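/- Let $\mathcal H$ be a Hilbert space of finite dimension $n\ge 1$ (inner products linear in the second variable) and let $V\in\mathcal L(\mathcal H\otimes\mathcal H)$ be a multiplicative unitary, i.e. a unitary with $V_{12}V_{13}V_{23}=V_{23}V_{12}$. A vector $\xi$ is called fixed (resp. cofixed) for $V$ if $V(\xi\otimes\eta)=\xi\otimes\eta$ (resp. $V(\eta\otimes\xi)=\eta\otimes\xi$) for all $\eta\in\mathcal H$; the multiplicity of $V$ is the dimension of its space of fixed vectors. The algebras associated with $V$ are $S=\{(\omega\otimes\mathrm{id})(V):\omega\in\mathcal L(\mathcal H)^*\}$ and $\widehat S=\{(\mathrm{id}\otimes\omega)(V):\omega\in\mathcal L(\mathcal H)^*\}$. Assume that $V$ has multiplicity $1$, let $e$ be a fixed and $\hat e$ a cofixed vector of $V$, both of norm $1$, with $\langle e,\hat e\rangle=n^{-1/2}$, and let $U\in\mathcal L(\mathcal H)$ be the operator $xe\mapsto\kappa(x)e$ $(x\in S)$, where $\kappa$ is the antipode $(\omega\otimes\mathrm{id})(V)\mapsto(\omega\otimes\mathrm{id})(V^*)$ of $S$. A pre-subgroup of $V$ is a vector $f\in\mathcal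 H$ with $\|f\|=1$, $\langle f,e\rangle>0$ and $V(f\otimes f)=f\otimes f$. For a pre-subgroup $f$ put $H_f=\{\eta: V(\eta\otimes f)=\eta\otimes f\}$, $H^f=\{\eta: V(f\otimes\eta)=f\otimes\eta\}$ and $$G_f=\{x\in S: xe\in H_f\},\quad D_f=\{x\in S: xe\in UH_f\},\quad \widehat D_f=\{y\in\widehat S: y\hat e\in H^f\},\quad \widehat G_f=\{y\in\widehat S: y\hat e\in UH^f\}.$$ For pre-subgroups $f,g$ let $A_{g,f}$ be the linear span of $\{xy: x\in U\widehat D_gU,\ y\in G_f\}$ and $B_{f,g}$ the linear span of $\{xy: x\in D_f,\ y\in\widehat G_g\}$. Theorem. Let $f$ and $g$ be pre-subgroups of $V$ with $\langle f,g\rangle=n^{-1/2}$. Then there is one and only one multiplicative unitary $W\in\mathcal L(\mathcal H\otimes\mathcal H)$ of multiplicity $1$ for which $g$ is fixed and $f$ is cofixed and whose associated algebras $S$ and $\widehat S$ are $A_{f,f}$ and $B_{g,g}$ respectively. -/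

import Mathlib

open scoped TensorProduct ComplexOrder

noncomputable section

namespace MultUnitary

variable {H : Type*} [NormedAddCommGroup H] [InnerProductSpace ℂ H]

/-! ### Multiplicative unitaries

A unitary on `H ⊗ H` is a linear isometric equivalence `V : H ⊗ H ≃ₗᵢ H ⊗ H`; its adjoint is
`V.symm`. As in Mathlib, the inner product is linear in the second variable. -/

/-- `V` as an element of the algebra of operators on `H ⊗ H`. -/
def op (V : (H ⊗[ℂ] H) ≃ₗᵢ[ℂ] (H ⊗[ℂ] H)) : Module.End ℂ (H ⊗[ℂ] H) :=
  V.toLinearEquiv.toLinearMap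

/-- `T₁₂ = T ⊗ 1` on `H ⊗ H ⊗ H`. -/
def leg12 (T : Module.End ℂ (H ⊗[ℂ] H)) : Module.End ℂ (H ⊗[ℂ] (H ⊗[ℂ] H)) :=
  (TensorProduct.assoc ℂ H H H).toLinearMap ∘ₗ T.rTensor H ∘ₗ
    (TensorProduct.assoc ℂ H H H).symm.toLinearMap

/-- `T₂₃ = 1 ⊗ T` on `H ⊗ H ⊗ H`. -/
def leg23 (T : Module.End ℂ (H ⊗[ℂ] H)) : Module.End ℂ (H ⊗[ℂ] (H ⊗[ℂ] H)) :=
  T.lTensor H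

/-- `T₁₃`: the operator `T₁₂` conjugated by the flip of the second and third factors. -/
def leg13 (T : Module.End ℂ (H ⊗[ℂ] H)) : Module.End ℂ (H ⊗[ℂ] (H ⊗[ℂ] H)) :=
  (TensorProduct.comm ℂ H H).toLinearMap.lTensor H ∘ₗ leg12 T ∘ₗ
    (TensorProduct.comm ℂ H H).toLinearMap.lTensor H

/-- The pentagon relation `V₁₂ V₁₃ V₂₃ = V₂₃ V₁₂`. -/
def IsMultiplicative (V : (H ⊗[ℂ] H) ≃ₗᵢ[ℂ] (H ⊗[ℂ] H)) : Prop :=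
  leg12 (op V) * leg13 (op V) * leg23 (op V) = leg23 (op V) * leg12 (op V)

/-- `ξ` is fixed: `V (ξ ⊗ η) = ξ ⊗ η` for all `η`. -/
def IsFixed (V : (H ⊗[ℂ] H) ≃ₗᵢ[ℂ] (H ⊗[ℂ] H)) (ξ : H) : Prop :=
  ∀ η : H, V (ξ ⊗ₜ[ℂ] η) = ξ ⊗ₜ[ℂ] η

/-- `ξ` is cofixed: `V (η ⊗ ξ) = η ⊗ ξ` for all `η`. -/
def IsCofixed (V : (H ⊗[ℂ] H) ≃ₗᵢ[ℂ] (H ⊗[ℂ] H)) (ξ : H) : Prop :=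
  ∀ η : H, V (η ⊗ₜ[ℂ] ξ) = η ⊗ₜ[ℂ] ξ

/-- The space `H_ξ` of all `η` with `V (η ⊗ ξ) = η ⊗ ξ`. -/
def lowerSpace (V : (H ⊗[ℂ] H) ≃ₗᵢ[ℂ] (H ⊗[ℂ] H)) (ξ : H) : Submodule ℂ H where
  carrier := {η | V (η ⊗ₜ[ℂ] ξ) = η ⊗ₜ[ℂ] ξ}
  add_mem' := by
    intro a b ha hb
    simp only [Set.mem_ofPred_eq] at ha hb ⊢
    rw [TensorProduct.add_tmul, map_add, ha, hb]
  zero_mem' := by simp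
  smul_mem' := by
    intro c a ha
    simp only [Set.mem_ofPred_eq] at ha ⊢
    rw [← TensorProduct.smul_tmul', map_smul, ha]

/-- The space `H^ξ` of all `η` with `V (ξ ⊗ η) = ξ ⊗ η`. -/
def upperSpace (V : (H ⊗[ℂ] H) ≃ₗᵢ[ℂ] (H ⊗[ℂ] H)) (ξ : H) : Submodule ℂ H where
  carrier := {η | V (ξ ⊗ₜ[ℂ] η) = ξ ⊗ₜ[ℂ] η}
  add_mem' := by
    intro a b ha hb
    simp only [Set.mem_ofPred_eq] at ha hb ⊢
    rw [TensorProduct.tmul_add, map_add, ha, hb]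
  zero_mem' := by simp
  smul_mem' := by
    intro c a ha
    simp only [Set.mem_ofPred_eq] at ha ⊢
    rw [TensorProduct.tmul_smul, map_smul, ha]

/-- The space of fixed vectors. -/
def fixedSpace (V : (H ⊗[ℂ] H) ≃ₗᵢ[ℂ] (H ⊗[ℂ] H)) : Submodule ℂ H :=
  ⨅ η : H, lowerSpace V η

theorem mem_fixedSpace (V : (H ⊗[ℂ] H) ≃ₗᵢ[ℂ] (H ⊗[ℂ] H)) (ξ : H) :
    ξ ∈ fixedSpace V ↔ IsFixed V ξ := by
  simp only [fixedSpace, Submodule.mem_iInf]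
  rfl

/-- The multiplicity: the dimension of the space of fixed vectors. -/
def multiplicity (V : (H ⊗[ℂ] H) ≃ₗᵢ[ℂ] (H ⊗[ℂ] H)) : ℕ :=
  Module.finrank ℂ (fixedSpace V)

/-! ### The associated algebras -/

variable [FiniteDimensional ℂ H]

/-- The slice map `ω ⊗ id` on operators on `H ⊗ H`, for a linear form `ω` on operators on `H`. -/
def sliceLeft (ω : Module.Dual ℂ (Module.End ℂ H)) :
    Module.End ℂ (H ⊗[ℂ] H) →ₗ[ℂ] Module.End ℂ H :=
  (TensorProduct.lid ℂ (Module.End ℂ H)).toLinearMap ∘ₗ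
    LinearMap.rTensor (Module.End ℂ H) ω ∘ₗ (homTensorHomEquiv ℂ H H H H).symm.toLinearMap

/-- The slice map `id ⊗ ω`. -/
def sliceRight (ω : Module.Dual ℂ (Module.End ℂ H)) :
    Module.End ℂ (H ⊗[ℂ] H) →ₗ[ℂ] Module.End ℂ H :=
  (TensorProduct.rid ℂ (Module.End ℂ H)).toLinearMap ∘ₗ
    LinearMap.lTensor (Module.End ℂ H) ω ∘ₗ (homTensorHomEquiv ℂ H H H H).symm.toLinearMap

theorem sliceLeft_map (ω : Module.Dual ℂ (Module.End ℂ H)) (a b : Module.End ℂ H) :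
    sliceLeft ω (TensorProduct.map a b) = ω a • b := by
  have h : (homTensorHomEquiv ℂ H H H H).symm (TensorProduct.map a b) = a ⊗ₜ[ℂ] b := by
    rw [LinearEquiv.symm_apply_eq, homTensorHomEquiv_apply]
    rfl
  simp [sliceLeft, h]

theorem sliceRight_map (ω : Module.Dual ℂ (Module.End ℂ H)) (a b : Module.End ℂ H) :
    sliceRight ω (TensorProduct.map a b) = ω b • a := by
  have h : (homTensorHomEquiv ℂ H H H H).symm (TensorProduct.map a b) = a ⊗ₜ[ℂ] b := by
    rw [LinearEquiv.symm_apply_eq, homTensorHomEquiv_apply]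
    rfl
  simp [sliceRight, h]

/-- The algebra `S`: all `L(ω) = (ω ⊗ id)(V)`. -/
def algS (V : (H ⊗[ℂ] H) ≃ₗᵢ[ℂ] (H ⊗[ℂ] H)) : Submodule ℂ (Module.End ℂ H) :=
  Submodule.span ℂ {x | ∃ ω : Module.Dual ℂ (Module.End ℂ H), x = sliceLeft ω (op V)}

/-- The algebra `Ŝ`: all `ρ(ω) = (id ⊗ ω)(V)`. -/
def algSHat (V : (H ⊗[ℂ] H) ≃ₗᵢ[ℂ] (H ⊗[ℂ] H)) : Submodule ℂ (Module.End ℂ H) :=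
  Submodule.span ℂ {x | ∃ ω : Module.Dual ℂ (Module.End ℂ H), x = sliceRight ω (op V)}

/-- The defining set of `S` is already a linear subspace, so that the span adds nothing. -/
theorem mem_algS (V : (H ⊗[ℂ] H) ≃ₗᵢ[ℂ] (H ⊗[ℂ] H)) (x : Module.End ℂ H) :
    x ∈ algS V ↔ ∃ ω : Module.Dual ℂ (Module.End ℂ H), x = sliceLeft ω (op V) := by
  refine ⟨fun hx => ?_, fun hx => Submodule.subset_span hx⟩
  induction hx using Submodule.span_induction with
  | mem x h => exact h
  | zero => exact ⟨0, by simp [sliceLeft]⟩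
  | add x y _ _ hx hy =>
    obtain ⟨a, rfl⟩ := hx
    obtain ⟨b, rfl⟩ := hy
    exact ⟨a + b, by simp [sliceLeft, LinearMap.rTensor_add]⟩
  | smul c x _ hx =>
    obtain ⟨a, rfl⟩ := hx
    exact ⟨c • a, by simp [sliceLeft, LinearMap.rTensor_smul]⟩

/-- The defining set of `Ŝ` is already a linear subspace, so that the span adds nothing. -/
theorem mem_algSHat (V : (H ⊗[ℂ] H) ≃ₗᵢ[ℂ] (H ⊗[ℂ] H)) (x : Module.End ℂ H) :
    x ∈ algSHat V ↔ ∃ ω : Module.Dual ℂ (Module.End ℂ H), x = sliceRight ω (op V) := by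
  refine ⟨fun hx => ?_, fun hx => Submodule.subset_span hx⟩
  induction hx using Submodule.span_induction with
  | mem x h => exact h
  | zero => exact ⟨0, by simp [sliceRight]⟩
  | add x y _ _ hx hy =>
    obtain ⟨a, rfl⟩ := hx
    obtain ⟨b, rfl⟩ := hy
    exact ⟨a + b, by simp [sliceRight, LinearMap.lTensor_add]⟩
  | smul c x _ hx =>
    obtain ⟨a, rfl⟩ := hx
    exact ⟨c • a, by simp [sliceRight, LinearMap.lTensor_smul]⟩

/-- `U` is the operator `x e ↦ κ(x) e` (`x ∈ S`), where `κ` is the antipode of `S`, given by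
`κ((ω ⊗ id)(V)) = (ω ⊗ id)(V*)`. -/
def IsAntipodeOperator (V : (H ⊗[ℂ] H) ≃ₗᵢ[ℂ] (H ⊗[ℂ] H)) (e : H) (U : Module.End ℂ H) : Prop :=
  ∀ ω : Module.Dual ℂ (Module.End ℂ H),
    U (sliceLeft ω (op V) e) = sliceLeft ω (op V.symm) e

/-- The operator `U : x e ↦ κ(x) e`. If `V` is multiplicative of multiplicity one and `e` is a
nonzero fixed vector, then `e` is cyclic and separating for `S`, and `U` is the only operator with
`IsAntipodeOperator V e U`. -/
def antipodeOperator (V : (H ⊗[ℂ] H) ≃ₗᵢ[ℂ] (H ⊗[ℂ] H)) (e : H) : Module.End ℂ H :=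
  Classical.epsilon (IsAntipodeOperator V e)

/-! ### Pre-subgroups and the algebras attached to them -/

/-- A pre-subgroup of `V`, relative to the chosen fixed unit vector `e`. -/
structure IsPreSubgroup (V : (H ⊗[ℂ] H) ≃ₗᵢ[ℂ] (H ⊗[ℂ] H)) (e f : H) : Prop where
  norm_eq_one : ‖f‖ = 1
  inner_pos : 0 < inner ℂ f e
  invariant : V (f ⊗ₜ[ℂ] f) = f ⊗ₜ[ℂ] f

/-- The set of all `x ∈ S` with `x e ∈ H_f`, called `G_f`. -/
def algG (V : (H ⊗[ℂ] H) ≃ₗᵢ[ℂ] (H ⊗[ℂ] H)) (e f : H) : Set (Module.End ℂ H) :=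
  {x | x ∈ algS V ∧ x e ∈ lowerSpace V f}

/-- The set of all `x ∈ S` with `x e ∈ U H_f`, called `D_f`. -/
def algD (V : (H ⊗[ℂ] H) ≃ₗᵢ[ℂ] (H ⊗[ℂ] H)) (e f : H) : Set (Module.End ℂ H) :=
  {x | x ∈ algS V ∧ x e ∈ (lowerSpace V f).map (antipodeOperator V e)}

/-- The set of all `y ∈ Ŝ` with `y ê ∈ H^f`, called `D̂_f`. -/
def algDHat (V : (H ⊗[ℂ] H) ≃ₗᵢ[ℂ] (H ⊗[ℂ] H)) (ehat f : H) : Set (Module.End ℂ H) :=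
  {y | y ∈ algSHat V ∧ y ehat ∈ upperSpace V f}

/-- The set of all `y ∈ Ŝ` with `y ê ∈ U H^f`, called `Ĝ_f`. -/
def algGHat (V : (H ⊗[ℂ] H) ≃ₗᵢ[ℂ] (H ⊗[ℂ] H)) (e ehat f : H) : Set (Module.End ℂ H) :=
  {y | y ∈ algSHat V ∧ y ehat ∈ (upperSpace V f).map (antipodeOperator V e)}

/-- `A_{g,f}`: the span of the products `(U x U) y` with `x ∈ D̂_g` and `y ∈ G_f`. -/
def algA (V : (H ⊗[ℂ] H) ≃ₗᵢ[ℂ] (H ⊗[ℂ] H)) (e ehat g f : H) :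
    Submodule ℂ (Module.End ℂ H) :=
  Submodule.span ℂ {z | ∃ x ∈ algDHat V ehat g, ∃ y ∈ algG V e f,
    z = (antipodeOperator V e * x * antipodeOperator V e) * y}

/-- `B_{f,g}`: the span of the products `x y` with `x ∈ D_f` and `y ∈ Ĝ_g`. -/
def algB (V : (H ⊗[ℂ] H) ≃ₗᵢ[ℂ] (H ⊗[ℂ] H)) (e ehat f g : H) :
    Submodule ℂ (Module.End ℂ H) :=
  Submodule.span ℂ {z | ∃ x ∈ algD V e f, ∃ y ∈ algGHat V e ehat g, z = x * y}

end MultUnitary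

end

/-! Notation: Δ(x) = V(x ⊗ 1)V*, ε is the counit, p_f and p̂_f are the diagonal slices `slL (op V) f
f` and `slR (op V) f f`. For an invariant unit vector f they are the orthogonal projections onto H^f
and H_f.

General theory. With multiplicity one, e is separating and cyclic for S (`Std.eq_of_apply_e`,
`Std.exists_apply_e`), so S is a star-algebra of dimension n and x e ↦ x* e is antiunitary
(`Std.inner_invol_comm`). The same holds for ΣV*Σ, whose S is Ŝ and where e and ê change places, and
for `Std.opp`, which has the same S with the flipped coproduct; every result on V is reused on these
two.

Factorization. The hypothesis ⟨f, g⟩ = n^{-1/2} enters through the equality case of Cauchy–Schwarz: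
it forces ⟨f, e⟩⟨g, e⟩ = n^{-1/2} and makes p_g p_f the projection onto ê (`Pair.inner_mul_inner`,
`Pair.p_mul_p`). Consequently G_f and D_g are independent for the trace ⟨e, · e⟩, their dimensions
multiply to n, and S = G_f D_g (`Pair.mem_span_algG_mul_algD`). The projection Φ : ud ↦ ε(d)u of S
onto G_f, `phi`, turns V into a = (id ⊗ Φ)(V), which lies in Ĝ_g ⊗ G_f and is unitary
(`Pair.star_aa_mul_aa`). The same construction for the opposite of V, with f and g exchanged, then
flipped and starred, gives a unitary b. The solution is W = ba.

Pentagon. In W₁₂W₁₃W₂₃ = b₁₂(a₁₂b₁₃a₁₃b₂₃)a₂₃ the bracket equals (V₁₂b₁₃V₁₂*)(V₂₃a₁₂V₂₃*)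
(`Data.conj_b_mul_conj_a`). Since b₁₂(V₁₂b₁₃V₁₂*) = b₂₃b₁₂ and (V₂₃a₁₂V₂₃*)a₂₃ = a₂₃a₁₂, and b₁₂
commutes with a₂₃, the result is W₂₃W₁₂. The identity for the bracket is only visible after a fourth
leg is added by s ↦ (1 ⊗ p_f)Δ(s)(p_g ⊗ 1), which is injective on S because it takes ud to u p_g ⊗
p_f d.

Algebras and uniqueness. The legs of a and b give the inclusions of the algebras of W in A_{f,f} and
B_{g,g}, and counting dimensions gives equality. A standard unitary is determined by its two
distinguished vectors and its two algebras (`Std.eq_of_algS_eq`). -/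

noncomputable section

namespace MultUnitary

variable {H : Type*} [NormedAddCommGroup H] [InnerProductSpace ℂ H]

/-! ### Partial inner products and insertions -/

section Bra

variable {K : Type*} [AddCommGroup K] [Module ℂ K]

/-- `⟨ζ| ⊗ 1`. -/
def braL (ζ : H) : H ⊗[ℂ] K →ₗ[ℂ] K :=
  (TensorProduct.lid ℂ K).toLinearMap ∘ₗ (innerₛₗ ℂ ζ).rTensor K

/-- `1 ⊗ ⟨ζ|`. -/
def braR (ζ : H) : K ⊗[ℂ] H →ₗ[ℂ] K :=
  (TensorProduct.rid ℂ K).toLinearMap ∘ₗ (innerₛₗ ℂ ζ).lTensor K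

@[simp] theorem braL_tmul (ζ ξ : H) (k : K) : braL ζ (ξ ⊗ₜ[ℂ] k) = inner ℂ ζ ξ • k := by
  simp [braL]

@[simp] theorem braR_tmul (ζ ξ : H) (k : K) : braR ζ (k ⊗ₜ[ℂ] ξ) = inner ℂ ζ ξ • k := by
  simp [braR]

theorem braL_add (ζ ζ' : H) (z : H ⊗[ℂ] K) : braL (ζ + ζ') z = braL ζ z + braL ζ' z := by
  induction z with
  | zero => simp
  | tmul x y => simp [add_smul]
  | add x y hx hy => simp only [map_add, hx, hy]; abel

theorem braL_smul (c : ℂ) (ζ : H) (z : H ⊗[ℂ] K) :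
    braL (c • ζ) z = (starRingEnd ℂ c) • braL ζ z := by
  induction z with
  | zero => simp
  | tmul x y => simp [smul_smul, mul_comm]
  | add x y hx hy => simp only [map_add, hx, hy, smul_add]

theorem braR_add (ζ ζ' : H) (z : K ⊗[ℂ] H) : braR (ζ + ζ') z = braR ζ z + braR ζ' z := by
  induction z with
  | zero => simp
  | tmul x y => simp [add_smul]
  | add x y hx hy => simp only [map_add, hx, hy]; abel

theorem braR_smul (c : ℂ) (ζ : H) (z : K ⊗[ℂ] H) :
    braR (c • ζ) z = (starRingEnd ℂ c) • braR ζ z := by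
  induction z with
  | zero => simp
  | tmul x y => simp [smul_smul, mul_comm]
  | add x y hx hy => simp only [map_add, hx, hy, smul_add]

theorem braL_lTensor {K' : Type*} [AddCommGroup K'] [Module ℂ K'] (ζ : H) (T : K →ₗ[ℂ] K')
    (z : H ⊗[ℂ] K) : braL ζ (T.lTensor H z) = T (braL ζ z) := by
  induction z with
  | zero => simp
  | tmul x y => simp
  | add x y hx hy => simp only [map_add, hx, hy]

theorem braR_rTensor {K' : Type*} [AddCommGroup K'] [Module ℂ K'] (ζ : H) (T : K →ₗ[ℂ] K')
    (z : K ⊗[ℂ] H) : braR ζ (T.rTensor H z) = T (braR ζ z) := by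
  induction z with
  | zero => simp
  | tmul x y => simp
  | add x y hx hy => simp only [map_add, hx, hy]

theorem braL_comm (ζ : H) (z : K ⊗[ℂ] H) :
    braL ζ (TensorProduct.comm ℂ K H z) = braR ζ z := by
  induction z with
  | zero => simp
  | tmul x y => simp
  | add x y hx hy => simp only [map_add, hx, hy]

theorem braR_comm (ζ : H) (z : H ⊗[ℂ] K) :
    braR ζ (TensorProduct.comm ℂ H K z) = braL ζ z := by
  induction z with
  | zero => simp
  | tmul x y => simp
  | add x y hx hy => simp only [map_add, hx, hy]

end Bra

section BraInner

variable {K : Type*} [NormedAddCommGroup K] [InnerProductSpace ℂ K]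

theorem inner_braL (ζ : H) (k : K) (z : H ⊗[ℂ] K) :
    inner ℂ k (braL ζ z) = inner ℂ (ζ ⊗ₜ[ℂ] k) z := by
  induction z with
  | zero => simp
  | tmul x y => simp [TensorProduct.inner_tmul]
  | add x y hx hy => simp only [map_add, hx, hy, inner_add_right]

theorem inner_braR (ζ : H) (k : K) (z : K ⊗[ℂ] H) :
    inner ℂ k (braR ζ z) = inner ℂ (k ⊗ₜ[ℂ] ζ) z := by
  induction z with
  | zero => simp
  | tmul x y => simp [TensorProduct.inner_tmul, mul_comm]
  | add x y hx hy => simp only [map_add, hx, hy, inner_add_right]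

theorem ext_braL {z w : H ⊗[ℂ] K} (h : ∀ ζ, braL ζ z = braL ζ w) : z = w := by
  rw [TensorProduct.ext_iff_inner_left]
  intro a b
  rw [← inner_braL, ← inner_braL, h]

theorem ext_braR {z w : K ⊗[ℂ] H} (h : ∀ ζ, braR ζ z = braR ζ w) : z = w := by
  rw [TensorProduct.ext_iff_inner_left]
  intro a b
  rw [← inner_braR, ← inner_braR, h]

theorem braL_rTensor [FiniteDimensional ℂ H] (ζ : H) (T : Module.End ℂ H) (z : H ⊗[ℂ] K) :
    braL ζ (T.rTensor K z) = braL (star T ζ) z := by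
  induction z with
  | zero => simp
  | tmul x y => simp [LinearMap.star_eq_adjoint, LinearMap.adjoint_inner_left]
  | add x y hx hy => simp only [map_add, hx, hy]

theorem braR_lTensor [FiniteDimensional ℂ H] (ζ : H) (T : Module.End ℂ H) (z : K ⊗[ℂ] H) :
    braR ζ (T.lTensor K z) = braR (star T ζ) z := by
  induction z with
  | zero => simp
  | tmul x y => simp [LinearMap.star_eq_adjoint, LinearMap.adjoint_inner_left]
  | add x y hx hy => simp only [map_add, hx, hy]

theorem sum_tmul_braL {ι : Type*} [Fintype ι] (ε : OrthonormalBasis ι ℂ H) (z : H ⊗[ℂ] K) :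
    z = ∑ i, ε i ⊗ₜ[ℂ] braL (ε i) z := by
  induction z with
  | zero => simp
  | tmul x y =>
    simp only [braL_tmul, ← TensorProduct.smul_tmul, ← TensorProduct.sum_tmul]
    rw [ε.sum_repr' x]
  | add x y hx hy =>
    simp only [map_add, TensorProduct.tmul_add, Finset.sum_add_distrib, ← hx, ← hy]

theorem sum_tmul_braR {ι : Type*} [Fintype ι] (ε : OrthonormalBasis ι ℂ H) (z : K ⊗[ℂ] H) :
    z = ∑ i, braR (ε i) z ⊗ₜ[ℂ] ε i := by
  induction z with
  | zero => simp
  | tmul x y =>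
    simp only [braR_tmul, TensorProduct.smul_tmul, ← TensorProduct.tmul_sum]
    rw [ε.sum_repr' y]
  | add x y hx hy =>
    simp only [map_add, TensorProduct.add_tmul, Finset.sum_add_distrib, ← hx, ← hy]

end BraInner

/-- Insertion of `θ` as a last factor. -/
def insR (θ : H) : H ⊗[ℂ] H →ₗ[ℂ] H ⊗[ℂ] (H ⊗[ℂ] H) :=
  (TensorProduct.assoc ℂ H H H).toLinearMap ∘ₗ (TensorProduct.mk ℂ (H ⊗[ℂ] H) H).flip θ

/-- Insertion of `η` as a middle factor. -/
def insM (η : H) : H ⊗[ℂ] H →ₗ[ℂ] H ⊗[ℂ] (H ⊗[ℂ] H) :=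
  (TensorProduct.mk ℂ H H η).lTensor H

@[simp] theorem insR_tmul (ξ η θ : H) : insR θ (ξ ⊗ₜ[ℂ] η) = ξ ⊗ₜ[ℂ] (η ⊗ₜ[ℂ] θ) := by
  simp [insR]

@[simp] theorem insM_tmul (ξ η θ : H) : insM η (ξ ⊗ₜ[ℂ] θ) = ξ ⊗ₜ[ℂ] (η ⊗ₜ[ℂ] θ) := by
  simp [insM]

/-- `⟨ζ|` on the middle factor. -/
abbrev bra2 (ζ : H) : H ⊗[ℂ] (H ⊗[ℂ] H) →ₗ[ℂ] H ⊗[ℂ] H := (braL ζ).lTensor H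

/-- `⟨ζ|` on the last factor. -/
abbrev bra3 (ζ : H) : H ⊗[ℂ] (H ⊗[ℂ] H) →ₗ[ℂ] H ⊗[ℂ] H := (braR ζ).lTensor H

theorem leg23_tmul (T : Module.End ℂ (H ⊗[ℂ] H)) (ξ : H) (w : H ⊗[ℂ] H) :
    leg23 T (ξ ⊗ₜ[ℂ] w) = ξ ⊗ₜ[ℂ] T w := rfl

theorem leg12_insR (T : Module.End ℂ (H ⊗[ℂ] H)) (θ : H) (z : H ⊗[ℂ] H) :
    leg12 T (insR θ z) = insR θ (T z) := by
  simp [leg12, insR]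

theorem leg12_tmul (T : Module.End ℂ (H ⊗[ℂ] H)) (ξ η θ : H) :
    leg12 T (ξ ⊗ₜ[ℂ] (η ⊗ₜ[ℂ] θ)) = insR θ (T (ξ ⊗ₜ[ℂ] η)) := by
  rw [← leg12_insR, insR_tmul]

theorem comm_insR (θ : H) (z : H ⊗[ℂ] H) :
    (TensorProduct.comm ℂ H H).toLinearMap.lTensor H (insR θ z) = insM θ z := by
  induction z with
  | zero => simp
  | tmul x y => simp
  | add x y hx hy => simp only [map_add, hx, hy]

theorem leg13_tmul (T : Module.End ℂ (H ⊗[ℂ] H)) (ξ η θ : H) :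
    leg13 T (ξ ⊗ₜ[ℂ] (η ⊗ₜ[ℂ] θ)) = insM η (T (ξ ⊗ₜ[ℂ] θ)) := by
  rw [← comm_insR]
  simp [leg13, leg12_tmul]

theorem leg13_insM (T : Module.End ℂ (H ⊗[ℂ] H)) (η : H) (z : H ⊗[ℂ] H) :
    leg13 T (insM η z) = insM η (T z) := by
  induction z with
  | zero => simp
  | tmul x y => rw [insM_tmul, leg13_tmul]
  | add x y hx hy => simp only [map_add, hx, hy]

/-- Linear maps on a triple tensor product agree if they agree on pure tensors. -/
theorem ext3 {K : Type*} [AddCommGroup K] [Module ℂ K]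
    {S T : H ⊗[ℂ] (H ⊗[ℂ] H) →ₗ[ℂ] K}
    (h : ∀ ξ η θ : H, S (ξ ⊗ₜ[ℂ] (η ⊗ₜ[ℂ] θ)) = T (ξ ⊗ₜ[ℂ] (η ⊗ₜ[ℂ] θ))) : S = T := by
  refine TensorProduct.ext' fun ξ z => ?_
  induction z with
  | zero => simp
  | tmul x y => exact h _ _ _
  | add x y hx hy => simp only [TensorProduct.tmul_add, map_add, hx, hy]

theorem bra1_insR (ζ θ : H) (z : H ⊗[ℂ] H) : braL ζ (insR θ z) = (braL ζ z) ⊗ₜ[ℂ] θ := by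
  induction z with
  | zero => simp
  | tmul x y => simp [TensorProduct.smul_tmul']
  | add x y hx hy => simp only [map_add, hx, hy, TensorProduct.add_tmul]

theorem bra1_insM (ζ η : H) (z : H ⊗[ℂ] H) : braL ζ (insM η z) = η ⊗ₜ[ℂ] (braL ζ z) := by
  rw [insM, braL_lTensor]; rfl

theorem bra2_insR (ζ θ : H) (z : H ⊗[ℂ] H) : bra2 ζ (insR θ z) = (braR ζ z) ⊗ₜ[ℂ] θ := by
  induction z with
  | zero => simp
  | tmul x y => simp [TensorProduct.smul_tmul']
  | add x y hx hy => simp only [map_add, hx, hy, TensorProduct.add_tmul]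

theorem bra2_insM (ζ η : H) (z : H ⊗[ℂ] H) : bra2 ζ (insM η z) = inner ℂ ζ η • z := by
  induction z with
  | zero => simp
  | tmul x y => simp
  | add x y hx hy => simp only [map_add, hx, hy, smul_add]

theorem bra3_insR (ζ θ : H) (z : H ⊗[ℂ] H) : bra3 ζ (insR θ z) = inner ℂ ζ θ • z := by
  induction z with
  | zero => simp
  | tmul x y => simp
  | add x y hx hy => simp only [map_add, hx, hy, smul_add]

theorem bra3_insM (ζ η : H) (z : H ⊗[ℂ] H) : bra3 ζ (insM η z) = (braR ζ z) ⊗ₜ[ℂ] η := by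
  induction z with
  | zero => simp
  | tmul x y => simp [TensorProduct.smul_tmul']
  | add x y hx hy => simp only [map_add, hx, hy, TensorProduct.add_tmul]

theorem bra1_leg23 (T : Module.End ℂ (H ⊗[ℂ] H)) (ζ : H) (z : H ⊗[ℂ] (H ⊗[ℂ] H)) :
    braL ζ (leg23 T z) = T (braL ζ z) := braL_lTensor _ _ _

theorem bra2_leg13 (T : Module.End ℂ (H ⊗[ℂ] H)) (ζ : H) (z : H ⊗[ℂ] (H ⊗[ℂ] H)) :
    bra2 ζ (leg13 T z) = T (bra2 ζ z) := by
  suffices h : bra2 ζ ∘ₗ leg13 T = T ∘ₗ bra2 ζ from LinearMap.congr_fun h z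
  refine ext3 fun ξ η θ => ?_
  simp only [LinearMap.comp_apply, leg13_tmul, bra2_insM]
  simp

theorem bra3_leg12 (T : Module.End ℂ (H ⊗[ℂ] H)) (ζ : H) (z : H ⊗[ℂ] (H ⊗[ℂ] H)) :
    bra3 ζ (leg12 T z) = T (bra3 ζ z) := by
  suffices h : bra3 ζ ∘ₗ leg12 T = T ∘ₗ bra3 ζ from LinearMap.congr_fun h z
  refine ext3 fun ξ η θ => ?_
  simp only [LinearMap.comp_apply, leg12_tmul, bra3_insR]
  simp

theorem braL_bra2 (ζ ζ' : H) (z : H ⊗[ℂ] (H ⊗[ℂ] H)) :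
    braL ζ (bra2 ζ' z) = braL ζ' (braL ζ z) := braL_lTensor _ _ _

theorem braL_bra3 (ζ ζ' : H) (z : H ⊗[ℂ] (H ⊗[ℂ] H)) :
    braL ζ (bra3 ζ' z) = braR ζ' (braL ζ z) := braL_lTensor _ _ _

theorem braR_bra2 (ζ ζ' : H) (z : H ⊗[ℂ] (H ⊗[ℂ] H)) :
    braR ζ (bra2 ζ' z) = braR ζ' (bra3 ζ z) := by
  suffices h : braR ζ ∘ₗ bra2 ζ' = braR ζ' ∘ₗ bra3 ζ from LinearMap.congr_fun h z
  refine ext3 fun ξ η θ => ?_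
  simp [smul_smul, mul_comm]

theorem leg12_mul (S T : Module.End ℂ (H ⊗[ℂ] H)) : leg12 (S * T) = leg12 S * leg12 T := by
  refine ext3 fun ξ η θ => ?_
  simp only [Module.End.mul_apply, leg12_tmul, leg12_insR]

theorem leg13_mul (S T : Module.End ℂ (H ⊗[ℂ] H)) : leg13 (S * T) = leg13 S * leg13 T := by
  refine ext3 fun ξ η θ => ?_
  simp only [Module.End.mul_apply, leg13_tmul, leg13_insM]

theorem leg23_mul (S T : Module.End ℂ (H ⊗[ℂ] H)) : leg23 (S * T) = leg23 S * leg23 T := by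
  refine TensorProduct.ext' fun ξ z => ?_
  simp only [Module.End.mul_apply, leg23_tmul]

@[simp] theorem leg12_one : leg12 (1 : Module.End ℂ (H ⊗[ℂ] H)) = 1 := by
  refine ext3 fun ξ η θ => ?_
  simp [leg12_tmul]

@[simp] theorem leg13_one : leg13 (1 : Module.End ℂ (H ⊗[ℂ] H)) = 1 := by
  refine ext3 fun ξ η θ => ?_
  simp [leg13_tmul]

@[simp] theorem leg23_one : leg23 (1 : Module.End ℂ (H ⊗[ℂ] H)) = 1 := by
  refine TensorProduct.ext' fun ξ z => ?_
  simp [leg23_tmul]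

/-! ### Slices -/

/-- The slice `(⟨ζ| ⊗ 1) T (|η⟩ ⊗ 1)`. -/
def slL (T : Module.End ℂ (H ⊗[ℂ] H)) (ζ η : H) : Module.End ℂ H :=
  braL ζ ∘ₗ T ∘ₗ TensorProduct.mk ℂ H H η

/-- The slice `(1 ⊗ ⟨ζ|) T (1 ⊗ |η⟩)`. -/
def slR (T : Module.End ℂ (H ⊗[ℂ] H)) (ζ η : H) : Module.End ℂ H :=
  braR ζ ∘ₗ T ∘ₗ (TensorProduct.mk ℂ H H).flip η

theorem slL_apply (T : Module.End ℂ (H ⊗[ℂ] H)) (ζ η θ : H) :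
    slL T ζ η θ = braL ζ (T (η ⊗ₜ[ℂ] θ)) := rfl

theorem slR_apply (T : Module.End ℂ (H ⊗[ℂ] H)) (ζ η θ : H) :
    slR T ζ η θ = braR ζ (T (θ ⊗ₜ[ℂ] η)) := rfl

theorem inner_slL (T : Module.End ℂ (H ⊗[ℂ] H)) (ζ η ζ' η' : H) :
    inner ℂ ζ' (slL T ζ η η') = inner ℂ (ζ ⊗ₜ[ℂ] ζ') (T (η ⊗ₜ[ℂ] η')) := by
  rw [slL_apply, inner_braL]

theorem inner_slR (T : Module.End ℂ (H ⊗[ℂ] H)) (ζ η ζ' η' : H) :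
    inner ℂ ζ' (slR T ζ η η') = inner ℂ (ζ' ⊗ₜ[ℂ] ζ) (T (η' ⊗ₜ[ℂ] η)) := by
  rw [slR_apply, inner_braR]

theorem slL_add_right (T : Module.End ℂ (H ⊗[ℂ] H)) (ζ η η' : H) :
    slL T ζ (η + η') = slL T ζ η + slL T ζ η' := by
  ext θ; simp [slL_apply, TensorProduct.add_tmul]

theorem slL_smul_right (T : Module.End ℂ (H ⊗[ℂ] H)) (c : ℂ) (ζ η : H) :
    slL T ζ (c • η) = c • slL T ζ η := by
  ext θ; simp [slL_apply, ← TensorProduct.smul_tmul']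

theorem slL_add_left (T : Module.End ℂ (H ⊗[ℂ] H)) (ζ ζ' η : H) :
    slL T (ζ + ζ') η = slL T ζ η + slL T ζ' η := by
  ext θ; simp [slL_apply, braL_add]

theorem ext_slR {S T : Module.End ℂ (H ⊗[ℂ] H)} (h : ∀ ζ η, slR S ζ η = slR T ζ η) : S = T :=
  TensorProduct.ext' fun ξ η => ext_braR fun ζ => LinearMap.congr_fun (h ζ η) ξ

/-- Resolution of the identity on both sides of the first factor. It reduces arbitrary operators on
H ⊗ H to elementary tensors and arbitrary functionals to vector functionals. -/
theorem eq_sum_map_slL [FiniteDimensional ℂ H] {ι : Type*} [Fintype ι]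
    (ε : OrthonormalBasis ι ℂ H) (T : Module.End ℂ (H ⊗[ℂ] H)) :
    T = ∑ i, ∑ j, TensorProduct.map ((innerₛₗ ℂ (ε j)).smulRight (ε i)) (slL T (ε i) (ε j)) := by
  refine TensorProduct.ext' fun ξ η => ?_
  conv_lhs => rw [sum_tmul_braL ε (T (ξ ⊗ₜ[ℂ] η)), ← ε.sum_repr' ξ]
  simp only [LinearMap.sum_apply, TensorProduct.map_tmul, LinearMap.smulRight_apply,
    innerₛₗ_apply_apply, TensorProduct.sum_tmul, map_sum, ← TensorProduct.smul_tmul', map_smul,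
    TensorProduct.tmul_sum, TensorProduct.tmul_smul, slL_apply]

theorem slL_mul [FiniteDimensional ℂ H] {ι : Type*} [Fintype ι]
    (ε : OrthonormalBasis ι ℂ H) (S T : Module.End ℂ (H ⊗[ℂ] H)) (ζ η : H) :
    slL (S * T) ζ η = ∑ i, slL S ζ (ε i) * slL T (ε i) η := by
  ext θ
  simp only [slL_apply, Module.End.mul_apply, LinearMap.sum_apply]
  conv_lhs => rw [sum_tmul_braL ε (T (η ⊗ₜ[ℂ] θ))]
  simp

end MultUnitary

end

noncomputable section

namespace MultUnitary

set_option linter.unusedSectionVars false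

variable {H : Type*} [NormedAddCommGroup H] [InnerProductSpace ℂ H]

theorem op_apply (V : (H ⊗[ℂ] H) ≃ₗᵢ[ℂ] (H ⊗[ℂ] H)) (z : H ⊗[ℂ] H) : op V z = V z := rfl

@[simp] theorem op_mul_op_symm (V : (H ⊗[ℂ] H) ≃ₗᵢ[ℂ] (H ⊗[ℂ] H)) : op V * op V.symm = 1 := by
  ext z; simp [op_apply]

@[simp] theorem op_symm_mul_op (V : (H ⊗[ℂ] H) ≃ₗᵢ[ℂ] (H ⊗[ℂ] H)) : op V.symm * op V = 1 := by
  ext z; simp [op_apply]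

theorem op_injective {V W : (H ⊗[ℂ] H) ≃ₗᵢ[ℂ] (H ⊗[ℂ] H)} (h : op V = op W) : V = W :=
  LinearIsometryEquiv.ext fun z => LinearMap.congr_fun h z

theorem inner_op (V : (H ⊗[ℂ] H) ≃ₗᵢ[ℂ] (H ⊗[ℂ] H)) (x y : H ⊗[ℂ] H) :
    inner ℂ x (op V y) = inner ℂ (op V.symm x) y :=
  (LinearIsometryEquiv.inner_map_eq_flip V.symm x y).symm

/-! ### Forms of the pentagon relation -/

section Pentagon

variable {V : (H ⊗[ℂ] H) ≃ₗᵢ[ℂ] (H ⊗[ℂ] H)}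

theorem leg12_inv (V : (H ⊗[ℂ] H) ≃ₗᵢ[ℂ] (H ⊗[ℂ] H)) :
    leg12 (op V) * leg12 (op V.symm) = 1 ∧ leg12 (op V.symm) * leg12 (op V) = 1 := by
  simp [← leg12_mul]

theorem leg13_inv (V : (H ⊗[ℂ] H) ≃ₗᵢ[ℂ] (H ⊗[ℂ] H)) :
    leg13 (op V) * leg13 (op V.symm) = 1 ∧ leg13 (op V.symm) * leg13 (op V) = 1 := by
  simp [← leg13_mul]

theorem leg23_inv (V : (H ⊗[ℂ] H) ≃ₗᵢ[ℂ] (H ⊗[ℂ] H)) :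
    leg23 (op V) * leg23 (op V.symm) = 1 ∧ leg23 (op V.symm) * leg23 (op V) = 1 := by
  simp [← leg23_mul]

theorem IsMultiplicative.mul_13_23 (h : IsMultiplicative V) :
    leg13 (op V) * leg23 (op V) = leg12 (op V.symm) * leg23 (op V) * leg12 (op V) := by
  rw [mul_assoc, ← h, ← mul_assoc, ← mul_assoc, (leg12_inv V).2, one_mul]

theorem IsMultiplicative.mul_12_13 (h : IsMultiplicative V) :
    leg12 (op V) * leg13 (op V) = leg23 (op V) * leg12 (op V) * leg23 (op V.symm) := by
  rw [← h, mul_assoc, mul_assoc, (leg23_inv V).1, mul_one]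

end Pentagon

/-! ### Fixed and cofixed vectors -/

section Fixed

variable {V : (H ⊗[ℂ] H) ≃ₗᵢ[ℂ] (H ⊗[ℂ] H)} {e ehat : H}

theorem IsFixed.op_apply (he : IsFixed V e) (η : H) : op V (e ⊗ₜ η) = e ⊗ₜ η := he η

theorem IsFixed.symm_apply (he : IsFixed V e) (η : H) : op V.symm (e ⊗ₜ η) = e ⊗ₜ η := by
  rw [MultUnitary.op_apply, V.symm_apply_eq]; exact (he η).symm

theorem IsCofixed.op_apply (he : IsCofixed V ehat) (η : H) : op V (η ⊗ₜ ehat) = η ⊗ₜ ehat := he η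

theorem IsCofixed.symm_apply (he : IsCofixed V ehat) (η : H) :
    op V.symm (η ⊗ₜ ehat) = η ⊗ₜ ehat := by
  rw [MultUnitary.op_apply, V.symm_apply_eq]; exact (he η).symm

theorem IsFixed.braL_op (he : IsFixed V e) (z : H ⊗[ℂ] H) : braL e (op V z) = braL e z := by
  refine ext_inner_left ℂ fun k => ?_
  rw [inner_braL, inner_braL, inner_op, he.symm_apply]

theorem IsCofixed.braR_op (he : IsCofixed V ehat) (z : H ⊗[ℂ] H) :
    braR ehat (op V z) = braR ehat z := by
  refine ext_inner_left ℂ fun k => ?_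
  rw [inner_braR, inner_braR, inner_op, he.symm_apply]

theorem IsCofixed.bra2_leg12 (he : IsCofixed V ehat) (z : H ⊗[ℂ] (H ⊗[ℂ] H)) :
    bra2 ehat (leg12 (op V) z) = bra2 ehat z := by
  suffices h : bra2 ehat ∘ₗ leg12 (op V) = bra2 ehat from LinearMap.congr_fun h z
  refine ext3 fun ξ η θ => ?_
  rw [LinearMap.comp_apply, leg12_tmul, bra2_insR, he.braR_op]
  simp [TensorProduct.smul_tmul']

theorem IsFixed.bra2_leg23 (he : IsFixed V e) (z : H ⊗[ℂ] (H ⊗[ℂ] H)) :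
    bra2 e (leg23 (op V) z) = bra2 e z := by
  suffices h : bra2 e ∘ₗ leg23 (op V) = bra2 e from LinearMap.congr_fun h z
  refine TensorProduct.ext' fun ξ w => ?_
  rw [LinearMap.comp_apply, leg23_tmul]
  simp [he.braL_op]

end Fixed

theorem slL_of_isFixed {V : (H ⊗[ℂ] H) ≃ₗᵢ[ℂ] (H ⊗[ℂ] H)} {e : H} (he : IsFixed V e) (η : H) :
    slL (op V) e η = inner ℂ e η • 1 := by
  ext θ
  rw [slL_apply, he.braL_op]
  simp

variable [FiniteDimensional ℂ H]

theorem star_slL (V : (H ⊗[ℂ] H) ≃ₗᵢ[ℂ] (H ⊗[ℂ] H)) (ζ η : H) :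
    star (slL (op V) ζ η) = slL (op V.symm) η ζ := by
  rw [LinearMap.star_eq_adjoint, eq_comm, LinearMap.eq_adjoint_iff]
  intro x y
  rw [inner_slL, ← inner_conj_symm, inner_slL, inner_op, V.symm_symm]
  exact inner_conj_symm (𝕜 := ℂ) (E := H ⊗[ℂ] H) _ _

theorem star_slR (V : (H ⊗[ℂ] H) ≃ₗᵢ[ℂ] (H ⊗[ℂ] H)) (ζ η : H) :
    star (slR (op V) ζ η) = slR (op V.symm) η ζ := by
  rw [LinearMap.star_eq_adjoint, eq_comm, LinearMap.eq_adjoint_iff]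
  intro x y
  rw [inner_slR, ← inner_conj_symm, inner_slR, inner_op, V.symm_symm]
  exact inner_conj_symm (𝕜 := ℂ) (E := H ⊗[ℂ] H) _ _

theorem inner_star_left (T : Module.End ℂ H) (x y : H) :
    inner ℂ (star T x) y = inner ℂ x (T y) := LinearMap.adjoint_inner_left _ _ _

theorem inner_star_right (T : Module.End ℂ H) (x y : H) :
    inner ℂ x (star T y) = inner ℂ (T x) y := LinearMap.adjoint_inner_right _ _ _

/-! ### Standard multiplicative unitaries -/

/-- A multiplicative unitary whose fixed vectors are the multiples of the unit vector `e`, with a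
cofixed unit vector `ê` such that `⟨e, ê⟩ = (dim H)^{-1/2}`. -/
structure Std (V : (H ⊗[ℂ] H) ≃ₗᵢ[ℂ] (H ⊗[ℂ] H)) (e ehat : H) : Prop where
  mult : IsMultiplicative V
  fixed : IsFixed V e
  cofixed : IsCofixed V ehat
  norm_e : ‖e‖ = 1
  norm_ehat : ‖ehat‖ = 1
  inner_eq : inner ℂ e ehat = (((√(Module.finrank ℂ H : ℝ))⁻¹ : ℝ) : ℂ)
  uniq : ∀ ξ, IsFixed V ξ → ξ ∈ Submodule.span ℂ {e}

namespace Std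

variable {V : (H ⊗[ℂ] H) ≃ₗᵢ[ℂ] (H ⊗[ℂ] H)} {e ehat : H}

/-- `(dim H)^{-1/2}`. -/
def scale (H : Type*) [NormedAddCommGroup H] [InnerProductSpace ℂ H] : ℝ :=
  (√(Module.finrank ℂ H : ℝ))⁻¹

theorem e_ne (h : Std V e ehat) : e ≠ 0 := by
  intro h0; simpa [h0] using h.norm_e

theorem inner_ee (h : Std V e ehat) : inner ℂ e e = 1 := by
  rw [inner_self_eq_norm_sq_to_K, h.norm_e]; simp

theorem inner_hh (h : Std V e ehat) : inner ℂ ehat ehat = 1 := by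
  rw [inner_self_eq_norm_sq_to_K, h.norm_ehat]; simp

theorem inner_e_ehat (h : Std V e ehat) : inner ℂ e ehat = (scale H : ℂ) := h.inner_eq

theorem inner_ehat_e (h : Std V e ehat) : inner ℂ ehat e = (scale H : ℂ) := by
  rw [← inner_conj_symm, h.inner_e_ehat, Complex.conj_ofReal]

theorem finrank_pos (h : Std V e ehat) : 0 < Module.finrank ℂ H :=
  Module.finrank_pos_iff_exists_ne_zero.2 ⟨e, h.e_ne⟩

theorem scale_pos (h : Std V e ehat) : 0 < scale H := by
  have := h.finrank_pos
  unfold scale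
  positivity

theorem scale_ne (h : Std V e ehat) : (scale H : ℂ) ≠ 0 := by
  exact_mod_cast h.scale_pos.ne'

theorem finrank_mul_scale_sq (h : Std V e ehat) : (Module.finrank ℂ H : ℝ) * scale H ^ 2 = 1 := by
  have := h.finrank_pos
  rw [scale, inv_pow, Real.sq_sqrt (by positivity)]
  field_simp

/-- `(1 ⊗ ⟨e|) V (1 ⊗ |e⟩) = |e⟩⟨e|`. -/
theorem braR_op_e (h : Std V e ehat) (η : H) :
    braR e (op V (η ⊗ₜ e)) = inner ℂ e η • e := by
  -- With P = `slR (op V) e e`, the relation V₁₂V₁₃ = V₂₃V₁₂V₂₃* on η ⊗ e ⊗ θ, paired with ⟨e| in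
  -- the middle, shows that P absorbs right slices from the right through their counit.
  have key : ∀ ζ θ η : H, slR (op V) e e (slR (op V) ζ θ η) = inner ℂ ζ θ • slR (op V) e e η := by
    intro ζ θ η
    have h1 := LinearMap.congr_fun h.mult.mul_12_13 (η ⊗ₜ (e ⊗ₜ θ))
    simp only [Module.End.mul_apply, leg13_tmul, leg23_tmul, h.fixed.symm_apply, leg12_tmul] at h1
    have h2 := congrArg (fun w => braR ζ (bra2 e w)) h1
    simp only [h.fixed.bra2_leg23, bra2_insR] at h2
    rw [braR_bra2, bra3_leg12, bra3_insM, braR_tmul] at h2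
    exact h2
  -- The adjoint form of `key`. Multiplicity one then puts the range of P* on the line of e, and P e
  -- = e settles the scalar.
  have hfix : ∀ ξ, IsFixed V (star (slR (op V) e e) ξ) := by
    intro ξ θ
    have : op V.symm (star (slR (op V) e e) ξ ⊗ₜ θ) = star (slR (op V) e e) ξ ⊗ₜ θ := by
      rw [TensorProduct.ext_iff_inner_left]
      intro η ζ
      have e1 : ∀ w : H ⊗[ℂ] H, inner ℂ w (star (slR (op V) e e) ξ ⊗ₜ[ℂ] θ) =
          starRingEnd ℂ (inner ℂ ξ (slR (op V) e e (braR θ w))) := fun w => by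
        rw [← inner_conj_symm w, ← inner_braR, inner_star_left]
      rw [inner_op, V.symm_symm, e1, e1, braR_tmul, map_smul]
      exact congrArg (fun w => starRingEnd ℂ (inner ℂ ξ w)) (key θ ζ η)
    rw [MultUnitary.op_apply, V.symm_apply_eq] at this
    exact this.symm
  have hPe : slR (op V) e e e = e := by
    rw [slR_apply, h.fixed.op_apply, braR_tmul, h.inner_ee, one_smul]
  change slR (op V) e e η = _
  refine ext_inner_left ℂ fun ξ => ?_
  obtain ⟨c, hc⟩ := Submodule.mem_span_singleton.1 (h.uniq _ (hfix ξ))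
  have h1 : inner ℂ (star (slR (op V) e e) ξ) e = inner ℂ ξ e := by rw [inner_star_left, hPe]
  rw [← hc, inner_smul_left, h.inner_ee, mul_one] at h1
  rw [← inner_star_left, ← hc, inner_smul_left, h1, inner_smul_right, mul_comm]

/-- The key inversion formula. -/
theorem braL_ehat_slL (h : Std V e ehat) (ζ η θ : H) :
    braL ehat (op V (slL (op V) ζ η e ⊗ₜ θ)) = (scale H : ℂ) • slL (op V) ζ η θ := by
  -- V₂₃ disappears on e ⊗ θ; pairing with ⟨ê| in the middle then removes V₁₂, and the remaining
  -- factor ⟨ê, e⟩ is n^{-1/2}.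
  have h1 := LinearMap.congr_fun h.mult (η ⊗ₜ (e ⊗ₜ θ))
  simp only [Module.End.mul_apply, leg13_tmul, leg23_tmul, h.fixed.op_apply, leg12_tmul] at h1
  have h2 := congrArg (fun w => braL ehat (braL ζ w)) h1
  simp only [bra1_leg23, bra1_insR] at h2
  rw [← braL_bra2, h.cofixed.bra2_leg12, bra2_insM, h.inner_ehat_e, map_smul] at h2
  exact h2.symm

end Std

/-- A unitary on a finite-dimensional space commutes with each projection whose range it
preserves. -/
theorem commute_proj {K : Type*} [NormedAddCommGroup K] [InnerProductSpace ℂ K]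
    [FiniteDimensional ℂ K] (V : K ≃ₗᵢ[ℂ] K) (p : Module.End ℂ K) (hp : p * p = p)
    (hs : star p = p) (hV : ∀ x, p (V (p x)) = V (p x)) (x : K) : p (V x) = V (p x) := by
  set M := LinearMap.range p with hM
  have hpM : ∀ y ∈ M, p y = y := by
    rintro _ ⟨y, rfl⟩; exact LinearMap.congr_fun hp y
  have hle : M.map (V.toLinearEquiv : K →ₗ[ℂ] K) ≤ M := by
    rintro _ ⟨_, ⟨y, rfl⟩, rfl⟩
    exact ⟨_, hV y⟩
  -- Equality of dimensions turns VM ⊆ M into VM = M, so V* preserves M as well; this replaces a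
  -- hypothesis on the adjoint.
  have hMV : M.map (V.toLinearEquiv : K →ₗ[ℂ] K) = M :=
    Submodule.eq_of_le_of_finrank_eq hle (LinearEquiv.finrank_map_eq V.toLinearEquiv M)
  have hsymm : ∀ y, p (V.symm (p y)) = V.symm (p y) := by
    intro y
    have : p y ∈ M.map (V.toLinearEquiv : K →ₗ[ℂ] K) := by rw [hMV]; exact ⟨y, rfl⟩
    obtain ⟨w, hw, hwy⟩ := this
    have : V.symm (p y) = w := by rw [V.symm_apply_eq]; exact hwy.symm
    rw [this, hpM w hw]
  refine ext_inner_left ℂ fun y => ?_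
  have hsp : ∀ a b : K, inner ℂ a (p b) = inner ℂ (p a) b := fun a b => by
    conv_lhs => rw [← hs]
    exact LinearMap.adjoint_inner_right _ _ _
  have hVs : ∀ a b : K, inner ℂ a (V b) = inner ℂ (V.symm a) b := fun a b =>
    (LinearIsometryEquiv.inner_map_eq_flip V.symm a b).symm
  rw [hsp, hVs, ← hsymm, ← hsp, ← hVs, ← hsp, hV]

end MultUnitary

end

noncomputable section

namespace MultUnitary

set_option linter.unusedSectionVars false

variable {H : Type*} [NormedAddCommGroup H] [InnerProductSpace ℂ H] [FiniteDimensional ℂ H]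

/-! ### The spaces of slices -/

theorem end_tensor_ext {M : Type*} [AddCommGroup M] [Module ℂ M]
    {F G : Module.End ℂ (H ⊗[ℂ] H) →ₗ[ℂ] M}
    (h : ∀ a b, F (TensorProduct.map a b) = G (TensorProduct.map a b)) : F = G := by
  ext T
  rw [eq_sum_map_slL (stdOrthonormalBasis ℂ H) T]
  simp only [map_sum, h]

theorem sliceLeft_mem_span (ω : Module.Dual ℂ (Module.End ℂ H)) (T : Module.End ℂ (H ⊗[ℂ] H)) :
    sliceLeft ω T ∈ Submodule.span ℂ (Set.range fun p : H × H => slL T p.1 p.2) := by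
  rw [eq_sum_map_slL (stdOrthonormalBasis ℂ H) T]
  simp only [map_sum, sliceLeft_map]
  rw [← eq_sum_map_slL (stdOrthonormalBasis ℂ H) T]
  exact Submodule.sum_mem _ fun i _ => Submodule.sum_mem _ fun j _ =>
    Submodule.smul_mem _ _ (Submodule.subset_span ⟨(_, _), rfl⟩)

theorem slL_eq_sliceLeft (T : Module.End ℂ (H ⊗[ℂ] H)) (ζ η : H) :
    slL T ζ η = sliceLeft ((innerₛₗ ℂ ζ) ∘ₗ LinearMap.applyₗ η) T := by
  have key : ∀ a b : Module.End ℂ H, slL (TensorProduct.map a b) ζ η =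
      sliceLeft ((innerₛₗ ℂ ζ) ∘ₗ LinearMap.applyₗ η) (TensorProduct.map a b) := by
    intro a b
    ext θ
    simp [slL_apply, sliceLeft_map]
  have hl : (LinearMap.lcomp ℂ H (TensorProduct.mk ℂ H H η)).comp
      (LinearMap.compRight ℂ (braL ζ) (M := H ⊗[ℂ] H)) =
      sliceLeft ((innerₛₗ ℂ ζ) ∘ₗ LinearMap.applyₗ η) := end_tensor_ext key
  exact LinearMap.congr_fun hl T

theorem slR_comm (T : Module.End ℂ (H ⊗[ℂ] H)) (ζ η : H) :
    slL ((TensorProduct.comm ℂ H H).toLinearMap ∘ₗ T ∘ₗ (TensorProduct.comm ℂ H H).toLinearMap)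
      ζ η = slR T ζ η := by
  ext θ
  simp [slL_apply, slR_apply, braL_comm]

theorem sliceLeft_comm (ω : Module.Dual ℂ (Module.End ℂ H)) (T : Module.End ℂ (H ⊗[ℂ] H)) :
    sliceLeft ω ((TensorProduct.comm ℂ H H).toLinearMap ∘ₗ T ∘ₗ
      (TensorProduct.comm ℂ H H).toLinearMap) = sliceRight ω T := by
  have hl : sliceLeft ω ∘ₗ (TensorProduct.comm ℂ H H).conj.toLinearMap = sliceRight ω := by
    refine end_tensor_ext fun a b => ?_
    have : (TensorProduct.comm ℂ H H).conj (TensorProduct.map a b) = TensorProduct.map b a := by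
      ext; simp [LinearEquiv.conj_apply]
    rw [LinearMap.comp_apply, LinearEquiv.coe_coe, this, sliceLeft_map, sliceRight_map]
  exact LinearMap.congr_fun hl T

theorem algS_eq_span (V : (H ⊗[ℂ] H) ≃ₗᵢ[ℂ] (H ⊗[ℂ] H)) :
    algS V = Submodule.span ℂ (Set.range fun p : H × H => slL (op V) p.1 p.2) := by
  refine le_antisymm (Submodule.span_le.2 ?_) (Submodule.span_le.2 ?_)
  · rintro _ ⟨ω, rfl⟩
    exact sliceLeft_mem_span _ _
  · rintro _ ⟨p, rfl⟩
    exact Submodule.subset_span ⟨_, slL_eq_sliceLeft _ _ _⟩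

theorem algSHat_eq_span (V : (H ⊗[ℂ] H) ≃ₗᵢ[ℂ] (H ⊗[ℂ] H)) :
    algSHat V = Submodule.span ℂ (Set.range fun p : H × H => slR (op V) p.1 p.2) := by
  refine le_antisymm (Submodule.span_le.2 ?_) (Submodule.span_le.2 ?_)
  · rintro _ ⟨ω, rfl⟩
    rw [← sliceLeft_comm]
    simp only [← slR_comm]
    exact sliceLeft_mem_span _ _
  · rintro _ ⟨p, rfl⟩
    exact Submodule.subset_span ⟨_, by
      simp only; rw [← slR_comm, slL_eq_sliceLeft, sliceLeft_comm]⟩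

theorem slL_mem (V : (H ⊗[ℂ] H) ≃ₗᵢ[ℂ] (H ⊗[ℂ] H)) (ζ η : H) : slL (op V) ζ η ∈ algS V := by
  rw [algS_eq_span]; exact Submodule.subset_span ⟨(ζ, η), rfl⟩

theorem slR_mem (V : (H ⊗[ℂ] H) ≃ₗᵢ[ℂ] (H ⊗[ℂ] H)) (ζ η : H) : slR (op V) ζ η ∈ algSHat V := by
  rw [algSHat_eq_span]; exact Submodule.subset_span ⟨(ζ, η), rfl⟩

theorem algS_le {V : (H ⊗[ℂ] H) ≃ₗᵢ[ℂ] (H ⊗[ℂ] H)} {N : Submodule ℂ (Module.End ℂ H)}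
    (hN : ∀ ζ η, slL (op V) ζ η ∈ N) : algS V ≤ N := by
  rw [algS_eq_span, Submodule.span_le]
  rintro _ ⟨p, rfl⟩
  exact hN _ _

theorem algSHat_le {V : (H ⊗[ℂ] H) ≃ₗᵢ[ℂ] (H ⊗[ℂ] H)} {N : Submodule ℂ (Module.End ℂ H)}
    (hN : ∀ ζ η, slR (op V) ζ η ∈ N) : algSHat V ≤ N := by
  rw [algSHat_eq_span, Submodule.span_le]
  rintro _ ⟨p, rfl⟩
  exact hN _ _

/-! ### S is a star-algebra -/

section Mult

variable {V : (H ⊗[ℂ] H) ≃ₗᵢ[ℂ] (H ⊗[ℂ] H)} {e ehat : H}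

/-- Slice V₁₃V₂₃ = V₁₂*V₂₃V₁₂ in the first two legs. Besides closing S under products, the explicit
right vectors on the right-hand side, `slL (op V) (ε i) ξ η`, are used in the proof that e is
cyclic. -/
theorem IsMultiplicative.slL_mul_slL (hV : IsMultiplicative V) {ι : Type*} [Fintype ι]
    (ε : OrthonormalBasis ι ℂ H) (ζ ξ ζ' η : H) :
    slL (op V) ζ ξ * slL (op V) ζ' η = ∑ i, ∑ j, inner ℂ ζ' (slL (op V.symm) ζ (ε i) (ε j)) •
      slL (op V) (ε j) (slL (op V) (ε i) ξ η) := by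
  ext θ
  have h1 := LinearMap.congr_fun hV.mul_13_23 (ξ ⊗ₜ (η ⊗ₜ θ))
  have h2 := congrArg (fun w => braL ζ (bra2 ζ' w)) h1
  have h3 : op V (ξ ⊗ₜ η) = ∑ i, ε i ⊗ₜ slL (op V) (ε i) ξ η := sum_tmul_braL ε _
  have h4 : ∀ i, op V (slL (op V) (ε i) ξ η ⊗ₜ θ) =
      ∑ j, ε j ⊗ₜ slL (op V) (ε j) (slL (op V) (ε i) ξ η) θ := fun i => sum_tmul_braL ε _
  simp only [Module.End.mul_apply, bra2_leg13, leg23_tmul, LinearMap.lTensor_tmul, leg12_tmul,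
    h3, map_sum, insR_tmul, h4, TensorProduct.tmul_sum, bra2_insR] at h2
  simp only [Module.End.mul_apply, LinearMap.sum_apply, LinearMap.smul_apply]
  refine (h2.trans ?_)
  refine Finset.sum_congr rfl fun i _ => Finset.sum_congr rfl fun j _ => ?_
  rw [braL_tmul, inner_braR, inner_slL]

theorem IsMultiplicative.mul_mem (hV : IsMultiplicative V) {x y : Module.End ℂ H}
    (hx : x ∈ algS V) (hy : y ∈ algS V) : x * y ∈ algS V := by
  have h1 : algS V ≤ (algS V).comap (LinearMap.mulRight ℂ y) := by
    refine algS_le fun ζ η => ?_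
    have h2 : algS V ≤ (algS V).comap (LinearMap.mulLeft ℂ (slL (op V) ζ η)) := by
      refine algS_le fun ζ' η' => ?_
      simp only [Submodule.mem_comap, LinearMap.mulLeft_apply]
      rw [hV.slL_mul_slL (stdOrthonormalBasis ℂ H)]
      exact Submodule.sum_mem _ fun i _ => Submodule.sum_mem _ fun j _ =>
        Submodule.smul_mem _ _ (slL_mem _ _ _)
    exact h2 hy
  exact h1 hx

theorem slL_one (ζ η : H) : slL (1 : Module.End ℂ (H ⊗[ℂ] H)) ζ η = inner ℂ ζ η • 1 := by
  ext θ; simp [slL_apply]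

/-- The operators all of whose left slices lie in S form a finite-dimensional space containing 1 and
stable under left multiplication by V. That multiplication is injective, hence onto, so V⁻¹ belongs
to the space. -/
theorem IsMultiplicative.slL_symm_mem (hV : IsMultiplicative V) (h1 : 1 ∈ algS V) (ζ η : H) :
    slL (op V.symm) ζ η ∈ algS V := by
  let B : Submodule ℂ (Module.End ℂ (H ⊗[ℂ] H)) :=
    { carrier := {z | ∀ ζ η, slL z ζ η ∈ algS V}
      add_mem' := fun {a b} ha hb ζ η => by
        have : slL (a + b) ζ η = slL a ζ η + slL b ζ η := by ext; simp [slL_apply]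
        rw [this]; exact Submodule.add_mem _ (ha _ _) (hb _ _)
      zero_mem' := fun ζ η => by
        have : slL (0 : Module.End ℂ (H ⊗[ℂ] H)) ζ η = 0 := by ext; simp [slL_apply]
        rw [this]; exact Submodule.zero_mem _
      smul_mem' := fun c a ha ζ η => by
        have : slL (c • a) ζ η = c • slL a ζ η := by ext; simp [slL_apply]
        rw [this]; exact Submodule.smul_mem _ _ (ha _ _) }
  have hB : ∀ z ∈ B, LinearMap.mulLeft ℂ (op V) z ∈ B := fun z hz ζ η => by
    rw [LinearMap.mulLeft_apply, slL_mul (stdOrthonormalBasis ℂ H)]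
    exact Submodule.sum_mem _ fun i _ => hV.mul_mem (slL_mem _ _ _) (hz _ _)
  have hinj : Function.Injective ((LinearMap.mulLeft ℂ (op V)).restrict hB) := by
    intro a b hab
    have := congrArg (fun w : B => op V.symm * w.1) hab
    simp only [LinearMap.coe_restrict_apply, LinearMap.mulLeft_apply, ← mul_assoc, op_symm_mul_op,
      one_mul] at this
    exact Subtype.ext this
  obtain ⟨z, hz⟩ := LinearMap.surjective_of_injective (V := B) hinj
    ⟨1, fun ζ η => by rw [slL_one]; exact Submodule.smul_mem _ _ h1⟩
  have hz' : op V * z.1 = 1 := congrArg Subtype.val hz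
  have : op V.symm = z.1 := by
    rw [← mul_one (op V.symm), ← hz', ← mul_assoc, op_symm_mul_op, one_mul]
  rw [this]
  exact z.2 _ _

theorem IsMultiplicative.star_mem (hV : IsMultiplicative V) (h1 : 1 ∈ algS V) {x : Module.End ℂ H}
    (hx : x ∈ algS V) : star x ∈ algS V := by
  rw [algS_eq_span] at hx
  induction hx using Submodule.span_induction with
  | mem x hx =>
    obtain ⟨p, rfl⟩ := hx
    simp only
    rw [star_slL]
    exact hV.slL_symm_mem h1 _ _
  | zero => simp
  | add x y _ _ hx hy => rw [star_add]; exact Submodule.add_mem _ hx hy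
  | smul c x _ hx => rw [star_smul]; exact Submodule.smul_mem _ _ hx

end Mult

/-! ### The vector e separates S -/

namespace Std

variable {V : (H ⊗[ℂ] H) ≃ₗᵢ[ℂ] (H ⊗[ℂ] H)} {e ehat : H}

theorem slL_e_e (h : Std V e ehat) : slL (op V) e e = 1 := by
  rw [slL_of_isFixed h.fixed, h.inner_ee, one_smul]

theorem one_mem (h : Std V e ehat) : 1 ∈ algS V := h.slL_e_e ▸ slL_mem V e e

theorem mul_mem (h : Std V e ehat) {x y : Module.End ℂ H}
    (hx : x ∈ algS V) (hy : y ∈ algS V) : x * y ∈ algS V := h.mult.mul_mem hx hy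

theorem star_mem (h : Std V e ehat) {x : Module.End ℂ H}
    (hx : x ∈ algS V) : star x ∈ algS V := h.mult.star_mem h.one_mem hx

theorem slL_symm_mem (h : Std V e ehat) (ζ η : H) : slL (op V.symm) ζ η ∈ algS V :=
  h.mult.slL_symm_mem h.one_mem ζ η

/-- The element of `S` taking `e` to a given vector. -/
def elt (V : (H ⊗[ℂ] H) ≃ₗᵢ[ℂ] (H ⊗[ℂ] H)) (ehat : H) : H →ₗ[ℂ] Module.End ℂ H :=
  (scale H : ℂ)⁻¹ • { toFun := slL (op V) ehat
                      map_add' := slL_add_right _ _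
                      map_smul' := fun c _ => slL_smul_right _ c _ _ }

theorem elt_apply (η : H) : elt V ehat η = (scale H : ℂ)⁻¹ • slL (op V) ehat η := rfl

theorem elt_mem (η : H) : elt V ehat η ∈ algS V := Submodule.smul_mem _ _ (slL_mem _ _ _)

/-- The left-hand side only involves the vector x e, so x can be recovered from it: this is what
makes e separating and `elt` its inverse. -/
theorem braL_ehat (h : Std V e ehat) {x : Module.End ℂ H} (hx : x ∈ algS V) (θ : H) :
    braL ehat (op V (x e ⊗ₜ θ)) = (scale H : ℂ) • x θ := by
  have : algS V ≤ LinearMap.eqLocus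
      ((braL ehat ∘ₗ op V ∘ₗ (TensorProduct.mk ℂ H H).flip θ) ∘ₗ LinearMap.applyₗ e)
      ((scale H : ℂ) • LinearMap.applyₗ θ) :=
    algS_le fun ζ η => h.braL_ehat_slL ζ η θ
  exact this hx

theorem elt_apply_e (h : Std V e ehat) {x : Module.End ℂ H} (hx : x ∈ algS V) :
    elt V ehat (x e) = x := by
  ext θ
  rw [elt_apply, LinearMap.smul_apply, slL_apply, h.braL_ehat hx, smul_smul,
    inv_mul_cancel₀ h.scale_ne, one_smul]

/-- `e` is separating for `S`. -/
theorem eq_of_apply_e (h : Std V e ehat) {x y : Module.End ℂ H} (hx : x ∈ algS V)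
    (hy : y ∈ algS V) (hxy : x e = y e) : x = y := by
  rw [← h.elt_apply_e hx, hxy, h.elt_apply_e hy]

end Std

end MultUnitary

end

/-! ### Cyclicity of e, the counit, and uniqueness of the cofixed vector -/

noncomputable section

namespace MultUnitary

set_option linter.unusedSectionVars false

variable {H : Type*} [NormedAddCommGroup H] [InnerProductSpace ℂ H] [FiniteDimensional ℂ H]

variable {V : (H ⊗[ℂ] H) ≃ₗᵢ[ℂ] (H ⊗[ℂ] H)} {e ehat : H}

theorem op_tmul_eq_sum {ι : Type*} [Fintype ι] (ε : OrthonormalBasis ι ℂ H)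
    (T : Module.End ℂ (H ⊗[ℂ] H)) (ξ η : H) :
    T (ξ ⊗ₜ η) = ∑ i, ε i ⊗ₜ slL T (ε i) ξ η := sum_tmul_braL ε _

/-- The coproduct of `S` on slices. -/
theorem IsMultiplicative.coproduct_slL (hV : IsMultiplicative V) {ι : Type*} [Fintype ι]
    (ε : OrthonormalBasis ι ℂ H) (ζ η : H) :
    op V * (slL (op V) ζ η).rTensor H * op V.symm =
      ∑ i, TensorProduct.map (slL (op V) ζ (ε i)) (slL (op V) (ε i) η) := by
  refine TensorProduct.ext' fun ξ θ => ?_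
  have h1 := congrArg (braL ζ) (LinearMap.congr_fun hV.mul_12_13 (η ⊗ₜ (ξ ⊗ₜ θ)))
  have h2 : ∀ w : H ⊗[ℂ] H, braL ζ (leg12 (op V) (η ⊗ₜ w)) = (slL (op V) ζ η).rTensor H w := by
    intro w
    induction w with
    | zero => simp
    | tmul x y => rw [leg12_tmul, bra1_insR]; rfl
    | add x y hx hy => simp only [TensorProduct.tmul_add, map_add, hx, hy]
  simp only [Module.End.mul_apply, bra1_leg23, leg23_tmul, h2, leg13_tmul,
    op_tmul_eq_sum ε (op V) η θ, map_sum, insM_tmul, leg12_tmul, bra1_insR] at h1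
  rw [LinearMap.sum_apply]
  exact h1.symm

theorem star_rTensor (T : Module.End ℂ H) : star (T.rTensor H) = (star T).rTensor H := by
  rw [LinearMap.star_eq_adjoint, LinearMap.adjoint_rTensor, LinearMap.star_eq_adjoint]

theorem star_lTensor (T : Module.End ℂ H) : star (T.lTensor H) = (star T).lTensor H := by
  rw [LinearMap.star_eq_adjoint, LinearMap.adjoint_lTensor, LinearMap.star_eq_adjoint]

theorem slL_comm_of_lTensor {T : Module.End ℂ (H ⊗[ℂ] H)} {z : Module.End ℂ H}
    (hz : ∀ x, z.lTensor H (T x) = T (z.lTensor H x)) (ζ η θ : H) :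
    z (slL T ζ η θ) = slL T ζ η (z θ) := by
  rw [slL_apply, ← braL_lTensor, hz, LinearMap.lTensor_tmul]; rfl

theorem slL_star_of_rTensor {T : Module.End ℂ (H ⊗[ℂ] H)} {z : Module.End ℂ H}
    (hz : ∀ x, z.rTensor H (T x) = T (z.rTensor H x)) (ζ η : H) :
    slL T (star z ζ) η = slL T ζ (z η) := by
  ext θ
  rw [slL_apply, ← braL_rTensor, hz, LinearMap.rTensor_tmul]; rfl

namespace Std

/-- `e` is cyclic for `S`. -/
theorem exists_apply_e (h : Std V e ehat) (ξ : H) : ∃ x ∈ algS V, x e = ξ := by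
  set ε := stdOrthonormalBasis ℂ H
  set K1 : Submodule ℂ H := (algS V).map (LinearMap.applyₗ e) with hK1
  have memK1 : ∀ {x}, x ∈ algS V → x e ∈ K1 := fun hx => ⟨_, hx, rfl⟩
  suffices hbot : K1ᗮ = ⊥ by
    have : ξ ∈ K1 := by rw [Submodule.orthogonal_eq_bot_iff.1 hbot]; trivial
    exact this
  set q : Module.End ℂ H := K1.starProjection.toLinearMap with hq
  have q_of_mem : ∀ x ∈ K1, q x = x := fun x hx => Submodule.starProjection_eq_self_iff.2 hx
  have q_mem : ∀ x, q x ∈ K1 := fun x => Submodule.starProjection_apply_mem _ _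
  have q_zero : ∀ x ∈ K1ᗮ, q x = 0 := fun x hx => by
    rw [hq]; exact (Submodule.starProjection_apply_eq_zero_iff K1).2 hx
  have hqq : q * q = q := LinearMap.ext fun x => q_of_mem _ (q_mem x)
  have hqs : star q = q := by
    rw [LinearMap.star_eq_adjoint, eq_comm, LinearMap.eq_adjoint_iff]
    exact fun x y => Submodule.starProjection_isSymmetric K1 x y
  -- V(x e ⊗ θ) = Δ(x)(e ⊗ θ), and the first legs of Δ(x) are in S; so V preserves Se ⊗ H.
  have c1 : ∀ x, q.rTensor H (op V x) = op V (q.rTensor H x) := by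
    have hpres : ∀ x, q.rTensor H (op V (q.rTensor H x)) = op V (q.rTensor H x) := by
      intro x
      induction x with
      | zero => simp
      | add x y hx hy => simp only [map_add, hx, hy]
      | tmul ξ θ =>
        rw [LinearMap.rTensor_tmul]
        obtain ⟨x, hx, hxe⟩ := q_mem ξ
        rw [← hxe]
        have hle : algS V ≤ LinearMap.eqLocus
            ((q.rTensor H ∘ₗ op V ∘ₗ (TensorProduct.mk ℂ H H).flip θ) ∘ₗ LinearMap.applyₗ e)
            ((op V ∘ₗ (TensorProduct.mk ℂ H H).flip θ) ∘ₗ LinearMap.applyₗ e) := by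
          refine algS_le fun ζ η => ?_
          have h1 := LinearMap.congr_fun (h.mult.coproduct_slL ε ζ η) (e ⊗ₜ θ)
          simp only [Module.End.mul_apply, h.fixed.symm_apply, LinearMap.rTensor_tmul,
            LinearMap.sum_apply, TensorProduct.map_tmul] at h1
          change q.rTensor H (op V (slL (op V) ζ η e ⊗ₜ θ)) = op V (slL (op V) ζ η e ⊗ₜ θ)
          rw [h1, map_sum]
          refine Finset.sum_congr rfl fun i _ => ?_
          rw [LinearMap.rTensor_tmul, q_of_mem _ (memK1 (slL_mem _ _ _))]
        exact hle hx
    refine commute_proj V (q.rTensor H) ?_ ?_ hpres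
    · exact (LinearMap.rTensor_comp H q q).symm.trans (congrArg _ hqq)
    · rw [star_rTensor, hqs]
  -- The second leg of V is in S, and S·Se ⊆ Se.
  have c2 : ∀ x, q.lTensor H (op V x) = op V (q.lTensor H x) := by
    have hpres : ∀ x, q.lTensor H (op V (q.lTensor H x)) = op V (q.lTensor H x) := by
      intro x
      induction x with
      | zero => simp
      | add x y hx hy => simp only [map_add, hx, hy]
      | tmul ξ θ =>
        rw [LinearMap.lTensor_tmul]
        obtain ⟨x, hx, hxe⟩ := q_mem θ
        rw [← hxe, op_tmul_eq_sum ε, map_sum]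
        refine Finset.sum_congr rfl fun i _ => ?_
        rw [LinearMap.lTensor_tmul]
        congr 1
        exact q_of_mem _ (memK1 (h.mul_mem (slL_mem _ _ _) hx))
    refine commute_proj V (q.lTensor H) ?_ ?_ hpres
    · exact (LinearMap.lTensor_comp H q q).symm.trans (congrArg _ hqq)
    · rw [star_lTensor, hqs]
  have mem_iff : ∀ x, x ∈ K1ᗮ ↔ q x = 0 := fun x =>
    ⟨q_zero x, fun h0 => by
      rw [hq] at h0; exact (Submodule.starProjection_apply_eq_zero_iff K1).1 h0⟩
  have sub_mem : ∀ x, x - q x ∈ K1ᗮ := fun x => by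
    rw [mem_iff, map_sub, q_of_mem _ (q_mem x), sub_self]
  have slL_sub : ∀ ζ, ∀ η ∈ K1ᗮ, slL (op V) (ζ - q ζ) η = slL (op V) ζ η := fun ζ η hη => by
    have h1 := slL_star_of_rTensor c1 ζ η
    rw [hqs, q_zero η hη] at h1
    have h2 := slL_add_left (op V) (ζ - q ζ) (q ζ) η
    rw [sub_add_cancel, h1] at h2
    rw [h2]
    have : slL (op V) ζ 0 = 0 := by simpa using slL_smul_right (op V) 0 ζ 0
    rw [this, add_zero]
  have slL_perp : ∀ ζ η, ∀ k ∈ K1ᗮ, slL (op V) ζ η k ∈ K1ᗮ := fun ζ η k hk => by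
    rw [mem_iff, slL_comm_of_lTensor c2, q_zero k hk, map_zero]
  -- The contradiction is a dimension count: V will map (Se)ᗮ ⊗ (K2 ⊕ ℂe) into (Se)ᗮ ⊗ K2, although
  -- e is orthogonal to K2.
  set K2 : Submodule ℂ H :=
    Submodule.span ℂ {w | ∃ ζ ∈ K1ᗮ, ∃ η ∈ K1ᗮ, w = slL (op V) ζ η e} with hK2
  have K2_gen : ∀ ζ, ∀ η ∈ K1ᗮ, slL (op V) ζ η e ∈ K2 := fun ζ η hη => by
    rw [← slL_sub ζ η hη]
    exact Submodule.subset_span ⟨_, sub_mem ζ, _, hη, rfl⟩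
  have K2_stable : ∀ ζ, ∀ η ∈ K1ᗮ, ∀ k ∈ K2 ⊔ Submodule.span ℂ {e}, slL (op V) ζ η k ∈ K2 := by
    intro ζ η hη
    change K2 ⊔ Submodule.span ℂ {e} ≤ K2.comap (slL (op V) ζ η)
    refine sup_le (Submodule.span_le.2 ?_) (Submodule.span_le.2 ?_)
    · rintro _ ⟨ζ', _, η', hη', rfl⟩
      change (slL (op V) ζ η * slL (op V) ζ' η') e ∈ K2
      rw [h.mult.slL_mul_slL ε, LinearMap.sum_apply]
      refine Submodule.sum_mem _ fun i _ => ?_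
      rw [LinearMap.sum_apply]
      exact Submodule.sum_mem _ fun j _ =>
        Submodule.smul_mem _ _ (K2_gen _ _ (slL_perp _ _ _ hη'))
    · rintro _ rfl
      exact K2_gen _ _ hη
  have he : e ∈ K1 := by simpa using memK1 h.one_mem
  -- Here multiplicity one enters, through `braR_op_e`: ⟨e, L(ζ, η)e⟩ is a multiple of ⟨e, η⟩, which
  -- vanishes for η orthogonal to Se.
  have K2_perp : ∀ k ∈ K2, inner ℂ e k = 0 := by
    intro k hk
    induction hk using Submodule.span_induction with
    | mem x hx =>
      obtain ⟨ζ, _, η, hη, rfl⟩ := hx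
      rw [inner_slL, ← inner_braR, h.braR_op_e, (Submodule.mem_orthogonal _ _).1 hη e he]
      simp
    | zero => simp
    | add x y _ _ hx hy => rw [inner_add_right, hx, hy, add_zero]
    | smul c x _ hx => rw [inner_smul_right, hx, mul_zero]
  set M : Submodule ℂ (H ⊗[ℂ] H) := Submodule.map₂ (TensorProduct.mk ℂ H H) K1ᗮ K2 with hM
  set M' : Submodule ℂ (H ⊗[ℂ] H) := Submodule.map₂ (TensorProduct.mk ℂ H H) K1ᗮ
    (K2 ⊔ Submodule.span ℂ {e}) with hM'
  have hMM' : M ≤ M' := Submodule.map₂_le_map₂_right le_sup_left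
  have hVM : M'.map (V.toLinearEquiv : H ⊗[ℂ] H →ₗ[ℂ] H ⊗[ℂ] H) ≤ M := by
    rw [Submodule.map_le_iff_le_comap, hM', Submodule.map₂_le]
    intro η hη k hk
    have h0 : q.rTensor H (op V (η ⊗ₜ k)) = 0 := by
      rw [c1, LinearMap.rTensor_tmul, q_zero η hη, TensorProduct.zero_tmul, map_zero]
    have h1 : op V (η ⊗ₜ k) = ∑ i, (ε i - q (ε i)) ⊗ₜ slL (op V) (ε i) η k := by
      rw [op_tmul_eq_sum ε, map_sum] at h0
      simp only [LinearMap.rTensor_tmul] at h0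
      simp only [TensorProduct.sub_tmul, Finset.sum_sub_distrib, h0, sub_zero]
      exact op_tmul_eq_sum ε _ _ _
    change op V (η ⊗ₜ k) ∈ M
    rw [h1]
    exact Submodule.sum_mem _ fun i _ =>
      Submodule.apply_mem_map₂ _ (sub_mem _) (K2_stable _ _ hη _ hk)
  -- V is injective, so dim M' ≤ dim M. A nonzero k in (Se)ᗮ would then give k ⊗ e in M, hence e in
  -- K2 after pairing with k.
  have hEq : M = M' := by
    refine Submodule.eq_of_le_of_finrank_le hMM' ?_
    rw [← LinearEquiv.finrank_map_eq V.toLinearEquiv M']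
    exact Submodule.finrank_mono hVM
  by_contra hne
  obtain ⟨k, hk, hk0⟩ := Submodule.exists_mem_ne_zero_of_ne_bot hne
  have h1 : k ⊗ₜ e ∈ M := by
    rw [hEq]
    exact Submodule.apply_mem_map₂ _ hk
      (Submodule.mem_sup_right (Submodule.mem_span_singleton_self e))
  have h2 : M ≤ K2.comap (braL k) := Submodule.map₂_le.2 fun a _ b hb => by
    simpa using Submodule.smul_mem _ _ hb
  have h3 := K2_perp _ (h2 h1)
  rw [braL_tmul, inner_smul_right, h.inner_ee, mul_one] at h3
  exact hk0 (inner_self_eq_zero.1 h3)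

theorem elt_e (h : Std V e ehat) (η : H) : elt V ehat η e = η := by
  obtain ⟨x, hx, rfl⟩ := h.exists_apply_e η
  rw [h.elt_apply_e hx]

/-- Two operators agreeing on all `x e` are equal. -/
theorem ext_apply_e (h : Std V e ehat) {M : Type*} {F G : H → M}
    (hFG : ∀ x ∈ algS V, F (x e) = G (x e)) : F = G := by
  ext ξ
  obtain ⟨x, hx, rfl⟩ := h.exists_apply_e ξ
  exact hFG x hx

theorem finrank_algS (h : Std V e ehat) : Module.finrank ℂ (algS V) = Module.finrank ℂ H := by
  refine LinearEquiv.finrank_eq (LinearEquiv.ofBijective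
    ((LinearMap.applyₗ e).domRestrict (algS V)) ⟨fun x y hxy => ?_, fun ξ => ?_⟩)
  · exact Subtype.ext (h.eq_of_apply_e x.2 y.2 hxy)
  · obtain ⟨x, hx, hxe⟩ := h.exists_apply_e ξ
    exact ⟨⟨x, hx⟩, hxe⟩

theorem slL_apply_ehat (h : Std V e ehat) (ζ η : H) :
    slL (op V) ζ η ehat = inner ℂ ζ η • ehat := by
  rw [slL_apply, h.cofixed.op_apply, braL_tmul]

/-- The counit of `S`. -/
def counit (ehat : H) : Module.End ℂ H →ₗ[ℂ] ℂ := innerₛₗ ℂ ehat ∘ₗ LinearMap.applyₗ ehat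

theorem counit_apply (ehat : H) (x : Module.End ℂ H) : counit ehat x = inner ℂ ehat (x ehat) := rfl

theorem apply_cofixed (h : Std V e ehat) {ξ : H} (hξ : IsCofixed V ξ) {x : Module.End ℂ H}
    (hx : x ∈ algS V) : x ξ = counit ehat x • ξ := by
  have : algS V ≤ LinearMap.eqLocus (LinearMap.applyₗ ξ) ((counit ehat).smulRight ξ) := by
    refine algS_le fun ζ η => ?_
    simp only [LinearMap.mem_eqLocus, LinearMap.applyₗ_apply_apply, LinearMap.smulRight_apply]
    rw [counit_apply, h.slL_apply_ehat, inner_smul_right, h.inner_hh, mul_one, slL_apply,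
      hξ.op_apply, braL_tmul]
  exact this hx

theorem apply_ehat (h : Std V e ehat) {x : Module.End ℂ H}
    (hx : x ∈ algS V) : x ehat = counit ehat x • ehat := h.apply_cofixed h.cofixed hx

theorem counit_star (x : Module.End ℂ H) :
    counit ehat (star x) = starRingEnd ℂ (counit ehat x) := by
  rw [counit_apply, counit_apply, inner_star_right, inner_conj_symm]

theorem inner_ehat_apply_e (h : Std V e ehat) {x : Module.End ℂ H}
    (hx : x ∈ algS V) : inner ℂ ehat (x e) = (scale H : ℂ) * counit ehat x := by
  conv_lhs => rw [← star_star x]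
  rw [inner_star_right, h.apply_ehat (h.star_mem hx), inner_smul_left,
    h.inner_ehat_e, counit_star, Complex.conj_conj, mul_comm]

/-- This slice absorbs S from the left through the counit and has counit 1; hence it equals its own
adjoint times itself and is self-adjoint. It then absorbs S from the right too, and its action on
the cyclic vector e determines it. -/
theorem slL_ehat_ehat (h : Std V e ehat) : slL (op V) ehat ehat = (innerₛₗ ℂ ehat).smulRight ehat := by
  have hq := slL_mem V ehat ehat
  have hc : counit ehat (slL (op V) ehat ehat) = 1 := by
    rw [counit_apply, h.slL_apply_ehat, h.inner_hh, one_smul, h.inner_hh]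
  have he : slL (op V) ehat ehat e = (scale H : ℂ) • ehat := by
    have := h.elt_e ehat
    rw [elt_apply, LinearMap.smul_apply, inv_smul_eq_iff₀ h.scale_ne] at this
    exact this
  have hmul : ∀ x ∈ algS V, x * slL (op V) ehat ehat = counit ehat x • slL (op V) ehat ehat := by
    intro x hx
    refine h.eq_of_apply_e (h.mul_mem hx hq) (Submodule.smul_mem _ _ hq) ?_
    rw [Module.End.mul_apply, he, map_smul, h.apply_ehat hx, LinearMap.smul_apply, he, smul_comm]
  have hsa : star (slL (op V) ehat ehat) = slL (op V) ehat ehat := by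
    have h1 := hmul _ (h.star_mem hq)
    rw [counit_star, hc, map_one, one_smul] at h1
    conv_lhs => rw [← h1]
    rw [star_mul, star_star, h1]
  ext θ
  obtain ⟨x, hx, rfl⟩ := h.exists_apply_e θ
  have h2 := congrArg star (hmul _ (h.star_mem hx))
  rw [star_mul, star_smul, star_star, hsa, counit_star] at h2
  have h3 := LinearMap.congr_fun h2 e
  rw [Module.End.mul_apply, LinearMap.smul_apply, he] at h3
  rw [h3, LinearMap.smulRight_apply, innerₛₗ_apply_apply, h.inner_ehat_apply_e hx, smul_smul,
    mul_comm]
  simp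

/-- S acts on every cofixed vector by the counit, and |ê⟩⟨ê| is an element of S of counit 1. This is
the uniqueness that the dual unitary needs in order to be standard. -/
theorem eq_smul_ehat (h : Std V e ehat) {ξ : H} (hξ : IsCofixed V ξ) :
    ξ ∈ Submodule.span ℂ {ehat} := by
  have h1 := h.apply_cofixed hξ (slL_mem V ehat ehat)
  have hc : counit ehat (slL (op V) ehat ehat) = 1 := by
    rw [counit_apply, h.slL_apply_ehat, h.inner_hh, one_smul, h.inner_hh]
  rw [hc, one_smul, h.slL_ehat_ehat] at h1
  rw [← h1]
  exact Submodule.smul_mem _ _ (Submodule.mem_span_singleton_self _)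

end Std

end MultUnitary

end

noncomputable section

namespace MultUnitary

set_option linter.unusedSectionVars false

variable {H : Type*} [NormedAddCommGroup H] [InnerProductSpace ℂ H] [FiniteDimensional ℂ H]

/-! ### The dual multiplicative unitary -/

/-- `Σ V* Σ`. -/
def dual (V : (H ⊗[ℂ] H) ≃ₗᵢ[ℂ] (H ⊗[ℂ] H)) : (H ⊗[ℂ] H) ≃ₗᵢ[ℂ] (H ⊗[ℂ] H) :=
  ((TensorProduct.commIsometry ℂ H H).trans V.symm).trans (TensorProduct.commIsometry ℂ H H)

variable {V : (H ⊗[ℂ] H) ≃ₗᵢ[ℂ] (H ⊗[ℂ] H)} {e ehat : H}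

/-- The flip, as a linear map. -/
abbrev flipMap (H : Type*) [NormedAddCommGroup H] [InnerProductSpace ℂ H] :
    H ⊗[ℂ] H →ₗ[ℂ] H ⊗[ℂ] H := (TensorProduct.comm ℂ H H).toLinearMap

theorem op_dual (V : (H ⊗[ℂ] H) ≃ₗᵢ[ℂ] (H ⊗[ℂ] H)) :
    op (dual V) = flipMap H ∘ₗ op V.symm ∘ₗ flipMap H := rfl

theorem op_dual_symm (V : (H ⊗[ℂ] H) ≃ₗᵢ[ℂ] (H ⊗[ℂ] H)) :
    op (dual V).symm = flipMap H ∘ₗ op V ∘ₗ flipMap H := rfl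

theorem op_dual_tmul (V : (H ⊗[ℂ] H) ≃ₗᵢ[ℂ] (H ⊗[ℂ] H)) (ξ η : H) :
    op (dual V) (ξ ⊗ₜ η) = TensorProduct.comm ℂ H H (op V.symm (η ⊗ₜ ξ)) := rfl

theorem op_dual_symm_tmul (V : (H ⊗[ℂ] H) ≃ₗᵢ[ℂ] (H ⊗[ℂ] H)) (ξ η : H) :
    op (dual V).symm (ξ ⊗ₜ η) = TensorProduct.comm ℂ H H (op V (η ⊗ₜ ξ)) := rfl

theorem dual_dual (V : (H ⊗[ℂ] H) ≃ₗᵢ[ℂ] (H ⊗[ℂ] H)) : dual (dual V) = V := by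
  refine op_injective (LinearMap.ext fun z => ?_)
  rw [op_dual, op_dual_symm]
  have : ∀ w : H ⊗[ℂ] H, flipMap H (flipMap H w) = w := fun w => by
    induction w with
    | zero => simp
    | tmul x y => simp
    | add x y hx hy => rw [map_add, map_add, hx, hy]
  simp only [LinearMap.comp_apply, this]

theorem slL_dual (V : (H ⊗[ℂ] H) ≃ₗᵢ[ℂ] (H ⊗[ℂ] H)) (ζ η : H) :
    slL (op (dual V)) ζ η = slR (op V.symm) ζ η := slR_comm _ _ _

theorem slL_dual_symm (V : (H ⊗[ℂ] H) ≃ₗᵢ[ℂ] (H ⊗[ℂ] H)) (ζ η : H) :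
    slL (op (dual V).symm) ζ η = slR (op V) ζ η := slR_comm _ _ _

theorem slR_dual (V : (H ⊗[ℂ] H) ≃ₗᵢ[ℂ] (H ⊗[ℂ] H)) (ζ η : H) :
    slR (op (dual V)) ζ η = slL (op V.symm) ζ η := by
  rw [← slL_dual_symm]
  have : (dual (dual V)).symm = V.symm := by rw [dual_dual]
  rw [this]

/-- Reversing the order of the three factors by `F` exchanges the legs 12 and 23 and turns V into
V*, so the claim is the inverse of the pentagon relation for V. -/
theorem IsMultiplicative.dual (hV : IsMultiplicative V) : IsMultiplicative (dual V) := by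
  set F : H ⊗[ℂ] (H ⊗[ℂ] H) →ₗ[ℂ] H ⊗[ℂ] (H ⊗[ℂ] H) :=
    (TensorProduct.assoc ℂ H H H).toLinearMap ∘ₗ (TensorProduct.comm ℂ H (H ⊗[ℂ] H)).toLinearMap ∘ₗ
      (flipMap H).lTensor H with hF
  have F_tmul : ∀ ξ η θ : H, F (ξ ⊗ₜ (η ⊗ₜ θ)) = θ ⊗ₜ (η ⊗ₜ ξ) := fun ξ η θ => by simp [hF]
  have F_left : ∀ (ξ : H) (w : H ⊗[ℂ] H), F (ξ ⊗ₜ w) = insR ξ (flipMap H w) := fun ξ w => rfl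
  have F_insR : ∀ (ξ : H) (w : H ⊗[ℂ] H), F (insR ξ w) = ξ ⊗ₜ flipMap H w := fun ξ w => by
    induction w with
    | zero => simp
    | tmul x y => rw [insR_tmul, F_tmul]; simp
    | add x y hx hy => simp only [map_add, hx, hy, TensorProduct.tmul_add]
  have F_insM : ∀ (ξ : H) (w : H ⊗[ℂ] H), F (insM ξ w) = insM ξ (flipMap H w) := fun ξ w => by
    induction w with
    | zero => simp
    | tmul x y => rw [insM_tmul, F_tmul]; simp
    | add x y hx hy => simp only [map_add, hx, hy]
  have c12 : ∀ z, leg12 (op (MultUnitary.dual V)) (F z) = F (leg23 (op V.symm) z) := by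
    refine fun z => LinearMap.congr_fun (f := leg12 (op (MultUnitary.dual V)) ∘ₗ F)
      (g := F ∘ₗ leg23 (op V.symm)) (ext3 fun ξ η θ => ?_) z
    rw [LinearMap.comp_apply, F_tmul, leg12_tmul, LinearMap.comp_apply, leg23_tmul, F_left]
    rfl
  have c23 : ∀ z, leg23 (op (MultUnitary.dual V)) (F z) = F (leg12 (op V.symm) z) := by
    refine fun z => LinearMap.congr_fun (f := leg23 (op (MultUnitary.dual V)) ∘ₗ F)
      (g := F ∘ₗ leg12 (op V.symm)) (ext3 fun ξ η θ => ?_) z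
    rw [LinearMap.comp_apply, F_tmul, leg23_tmul, LinearMap.comp_apply, leg12_tmul, F_insR]
    rfl
  have c13 : ∀ z, leg13 (op (MultUnitary.dual V)) (F z) = F (leg13 (op V.symm) z) := by
    refine fun z => LinearMap.congr_fun (f := leg13 (op (MultUnitary.dual V)) ∘ₗ F)
      (g := F ∘ₗ leg13 (op V.symm)) (ext3 fun ξ η θ => ?_) z
    rw [LinearMap.comp_apply, F_tmul, leg13_tmul, LinearMap.comp_apply, leg13_tmul, F_insM]
    rfl
  have hinv : leg23 (op V.symm) * (leg13 (op V.symm) * leg12 (op V.symm)) =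
      leg12 (op V.symm) * leg23 (op V.symm) := by
    obtain ⟨a1, a2⟩ := leg12_inv V
    obtain ⟨b1, b2⟩ := leg13_inv V
    obtain ⟨c1, c2⟩ := leg23_inv V
    have hl : (leg12 (op V) * leg13 (op V) * leg23 (op V)) *
        (leg23 (op V.symm) * (leg13 (op V.symm) * leg12 (op V.symm))) = 1 := by
      simp only [mul_assoc]
      rw [← mul_assoc (leg23 (op V)), c1, one_mul, ← mul_assoc (leg13 (op V)), b1, one_mul, a1]
    rw [hV] at hl
    have hr : (leg12 (op V.symm) * leg23 (op V.symm)) * (leg23 (op V) * leg12 (op V)) = 1 := by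
      simp only [mul_assoc]
      rw [← mul_assoc (leg23 (op V.symm)), c2, one_mul, a2]
    exact (left_inv_eq_right_inv hr hl).symm
  refine ext3 fun ξ η θ => ?_
  rw [← F_tmul θ η ξ]
  simp only [Module.End.mul_apply, c12, c23, c13]
  exact congrArg F (LinearMap.congr_fun hinv _)

namespace Std

theorem dual (h : Std V e ehat) : Std (dual V) ehat e where
  mult := h.mult.dual
  fixed η := by
    change op (MultUnitary.dual V) _ = _
    rw [op_dual_tmul, h.cofixed.symm_apply]; simp
  cofixed η := by
    change op (MultUnitary.dual V) _ = _
    rw [op_dual_tmul, h.fixed.symm_apply]; simp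
  norm_e := h.norm_ehat
  norm_ehat := h.norm_e
  inner_eq := h.inner_ehat_e
  uniq ξ hξ := by
    refine h.eq_smul_ehat fun η => ?_
    have h1 := hξ.symm_apply η
    rw [op_dual_symm_tmul] at h1
    exact (TensorProduct.comm ℂ H H).injective (h1.trans (by simp))

/-- The left slices of the dual are right slices of V*, adjoints of right slices of V; stability of
the algebra of the dual under the star closes the gap. -/
theorem algS_dual (h : Std V e ehat) : algS (MultUnitary.dual V) = algSHat V := by
  refine le_antisymm ?_ (algSHat_le fun ζ η => ?_)
  · have key : ∀ y ∈ algS (MultUnitary.dual V), star y ∈ algSHat V := by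
      intro y hy
      rw [algS_eq_span] at hy
      induction hy using Submodule.span_induction with
      | mem x hx =>
        obtain ⟨p, rfl⟩ := hx
        simp only
        rw [slL_dual, star_slR, V.symm_symm]
        exact slR_mem _ _ _
      | zero => simp
      | add x y _ _ hx hy => rw [star_add]; exact Submodule.add_mem _ hx hy
      | smul c x _ hx => rw [star_smul]; exact Submodule.smul_mem _ _ hx
    intro y hy
    rw [← star_star y]
    exact key _ (h.dual.star_mem hy)
  · rw [← slL_dual_symm]
    exact h.dual.slL_symm_mem _ _

end Std

/-! ### The involutions -/

/-- `η ↦ (dim H)^{1/2} (⟨η| ⊗ 1) V* (ê ⊗ e)`; the map `x e ↦ x* e`. -/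
def invol (V : (H ⊗[ℂ] H) ≃ₗᵢ[ℂ] (H ⊗[ℂ] H)) (e ehat : H) : H →ₛₗ[starRingEnd ℂ] H where
  toFun η := (Std.scale H : ℂ)⁻¹ • braL η (op V.symm (ehat ⊗ₜ e))
  map_add' a b := by rw [braL_add, smul_add]
  map_smul' c a := by rw [braL_smul, smul_comm]

theorem invol_apply (V : (H ⊗[ℂ] H) ≃ₗᵢ[ℂ] (H ⊗[ℂ] H)) (e ehat η : H) :
    invol V e ehat η = (Std.scale H : ℂ)⁻¹ • braL η (op V.symm (ehat ⊗ₜ e)) := rfl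

theorem inner_braL_left (ζ k : H) (z : H ⊗[ℂ] H) :
    inner ℂ (braL ζ z) k = inner ℂ z (ζ ⊗ₜ[ℂ] k) := by
  rw [← inner_conj_symm, inner_braL]
  exact inner_conj_symm (𝕜 := ℂ) (E := H ⊗[ℂ] H) _ _

theorem inner_braR_left (ζ k : H) (z : H ⊗[ℂ] H) :
    inner ℂ (braR ζ z) k = inner ℂ z (k ⊗ₜ[ℂ] ζ) := by
  rw [← inner_conj_symm, inner_braR]
  exact inner_conj_symm (𝕜 := ℂ) (E := H ⊗[ℂ] H) _ _

theorem norm_sq_eq_sum_braL {ι : Type*} [Fintype ι] (ε : OrthonormalBasis ι ℂ H) (z : H ⊗[ℂ] H) :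
    inner ℂ z z = ∑ i, inner ℂ (braL (ε i) z) (braL (ε i) z) := by
  have h1 : inner ℂ z (∑ i, ε i ⊗ₜ braL (ε i) z) =
      ∑ i, inner ℂ (braL (ε i) z) (braL (ε i) z) := by
    rw [inner_sum]
    exact Finset.sum_congr rfl fun i _ => (inner_braL_left _ _ _).symm
  rwa [← sum_tmul_braL ε z] at h1

theorem norm_sq_eq_sum_braR {ι : Type*} [Fintype ι] (ε : OrthonormalBasis ι ℂ H) (z : H ⊗[ℂ] H) :
    inner ℂ z z = ∑ i, inner ℂ (braR (ε i) z) (braR (ε i) z) := by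
  have h1 : inner ℂ z (∑ i, braR (ε i) z ⊗ₜ ε i) =
      ∑ i, inner ℂ (braR (ε i) z) (braR (ε i) z) := by
    rw [inner_sum]
    exact Finset.sum_congr rfl fun i _ => (inner_braR_left _ _ _).symm
  rwa [← sum_tmul_braR ε z] at h1

/-- A tensor whose associated conjugate-linear map is a multiple of an involution is symmetric,
provided that its norm is the one of an antiunitary. -/
theorem braL_eq_braR_of_involutive {z : H ⊗[ℂ] H} (hz : inner ℂ z z = (1 : ℂ)) {c : ℝ}
    (hn : (Module.finrank ℂ H : ℝ) * c ^ 2 = 1)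
    (hA : ∀ η, braL (braL η z) z = ((c ^ 2 : ℝ) : ℂ) • η) (η : H) : braL η z = braR η z := by
  set ε := stdOrthonormalBasis ℂ H
  have hcross : ∀ i, inner ℂ (braR (ε i) z) (braL (ε i) z) = ((c ^ 2 : ℝ) : ℂ) := by
    intro i
    rw [← inner_conj_symm, inner_braR, ← inner_braL, hA, inner_smul_right,
      inner_self_eq_norm_sq_to_K, ε.norm_eq_one]
    simp
  -- Each of the two square sums equals ‖z‖² = 1, and the cross terms contribute -2nc² = -2.
  have hsum : ∑ i, ‖braL (ε i) z - braR (ε i) z‖ ^ 2 = 0 := by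
    have h1 : ∀ i, ((‖braL (ε i) z - braR (ε i) z‖ ^ 2 : ℝ) : ℂ) =
        inner ℂ (braL (ε i) z) (braL (ε i) z) + inner ℂ (braR (ε i) z) (braR (ε i) z)
          - 2 * ((c ^ 2 : ℝ) : ℂ) := by
      intro i
      have h2 := inner_self_eq_norm_sq_to_K (𝕜 := ℂ) (braL (ε i) z - braR (ε i) z)
      rw [inner_sub_left, inner_sub_right, inner_sub_right, hcross,
        ← inner_conj_symm (braL (ε i) z) (braR (ε i) z), hcross] at h2
      push_cast
      rw [Complex.conj_ofReal] at h2
      refine (Eq.trans ?_ h2.symm).trans ?_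
      · norm_cast
      · push_cast; ring
    have h3 : ((∑ i, ‖braL (ε i) z - braR (ε i) z‖ ^ 2 : ℝ) : ℂ) = 0 := by
      rw [Complex.ofReal_sum, Finset.sum_congr rfl fun i _ => h1 i]
      rw [Finset.sum_sub_distrib, Finset.sum_add_distrib, ← norm_sq_eq_sum_braL,
        ← norm_sq_eq_sum_braR, hz, Finset.sum_const, Finset.card_univ, Fintype.card_fin]
      have : ((Module.finrank ℂ H : ℝ) : ℂ) * ((c ^ 2 : ℝ) : ℂ) = 1 := by exact_mod_cast hn
      simp only [nsmul_eq_mul]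
      push_cast at this ⊢
      linear_combination -2 * this
    exact_mod_cast h3
  have h0 : ∀ i, braL (ε i) z = braR (ε i) z := by
    intro i
    have := (Finset.sum_eq_zero_iff_of_nonneg (fun i _ => by positivity)).1 hsum i
      (Finset.mem_univ _)
    rwa [sq_eq_zero_iff, norm_eq_zero, sub_eq_zero] at this
  let A : H →ₛₗ[starRingEnd ℂ] H :=
    { toFun := fun x => braL x z
      map_add' := fun _ _ => braL_add _ _ _
      map_smul' := fun _ _ => braL_smul _ _ _ }
  let B : H →ₛₗ[starRingEnd ℂ] H :=
    { toFun := fun x => braR x z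
      map_add' := fun _ _ => braR_add _ _ _
      map_smul' := fun _ _ => braR_smul _ _ _ }
  have hAB : A = B := ε.toBasis.ext fun i => by simpa [A, B] using h0 i
  exact LinearMap.congr_fun hAB η

namespace Std

theorem invol_apply_e (h : Std V e ehat) {x : Module.End ℂ H} (hx : x ∈ algS V) :
    invol V e ehat (x e) = star x e := by
  refine ext_inner_left ℂ fun k => ?_
  rw [invol_apply, inner_smul_right, inner_braL, inner_op, V.symm_symm, ← inner_braL_left,
    h.braL_ehat hx, inner_smul_left, Complex.conj_ofReal, ← mul_assoc, inv_mul_cancel₀ h.scale_ne,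
    one_mul, inner_star_right]

theorem invol_invol (h : Std V e ehat) (η : H) : invol V e ehat (invol V e ehat η) = η := by
  obtain ⟨x, hx, rfl⟩ := h.exists_apply_e η
  rw [h.invol_apply_e hx, h.invol_apply_e (h.star_mem hx), star_star]

/-- The unit vector V*(ê ⊗ e) induces n^{-1/2} times an involutive conjugate-linear map. Its norm is
too small for the involution to be anything but antiunitary, so the two slices of the vector agree.
-/
theorem inner_invol_comm (h : Std V e ehat) (ζ η : H) :
    inner ℂ ζ (invol V e ehat η) = inner ℂ η (invol V e ehat ζ) := by
  have hc := h.scale_ne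
  have h1 : inner ℂ (op V.symm (ehat ⊗ₜ[ℂ] e)) (op V.symm (ehat ⊗ₜ[ℂ] e)) = (1 : ℂ) := by
    rw [inner_op, V.symm_symm]
    have : op V (op V.symm (ehat ⊗ₜ[ℂ] e)) = ehat ⊗ₜ[ℂ] e :=
      LinearMap.congr_fun (op_mul_op_symm V) _
    rw [this, TensorProduct.inner_tmul, h.inner_ee, h.inner_hh, mul_one]
  have h2 := braL_eq_braR_of_involutive h1 h.finrank_mul_scale_sq (fun η => by
    have := h.invol_invol η
    rw [invol_apply, invol_apply, braL_smul, map_inv₀, Complex.conj_ofReal, smul_smul,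
      ← mul_inv, inv_smul_eq_iff₀ (mul_ne_zero hc hc)] at this
    rw [this, sq, Complex.ofReal_mul])
  rw [invol_apply, invol_apply, inner_smul_right, inner_smul_right, h2, inner_braR, inner_braL]

theorem inner_invol_invol (h : Std V e ehat) (ζ η : H) :
    inner ℂ (invol V e ehat ζ) (invol V e ehat η) = inner ℂ η ζ := by
  rw [h.inner_invol_comm, h.invol_invol]

theorem invol_e (h : Std V e ehat) : invol V e ehat e = e := by
  simpa using h.invol_apply_e h.one_mem

theorem invol_ehat (h : Std V e ehat) : invol V e ehat ehat = ehat := by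
  have h1 : star (elt V ehat ehat) = elt V ehat ehat := by
    rw [elt_apply, h.slL_ehat_ehat, star_smul]
    congr 1
    · simp
    · rw [LinearMap.star_eq_adjoint, eq_comm, LinearMap.eq_adjoint_iff]
      intro x y
      simp [inner_smul_left, inner_smul_right, mul_comm]
  have h2 := h.invol_apply_e (elt_mem (V := V) (ehat := ehat) ehat)
  rwa [h1, h.elt_e] at h2

/-- The involution of the dual, on the vectors `L(ζ, η)* e`. -/
theorem invol_dual_apply_e (h : Std V e ehat) (ζ η : H) :
    invol (MultUnitary.dual V) ehat e (slL (op V.symm) η ζ e) = slL (op V.symm) ζ η e := by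
  have hc := h.scale_ne
  have key : ∀ z : H ⊗[ℂ] H, braL ζ (leg13 (op V) (η ⊗ₜ z)) = (slL (op V) ζ η).lTensor H z := by
    intro z
    induction z with
    | zero => simp
    | tmul x y => rw [leg13_tmul, bra1_insM]; rfl
    | add x y hx hy => simp only [TensorProduct.tmul_add, map_add, hx, hy]
  rw [invol_apply, op_dual_symm_tmul, braL_comm, ← star_slL, ← braR_lTensor, ← key, ← leg23_tmul,
    ← braL_bra3, inv_smul_eq_iff₀ hc]
  have h1 := LinearMap.congr_fun h.mult.mul_13_23 (η ⊗ₜ (ehat ⊗ₜ e))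
  simp only [Module.End.mul_apply] at h1
  rw [h1, bra3_leg12, leg12_tmul, h.cofixed.op_apply, insR_tmul, leg23_tmul, LinearMap.lTensor_tmul,
    h.braR_op_e, h.inner_e_ehat, TensorProduct.tmul_smul, map_smul, map_smul]
  rfl

end Std

end MultUnitary

end

/-! ### The commutant of S, the antipode, and the opposite multiplicative unitary -/

noncomputable section

namespace MultUnitary

set_option linter.unusedSectionVars false

variable {H : Type*} [NormedAddCommGroup H] [InnerProductSpace ℂ H] [FiniteDimensional ℂ H]
variable {V : (H ⊗[ℂ] H) ≃ₗᵢ[ℂ] (H ⊗[ℂ] H)} {e ehat : H}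

/-- Conjugation of an operator by a conjugate-linear involution. -/
def conjBy (J : H →ₛₗ[starRingEnd ℂ] H) (x : Module.End ℂ H) : Module.End ℂ H :=
  J.comp (x.comp J)

theorem conjBy_apply (J : H →ₛₗ[starRingEnd ℂ] H) (x : Module.End ℂ H) (ξ : H) :
    conjBy J x ξ = J (x (J ξ)) := rfl

namespace Std

/-- With T the involution x e ↦ x* e, the operator TyT is right multiplication by y* on S e, hence
belongs to the commutant of S. Such operators move e to any vector, which is how statements on e ⊗ θ
are extended to ξ ⊗ θ. -/
theorem conjBy_apply_e (h : Std V e ehat) {x y : Module.End ℂ H} (hx : x ∈ algS V)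
    (hy : y ∈ algS V) : conjBy (invol V e ehat) y (x e) = x (star y e) := by
  rw [conjBy_apply, h.invol_apply_e hx, ← Module.End.mul_apply,
    h.invol_apply_e (h.mul_mem hy (h.star_mem hx)), star_mul, star_star, Module.End.mul_apply]

theorem conjBy_commute (h : Std V e ehat) {x y : Module.End ℂ H} (hx : x ∈ algS V)
    (hy : y ∈ algS V) : conjBy (invol V e ehat) y * x = x * conjBy (invol V e ehat) y := by
  refine LinearMap.coe_injective (h.ext_apply_e fun z hz => ?_)
  rw [Module.End.mul_apply, Module.End.mul_apply, ← Module.End.mul_apply x,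
    h.conjBy_apply_e (h.mul_mem hx hz) hy, h.conjBy_apply_e hz hy, Module.End.mul_apply]

theorem star_conjBy_apply_e (h : Std V e ehat) {y : Module.End ℂ H}
    (hy : y ∈ algS V) : star (conjBy (invol V e ehat) y) e = y e := by
  refine ext_inner_right ℂ fun w => ?_
  rw [inner_star_left, conjBy_apply, h.inner_invol_comm, h.invol_e, ← inner_star_right,
    ← h.invol_apply_e hy, h.inner_invol_invol]

/-- The coproduct commutes with the commutant on the first leg. -/
theorem coproduct_comm_rTensor (h : Std V e ehat) {x z : Module.End ℂ H} (hx : x ∈ algS V)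
    (hz : ∀ y ∈ algS V, z * y = y * z) :
    (op V * x.rTensor H * op V.symm) * z.rTensor H =
      z.rTensor H * (op V * x.rTensor H * op V.symm) := by
  have : algS V ≤ LinearMap.eqLocus
      (LinearMap.mulRight ℂ (z.rTensor H) ∘ₗ LinearMap.mulRight ℂ (op V.symm) ∘ₗ
        LinearMap.mulLeft ℂ (op V) ∘ₗ LinearMap.rTensorHom H)
      (LinearMap.mulLeft ℂ (z.rTensor H) ∘ₗ LinearMap.mulRight ℂ (op V.symm) ∘ₗ
        LinearMap.mulLeft ℂ (op V) ∘ₗ LinearMap.rTensorHom H) := by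
    refine algS_le fun ζ η => ?_
    change (op V * (slL (op V) ζ η).rTensor H * op V.symm) * z.rTensor H =
      z.rTensor H * (op V * (slL (op V) ζ η).rTensor H * op V.symm)
    rw [h.mult.coproduct_slL (stdOrthonormalBasis ℂ H), Finset.sum_mul, Finset.mul_sum]
    refine Finset.sum_congr rfl fun i _ => ?_
    refine TensorProduct.ext' fun ξ θ => ?_
    simp only [Module.End.mul_apply, LinearMap.rTensor_tmul, TensorProduct.map_tmul]
    congr 1
    exact (LinearMap.congr_fun (hz _ (slL_mem V _ _)) ξ).symm
  exact this hx

/-- Write η = x e and ζ = y e, and let Δ(x) commute with TyT ⊗ 1 on e ⊗ θ. Paired with ⟨e|, one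
order gives a slice of V and the other, where ⟨e| absorbs V, a slice of V*. -/
theorem slL_symm_invol (h : Std V e ehat) (ζ η : H) :
    slL (op V.symm) (invol V e ehat η) (invol V e ehat ζ) = slL (op V) ζ η := by
  obtain ⟨x, hx, rfl⟩ := h.exists_apply_e η
  obtain ⟨y, hy, rfl⟩ := h.exists_apply_e ζ
  ext θ
  have hcomm := LinearMap.congr_fun (h.coproduct_comm_rTensor hx
    (fun w hw => h.conjBy_commute hw hy)) (e ⊗ₜ θ)
  have h1 := congrArg (braL e) hcomm
  simp only [Module.End.mul_apply] at h1
  rw [braL_rTensor, h.star_conjBy_apply_e hy, h.fixed.braL_op, braL_rTensor,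
    h.fixed.symm_apply, LinearMap.rTensor_tmul, LinearMap.rTensor_tmul, conjBy_apply, h.invol_e,
    ← h.invol_apply_e hx] at h1
  exact h1

theorem star_slL_eq (h : Std V e ehat) (ζ η : H) :
    star (slL (op V) ζ η) = slL (op V) (invol V e ehat ζ) (invol V e ehat η) := by
  rw [star_slL, ← h.slL_symm_invol, h.invol_invol, h.invol_invol]

theorem slR_eq_slR_symm (h : Std V e ehat) (ζ η : H) :
    slR (op V) (invol (MultUnitary.dual V) ehat e η) (invol (MultUnitary.dual V) ehat e ζ) =
      slR (op V.symm) ζ η := by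
  rw [← slL_dual, ← h.dual.slL_symm_invol, slL_dual_symm]

/-- Conjugation by the involution of the dual flips the slices of `V`. -/
theorem conjBy_slL (h : Std V e ehat) (ζ η : H) :
    conjBy (invol (MultUnitary.dual V) ehat e) (slL (op V) η ζ) = slL (op V) ζ η := by
  ext θ
  refine ext_inner_left ℂ fun k => ?_
  rw [conjBy_apply, h.dual.inner_invol_comm, ← inner_conj_symm, inner_slL, ← inner_slR,
    h.slR_eq_slR_symm, inner_slR, inner_op, V.symm_symm, inner_slL]
  exact inner_conj_symm (𝕜 := ℂ) (E := H ⊗[ℂ] H) _ _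

/-- The two involutions commute. -/
theorem invol_comm (h : Std V e ehat) (ξ : H) :
    invol (MultUnitary.dual V) ehat e (invol V e ehat ξ) =
      invol V e ehat (invol (MultUnitary.dual V) ehat e ξ) := by
  obtain ⟨x, hx, rfl⟩ := h.exists_apply_e ξ
  have : algS V ≤ LinearMap.eqLocus
      ((invol (MultUnitary.dual V) ehat e).comp (invol V e ehat) ∘ₗ LinearMap.applyₗ e)
      ((invol V e ehat).comp (invol (MultUnitary.dual V) ehat e) ∘ₗ LinearMap.applyₗ e) := by
    refine algS_le fun ζ η => ?_
    change invol (MultUnitary.dual V) ehat e (invol V e ehat (slL (op V) ζ η e)) =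
      invol V e ehat (invol (MultUnitary.dual V) ehat e (slL (op V) ζ η e))
    rw [h.invol_apply_e (slL_mem V _ _), star_slL, h.invol_dual_apply_e]
    rw [← h.slL_symm_invol ζ η, h.invol_dual_apply_e, h.slL_symm_invol,
      h.invol_apply_e (slL_mem V _ _), star_slL]
  exact this hx

/-- The antipode on vectors, `x e ↦ κ(x) e`. -/
def antip (h : Std V e ehat) : H ≃ₗᵢ[ℂ] H where
  toLinearEquiv := LinearEquiv.ofInvolutive
    ((invol (MultUnitary.dual V) ehat e).comp (invol V e ehat)) fun ξ => by
      simp only [LinearMap.comp_apply]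
      rw [← h.invol_comm, h.invol_invol, h.dual.invol_invol]
  norm_map' ξ := by
    change ‖invol (MultUnitary.dual V) ehat e (invol V e ehat ξ)‖ = ‖ξ‖
    rw [@norm_eq_sqrt_re_inner ℂ, h.dual.inner_invol_invol, h.inner_invol_invol,
      ← @norm_eq_sqrt_re_inner ℂ]

theorem antip_apply (h : Std V e ehat) (ξ : H) :
    h.antip ξ = invol (MultUnitary.dual V) ehat e (invol V e ehat ξ) := rfl

theorem antip_antip (h : Std V e ehat) (ξ : H) : h.antip (h.antip ξ) = ξ := by
  rw [antip_apply, antip_apply, ← h.invol_comm, h.invol_invol, h.dual.invol_invol]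

theorem inner_antip (h : Std V e ehat) (ζ η : H) :
    inner ℂ (h.antip ζ) η = inner ℂ ζ (h.antip η) := by
  rw [← h.antip.inner_map_map, antip_antip]

theorem antip_slL (h : Std V e ehat) (ζ η : H) :
    h.antip (slL (op V) ζ η e) = slL (op V.symm) ζ η e := by
  rw [antip_apply, h.invol_apply_e (slL_mem V _ _), star_slL, h.invol_dual_apply_e]

theorem isAntipodeOperator_antip (h : Std V e ehat) :
    IsAntipodeOperator V e h.antip.toLinearEquiv.toLinearMap := by
  intro ω
  have key : ∀ T : Module.End ℂ (H ⊗[ℂ] H), sliceLeft ω T =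
      ∑ i, ∑ j, ω ((innerₛₗ ℂ (stdOrthonormalBasis ℂ H j)).smulRight (stdOrthonormalBasis ℂ H i)) •
        slL T (stdOrthonormalBasis ℂ H i) (stdOrthonormalBasis ℂ H j) := by
    intro T
    conv_lhs => rw [eq_sum_map_slL (stdOrthonormalBasis ℂ H) T]
    simp only [map_sum, sliceLeft_map]
  rw [key, key]
  simp only [LinearMap.sum_apply, map_sum, LinearMap.smul_apply, map_smul]
  exact Finset.sum_congr rfl fun i _ => Finset.sum_congr rfl fun j _ =>
    congrArg _ (h.antip_slL _ _)

/-- Since one antipode operator exists, the choice operator returns an antipode operator; its values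
on S e are prescribed and e is cyclic, so there is only one. -/
theorem antipodeOperator_eq (h : Std V e ehat) :
    antipodeOperator V e = h.antip.toLinearEquiv.toLinearMap := by
  have h1 : IsAntipodeOperator V e (antipodeOperator V e) :=
    Classical.epsilon_spec ⟨_, h.isAntipodeOperator_antip⟩
  refine LinearMap.coe_injective (h.ext_apply_e fun x hx => ?_)
  obtain ⟨ω, rfl⟩ := (mem_algS V x).1 hx
  rw [h1 ω, h.isAntipodeOperator_antip ω]

theorem antip_eq (h : Std V e ehat) (ξ : H) : antipodeOperator V e ξ = h.antip ξ := by
  rw [h.antipodeOperator_eq]; rfl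

/-- The multiplicative unitary `(U ⊗ 1) V* (U ⊗ 1)`, that is, `(R ⊗ R) V (R ⊗ R)`. -/
def opp (h : Std V e ehat) : (H ⊗[ℂ] H) ≃ₗᵢ[ℂ] (H ⊗[ℂ] H) :=
  ((TensorProduct.congrIsometry h.antip (LinearIsometryEquiv.refl ℂ H)).trans V.symm).trans
    (TensorProduct.congrIsometry h.antip (LinearIsometryEquiv.refl ℂ H))

theorem op_opp (h : Std V e ehat) : op h.opp =
    h.antip.toLinearEquiv.toLinearMap.rTensor H * op V.symm *
      h.antip.toLinearEquiv.toLinearMap.rTensor H := by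
  refine TensorProduct.ext' fun ξ η => ?_
  rfl

theorem star_antip (h : Std V e ehat) : star h.antip.toLinearEquiv.toLinearMap =
    h.antip.toLinearEquiv.toLinearMap := by
  rw [LinearMap.star_eq_adjoint, eq_comm, LinearMap.eq_adjoint_iff]
  exact h.inner_antip

theorem slL_opp (h : Std V e ehat) (ζ η : H) : slL (op h.opp) ζ η =
    slL (op V) (invol (MultUnitary.dual V) ehat e η) (invol (MultUnitary.dual V) ehat e ζ) := by
  have h1 : slL (op h.opp) ζ η = slL (op V.symm) (h.antip ζ) (h.antip η) := by
    ext θ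
    rw [slL_apply, op_opp, Module.End.mul_apply, Module.End.mul_apply, braL_rTensor, star_antip]
    rfl
  rw [h1, ← star_slL, h.star_slL_eq, antip_apply, antip_apply, h.invol_comm, h.invol_comm,
    h.invol_invol, h.invol_invol]

/-- `R ⊗ R`. -/
abbrev rr (V : (H ⊗[ℂ] H) ≃ₗᵢ[ℂ] (H ⊗[ℂ] H)) (e ehat : H) :
    H ⊗[ℂ] H →ₛₗ[starRingEnd ℂ] H ⊗[ℂ] H :=
  TensorProduct.map (invol (MultUnitary.dual V) ehat e) (invol (MultUnitary.dual V) ehat e)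

theorem braL_rr (h : Std V e ehat) (ζ : H) (w : H ⊗[ℂ] H) :
    braL ζ (rr V e ehat w) = invol (MultUnitary.dual V) ehat e
      (braL (invol (MultUnitary.dual V) ehat e ζ) w) := by
  induction w with
  | zero => simp
  | tmul x y =>
    rw [TensorProduct.map_tmul, braL_tmul, braL_tmul, LinearMap.map_smulₛₗ, inner_conj_symm,
      h.dual.inner_invol_comm]
  | add x y hx hy => simp only [map_add, hx, hy]

/-- The opposite is the conjugate of V by the antiunitary R ⊗ R, with R the involution of the dual.
Pentagon relation, fixed vectors and pre-subgroups are all transported along it. -/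
theorem op_opp_rr (h : Std V e ehat) (w : H ⊗[ℂ] H) :
    op h.opp (rr V e ehat w) = rr V e ehat (op V w) := by
  induction w with
  | zero => simp
  | add x y hx hy => simp only [map_add, hx, hy]
  | tmul x y =>
    refine ext_braL fun ζ => ?_
    rw [h.braL_rr, TensorProduct.map_tmul, ← slL_apply, h.slL_opp, h.dual.invol_invol,
      ← h.conjBy_slL, conjBy_apply, h.dual.invol_invol, slL_apply]

theorem opp_isMultiplicative (h : Std V e ehat) : IsMultiplicative h.opp := by
  set R := invol (MultUnitary.dual V) ehat e with hR
  set R3 : H ⊗[ℂ] (H ⊗[ℂ] H) →ₛₗ[starRingEnd ℂ] H ⊗[ℂ] (H ⊗[ℂ] H) :=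
    TensorProduct.map R (rr V e ehat) with hR3
  have R3_insR : ∀ (θ : H) (w : H ⊗[ℂ] H), insR (R θ) (rr V e ehat w) = R3 (insR θ w) := by
    intro θ w
    induction w with
    | zero => simp
    | tmul x y => simp [R3, rr, R]
    | add x y hx hy => simp only [map_add, hx, hy]
  have R3_insM : ∀ (θ : H) (w : H ⊗[ℂ] H), insM (R θ) (rr V e ehat w) = R3 (insM θ w) := by
    intro θ w
    induction w with
    | zero => simp
    | tmul x y => simp [R3, rr, R]
    | add x y hx hy => simp only [map_add, hx, hy]
  have R3_tmul : ∀ ξ η θ : H, R3 (ξ ⊗ₜ (η ⊗ₜ θ)) = R ξ ⊗ₜ (R η ⊗ₜ R θ) := fun ξ η θ => by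
    simp [R3, rr, R]
  have ind : ∀ {P : H ⊗[ℂ] (H ⊗[ℂ] H) → Prop}, (∀ ξ η θ : H, P (ξ ⊗ₜ (η ⊗ₜ θ))) →
      (∀ x y, P x → P y → P (x + y)) → ∀ z, P z := by
    intro P hp ha z
    induction z with
    | zero => simpa using hp 0 0 0
    | add x y hx hy => exact ha _ _ hx hy
    | tmul x w =>
      induction w with
      | zero => simpa using hp 0 0 0
      | add a b hx hy => rw [TensorProduct.tmul_add]; exact ha _ _ hx hy
      | tmul a b => exact hp _ _ _
  have c12 : ∀ z, leg12 (op h.opp) (R3 z) = R3 (leg12 (op V) z) := by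
    refine ind (fun ξ η θ => ?_) fun x y hx hy => by simp only [map_add, hx, hy]
    rw [R3_tmul, leg12_tmul, leg12_tmul, ← R3_insR, ← h.op_opp_rr, TensorProduct.map_tmul]
  have c13 : ∀ z, leg13 (op h.opp) (R3 z) = R3 (leg13 (op V) z) := by
    refine ind (fun ξ η θ => ?_) fun x y hx hy => by simp only [map_add, hx, hy]
    rw [R3_tmul, leg13_tmul, leg13_tmul, ← R3_insM, ← h.op_opp_rr, TensorProduct.map_tmul]
  have c23 : ∀ z, leg23 (op h.opp) (R3 z) = R3 (leg23 (op V) z) := by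
    refine ind (fun ξ η θ => ?_) fun x y hx hy => by simp only [map_add, hx, hy]
    rw [R3_tmul, leg23_tmul, leg23_tmul, hR3, TensorProduct.map_tmul, ← h.op_opp_rr,
      TensorProduct.map_tmul]
  refine ext3 fun ξ η θ => ?_
  have h1 : R3 (R ξ ⊗ₜ (R η ⊗ₜ R θ)) = ξ ⊗ₜ (η ⊗ₜ θ) := by
    rw [R3_tmul, h.dual.invol_invol, h.dual.invol_invol, h.dual.invol_invol]
  rw [← h1]
  simp only [Module.End.mul_apply, c12, c13, c23]
  exact congrArg R3 (LinearMap.congr_fun h.mult _)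

theorem opp_tmul_eq_iff (h : Std V e ehat) (ξ η : H) :
    h.opp (invol (MultUnitary.dual V) ehat e ξ ⊗ₜ invol (MultUnitary.dual V) ehat e η) =
      invol (MultUnitary.dual V) ehat e ξ ⊗ₜ invol (MultUnitary.dual V) ehat e η ↔
    V (ξ ⊗ₜ η) = ξ ⊗ₜ η := by
  have h1 := h.op_opp_rr (ξ ⊗ₜ η)
  rw [TensorProduct.map_tmul] at h1
  have hinv : ∀ w, rr V e ehat (rr V e ehat w) = w := fun w => by
    induction w with
    | zero => simp
    | tmul x y => simp only [TensorProduct.map_tmul, h.dual.invol_invol]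
    | add x y hx hy => simp only [map_add, hx, hy]
  rw [← op_apply, h1, ← op_apply]
  constructor
  · intro h2
    rw [← hinv (op V (ξ ⊗ₜ η)), h2, TensorProduct.map_tmul, h.dual.invol_invol, h.dual.invol_invol]
  · intro h2
    rw [h2, TensorProduct.map_tmul]

theorem std_opp (h : Std V e ehat) : Std h.opp e ehat where
  mult := h.opp_isMultiplicative
  fixed η := by
    have := (h.opp_tmul_eq_iff e (invol (MultUnitary.dual V) ehat e η)).2 (h.fixed _)
    rwa [h.dual.invol_ehat, h.dual.invol_invol] at this
  cofixed η := by
    have := (h.opp_tmul_eq_iff (invol (MultUnitary.dual V) ehat e η) ehat).2 (h.cofixed _)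
    rwa [h.dual.invol_e, h.dual.invol_invol] at this
  norm_e := h.norm_e
  norm_ehat := h.norm_ehat
  inner_eq := h.inner_eq
  uniq ξ hξ := by
    have : IsFixed V (invol (MultUnitary.dual V) ehat e ξ) := fun η => by
      rw [← h.opp_tmul_eq_iff, h.dual.invol_invol]
      exact hξ _
    obtain ⟨c, hc⟩ := Submodule.mem_span_singleton.1 (h.uniq _ this)
    have h2 := congrArg (invol (MultUnitary.dual V) ehat e) hc
    rw [h.dual.invol_invol, LinearMap.map_smulₛₗ, h.dual.invol_ehat] at h2
    rw [← h2]
    exact Submodule.smul_mem _ _ (Submodule.mem_span_singleton_self _)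

theorem algS_opp (h : Std V e ehat) : algS h.opp = algS V := by
  refine le_antisymm (algS_le fun ζ η => ?_) (algS_le fun ζ η => ?_)
  · rw [slL_opp]; exact slL_mem _ _ _
  · have := h.slL_opp (invol (MultUnitary.dual V) ehat e η) (invol (MultUnitary.dual V) ehat e ζ)
    rw [h.dual.invol_invol, h.dual.invol_invol] at this
    rw [← this]
    exact slL_mem _ _ _

theorem invol_opp (h : Std V e ehat) (ξ : H) : invol h.opp e ehat ξ = invol V e ehat ξ := by
  obtain ⟨x, hx, rfl⟩ := h.exists_apply_e ξ
  rw [h.invol_apply_e hx, h.std_opp.invol_apply_e (by rwa [h.algS_opp])]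

/-- `(1 ⊗ y) V (ξ ⊗ e) = V (y ξ ⊗ e)` for `y` in the dual algebra. -/
theorem lTensor_op_e (h : Std V e ehat) {y : Module.End ℂ H} (hy : y ∈ algSHat V) (ξ : H) :
    y.lTensor H (op V (ξ ⊗ₜ e)) = op V (y ξ ⊗ₜ e) := by
  have : algSHat V ≤ LinearMap.eqLocus
      (LinearMap.applyₗ (op V (ξ ⊗ₜ e)) ∘ₗ LinearMap.lTensorHom H)
      (op V ∘ₗ (TensorProduct.mk ℂ H H).flip e ∘ₗ LinearMap.applyₗ ξ) := by
    refine algSHat_le fun ζ η => ?_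
    change (slR (op V) ζ η).lTensor H (op V (ξ ⊗ₜ e)) = op V (slR (op V) ζ η ξ ⊗ₜ e)
    have key : ∀ z : H ⊗[ℂ] H, bra3 ζ (leg23 (op V) (insR η z)) =
        (slR (op V) ζ η).lTensor H z := by
      intro z
      induction z with
      | zero => simp
      | tmul x y => rw [insR_tmul, leg23_tmul]; rfl
      | add x y hx hy => simp only [map_add, hx, hy]
    have h1 := congrArg (bra3 ζ) (LinearMap.congr_fun h.mult (ξ ⊗ₜ (e ⊗ₜ η)))
    simp only [Module.End.mul_apply] at h1
    rw [leg23_tmul, h.fixed.op_apply, bra3_leg12, leg13_tmul, bra3_insM, leg12_tmul, key] at h1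
    exact h1.symm
  exact this hy

theorem braR_op_ehat_e (h : Std V e ehat) (ζ : H) : braR ζ (op V (ehat ⊗ₜ e)) =
    (scale H : ℂ) • invol (MultUnitary.dual V) ehat e ζ := by
  rw [invol_apply, op_dual_symm_tmul, braL_comm, smul_inv_smul₀ h.scale_ne]

theorem braL_op_ehat_e (h : Std V e ehat) (ζ : H) : braL ζ (op V (ehat ⊗ₜ e)) =
    (scale H : ℂ) • invol (MultUnitary.dual V) ehat e ζ := by
  refine ext_inner_left ℂ fun k => ?_
  rw [inner_braL, ← inner_braR, h.braR_op_ehat_e, inner_smul_right, inner_smul_right,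
    h.dual.inner_invol_comm]

/-- `X (η ⊗ e) = Σ V (η ⊗ e)` for `X = (U ⊗ 1) V* (U ⊗ 1)`. -/
theorem opp_tmul_e (h : Std V e ehat) (η : H) :
    op h.opp (η ⊗ₜ e) = TensorProduct.comm ℂ H H (op V (η ⊗ₜ e)) := by
  obtain ⟨y, hy, rfl⟩ := h.dual.exists_apply_e η
  have hy' : y ∈ algSHat V := by rwa [← h.algS_dual]
  have hys : star y ∈ algSHat V := by rw [← h.algS_dual]; exact h.dual.star_mem hy
  refine ext_braL fun ζ => ?_
  rw [braL_comm, ← h.lTensor_op_e hy', braR_lTensor, h.braR_op_ehat_e]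
  have h1 : y ehat ⊗ₜ[ℂ] e = rr V e ehat (star y ehat ⊗ₜ e) := by
    rw [TensorProduct.map_tmul, ← h.dual.invol_apply_e hy, h.dual.invol_invol, h.dual.invol_ehat]
  rw [h1, h.op_opp_rr, h.braL_rr, ← h.lTensor_op_e hys, braL_lTensor, h.braL_op_ehat_e,
    h.dual.invol_invol, map_smul, LinearMap.map_smulₛₗ, Complex.conj_ofReal]

theorem invol_dual_opp (h : Std V e ehat) (ξ : H) :
    invol (MultUnitary.dual h.opp) ehat e ξ = invol (MultUnitary.dual V) ehat e ξ := by
  have h1 := h.std_opp.braR_op_ehat_e ξ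
  rw [h.opp_tmul_e, braR_comm, h.braL_op_ehat_e] at h1
  exact (smul_right_injective _ h.scale_ne h1).symm

theorem antip_opp (h : Std V e ehat) (ξ : H) : h.std_opp.antip ξ = h.antip ξ := by
  rw [antip_apply, antip_apply, h.invol_opp, h.invol_dual_opp]

/-- The antipode operator as an endomorphism. -/
abbrev U (h : Std V e ehat) : Module.End ℂ H := h.antip.toLinearEquiv.toLinearMap

theorem U_mul_U (h : Std V e ehat) : h.U * h.U = 1 := LinearMap.ext h.antip_antip

/-- All left slices of Z being in S means that Z lies in L(H) ⊗ S, which commutes with 1 ⊗ z for z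
in the commutant. -/
theorem lTensor_comm {Z : Module.End ℂ (H ⊗[ℂ] H)}
    (hZ : ∀ ζ η, slL Z ζ η ∈ algS V) {z : Module.End ℂ H} (hz : ∀ y ∈ algS V, z * y = y * z)
    (w : H ⊗[ℂ] H) : Z (z.lTensor H w) = z.lTensor H (Z w) := by
  induction w with
  | zero => simp
  | add x y hx hy => simp only [map_add, hx, hy]
  | tmul ξ θ =>
    rw [LinearMap.lTensor_tmul, op_tmul_eq_sum (stdOrthonormalBasis ℂ H) Z,
      op_tmul_eq_sum (stdOrthonormalBasis ℂ H) Z, map_sum]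
    refine Finset.sum_congr rfl fun i _ => ?_
    rw [LinearMap.lTensor_tmul]
    congr 1
    exact (LinearMap.congr_fun (hz _ (hZ _ _)) θ).symm

/-- The coproduct of `X` is the flipped coproduct of `V`. -/
theorem opp_coproduct (h : Std V e ehat) {x : Module.End ℂ H} (hx : x ∈ algS V) :
    op h.opp * x.rTensor H * op h.opp.symm =
      flipMap H * (op V * x.rTensor H * op V.symm) * flipMap H := by
  have hff : ∀ w : H ⊗[ℂ] H, flipMap H (flipMap H w) = w := fun w => by
    induction w with
    | zero => simp
    | tmul x y => simp
    | add x y hx hy => rw [map_add, map_add, hx, hy]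
  have hfl : ∀ (z : Module.End ℂ H) (w : H ⊗[ℂ] H),
      flipMap H (z.lTensor H w) = z.rTensor H (flipMap H w) := fun z w => by
    induction w with
    | zero => simp
    | tmul x y => simp
    | add x y hx hy => simp only [map_add, hx, hy]
  have hX : ∀ w, op h.opp.symm (op h.opp w) = w := fun w => h.opp.symm_apply_apply w
  have hVV : ∀ w, op V.symm (op V w) = w := fun w => V.symm_apply_apply w
  suffices hmain : ∀ w, (op h.opp * x.rTensor H * op h.opp.symm) (op h.opp w) =
      (flipMap H * (op V * x.rTensor H * op V.symm) * flipMap H) (op h.opp w) by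
    refine LinearMap.ext fun w => ?_
    have := hmain (op h.opp.symm w)
    rwa [show op h.opp (op h.opp.symm w) = w from h.opp.apply_symm_apply w] at this
  intro w
  induction w with
  | zero => simp
  | add x y hx hy => simp only [map_add, hx, hy]
  | tmul η θ =>
    obtain ⟨y, hy, rfl⟩ := h.exists_apply_e θ
    -- z is in the commutant of S and z e = y e; both sides commute with the insertion of z, so only
    -- vectors η ⊗ e matter, and there X(η ⊗ e) = ΣV(η ⊗ e).
    set z := conjBy (invol V e ehat) (star y) with hz
    have hzc : ∀ w ∈ algS V, z * w = w * z := fun w hw => h.conjBy_commute hw (h.star_mem hy)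
    have hze : y e = z e := by
      have := h.conjBy_apply_e h.one_mem (h.star_mem hy)
      rw [star_star] at this
      simpa using this.symm
    have hXc : ∀ w, op h.opp (z.lTensor H w) = z.lTensor H (op h.opp w) :=
      lTensor_comm (fun ζ η => by rw [← h.algS_opp]; exact slL_mem _ _ _) hzc
    have e1 : ∀ ξ, op h.opp (ξ ⊗ₜ y e) = z.lTensor H (op h.opp (ξ ⊗ₜ e)) := fun ξ => by
      rw [← hXc, LinearMap.lTensor_tmul, hze]
    have e2 : (op V * x.rTensor H * op V.symm) (z.rTensor H (op V (η ⊗ₜ e))) =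
        z.rTensor H (op V (x η ⊗ₜ e)) := by
      refine (LinearMap.congr_fun (h.coproduct_comm_rTensor hx hzc) _).trans ?_
      rw [Module.End.mul_apply, Module.End.mul_apply, Module.End.mul_apply, hVV,
        LinearMap.rTensor_tmul]
    have e3 : ∀ ξ, op h.opp (ξ ⊗ₜ e) = flipMap H (op V (ξ ⊗ₜ e)) := h.opp_tmul_e
    have e4 : (op h.opp * x.rTensor H * op h.opp.symm) (op h.opp (η ⊗ₜ y e)) =
        op h.opp (x η ⊗ₜ y e) := by
      rw [Module.End.mul_apply, Module.End.mul_apply, hX, LinearMap.rTensor_tmul]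
    rw [e4, e1, e1, Module.End.mul_apply, Module.End.mul_apply, hfl, e3, e3, hff, e2,
      ← hff (z.lTensor H _), hfl, hff]

theorem algSHat_eq_span_symm (h : Std V e ehat) : algSHat V =
    Submodule.span ℂ (Set.range fun p : H × H => slR (op V.symm) p.1 p.2) := by
  rw [← h.algS_dual, algS_eq_span]
  simp only [slL_dual]

theorem slR_opp (h : Std V e ehat) (ζ η : H) :
    slR (op h.opp) ζ η = h.U * slR (op V.symm) ζ η * h.U := by
  ext θ
  rw [slR_apply, op_opp, Module.End.mul_apply, Module.End.mul_apply, braR_rTensor]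
  rfl

theorem mem_algSHat_opp (h : Std V e ehat) {y : Module.End ℂ H} :
    y ∈ algSHat h.opp ↔ h.U * y * h.U ∈ algSHat V := by
  have key : algSHat h.opp = (algSHat V).map (LinearMap.mulLeft ℂ h.U ∘ₗ
      LinearMap.mulRight ℂ h.U) := by
    rw [h.algSHat_eq_span_symm, algSHat_eq_span, Submodule.map_span, ← Set.range_comp]
    simp only [slR_opp, mul_assoc]
    rfl
  have huu : ∀ z : Module.End ℂ H, h.U * (h.U * z * h.U) * h.U = z := fun z => by
    rw [mul_assoc h.U z, ← mul_assoc h.U h.U, h.U_mul_U, one_mul, mul_assoc, h.U_mul_U, mul_one]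
  rw [key]
  constructor
  · rintro ⟨z, hz, rfl⟩
    have : h.U * ((LinearMap.mulLeft ℂ h.U ∘ₗ LinearMap.mulRight ℂ h.U) z) * h.U = z := by
      simp only [LinearMap.comp_apply, LinearMap.mulLeft_apply, LinearMap.mulRight_apply]
      rw [← mul_assoc h.U z]; exact huu z
    rwa [this]
  · intro hy
    refine ⟨_, hy, ?_⟩
    simp only [LinearMap.comp_apply, LinearMap.mulLeft_apply, LinearMap.mulRight_apply]
    rw [← mul_assoc h.U]; exact huu y

end Std

end MultUnitary

end

/-! ### The projections, subalgebras and dimensions attached to a pre-subgroup -/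

noncomputable section

namespace MultUnitary

set_option linter.unusedSectionVars false

variable {H : Type*} [NormedAddCommGroup H] [InnerProductSpace ℂ H] [FiniteDimensional ℂ H]
variable {V : (H ⊗[ℂ] H) ≃ₗᵢ[ℂ] (H ⊗[ℂ] H)} {e ehat f g : H}

theorem eq_of_inner_eq {K : Type*} [NormedAddCommGroup K] [InnerProductSpace ℂ K] {z w : K}
    (hn : inner ℂ w w = inner ℂ z z) (hi : inner ℂ z w = inner ℂ z z) : w = z := by
  rw [← sub_eq_zero, ← inner_self_eq_zero (𝕜 := ℂ), inner_sub_left, inner_sub_right,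
    inner_sub_right, hn, hi, ← inner_conj_symm w z, hi, inner_conj_symm]
  ring

/-- The equality case of Cauchy–Schwarz, used to identify a vector from one inner product and its
norm. -/
theorem eq_smul_of_inner_eq {K : Type*} [NormedAddCommGroup K] [InnerProductSpace ℂ K] {z w : K}
    {a : ℂ} (hz : inner ℂ z z = 1) (hi : inner ℂ z w = a)
    (hn : inner ℂ w w = starRingEnd ℂ a * a) : w = a • z := by
  refine eq_of_inner_eq ?_ ?_
  · rw [inner_smul_left, inner_smul_right, hz, hn, mul_one]
  · rw [inner_smul_left, inner_smul_left, inner_smul_right, hz, hi, mul_one]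

section Invariant

theorem lowerSpace_dual (V : (H ⊗[ℂ] H) ≃ₗᵢ[ℂ] (H ⊗[ℂ] H)) (f : H) :
    lowerSpace (dual V) f = upperSpace V f := by
  ext η
  change op (dual V) (η ⊗ₜ f) = η ⊗ₜ f ↔ V (f ⊗ₜ η) = f ⊗ₜ η
  rw [op_dual_tmul]
  have h1 : η ⊗ₜ[ℂ] f = TensorProduct.comm ℂ H H (f ⊗ₜ η) := by simp
  rw [h1, (TensorProduct.comm ℂ H H).injective.eq_iff, op_apply, V.symm_apply_eq, eq_comm]

theorem dual_invariant (hi : V (f ⊗ₜ f) = f ⊗ₜ f) : dual V (f ⊗ₜ f) = f ⊗ₜ f := by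
  have : f ∈ lowerSpace (dual V) f := by rw [lowerSpace_dual]; exact hi
  exact this

theorem symm_invariant {a b : H} (hi : V (a ⊗ₜ b) = a ⊗ₜ b) : op V.symm (a ⊗ₜ b) = a ⊗ₜ b := by
  rw [op_apply, V.symm_apply_eq, hi]

/-- Evaluate V₁₂V₁₃ = V₂₃V₁₂V₂₃* on η ⊗ f ⊗ f and pair with ⟨f ⊗ f| in the last two legs: both
factors V₂₃ disappear by invariance. -/
theorem slR_idem (hV : IsMultiplicative V) (hn : inner ℂ f f = (1 : ℂ))
    (hi : V (f ⊗ₜ f) = f ⊗ₜ f) (η : H) :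
    slR (op V) f f (slR (op V) f f η) = slR (op V) f f η := by
  have h1 := LinearMap.congr_fun hV.mul_12_13 (η ⊗ₜ (f ⊗ₜ f))
  simp only [Module.End.mul_apply, leg13_tmul, leg23_tmul, leg12_tmul, symm_invariant hi] at h1
  have h2 := congrArg (fun w => braR f (bra2 f w)) h1
  have key : ∀ z, braR f (bra2 f (leg23 (op V) z)) = braR f (bra2 f z) := by
    intro z
    suffices hs : braR f ∘ₗ bra2 f ∘ₗ leg23 (op V) = braR f ∘ₗ bra2 f from
      LinearMap.congr_fun hs z
    refine TensorProduct.ext' fun ξ w => ?_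
    simp only [LinearMap.comp_apply, leg23_tmul, LinearMap.lTensor_tmul, braR_tmul]
    rw [inner_braL, inner_braL, inner_op, symm_invariant hi]
  simp only [key, bra2_insR] at h2
  rw [braR_bra2, bra3_leg12, bra3_insM, braR_tmul, hn, one_smul] at h2
  exact h2

/-- V is isometric, so if ⟨η ⊗ f, V(η ⊗ f)⟩ = ‖η ⊗ f‖² then V fixes η ⊗ f. With `slR_idem` and
`star_slR_self` this makes p̂_f the orthogonal projection onto H_f. -/
theorem slR_apply_eq_iff (hn : inner ℂ f f = (1 : ℂ)) (η : H) :
    slR (op V) f f η = η ↔ η ∈ lowerSpace V f := by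
  constructor
  · intro h
    have h1 : inner ℂ (η ⊗ₜ[ℂ] f) (op V (η ⊗ₜ f)) = inner ℂ (η ⊗ₜ[ℂ] f) (η ⊗ₜ[ℂ] f) := by
      rw [← inner_slR, h, TensorProduct.inner_tmul, hn, mul_one]
    exact eq_of_inner_eq (V.inner_map_map _ _) h1
  · intro h
    have h1 : op V (η ⊗ₜ f) = η ⊗ₜ f := h
    rw [slR_apply, h1, braR_tmul, hn, one_smul]

/-- On the range H_f of p̂_f the unitary V* also fixes η ⊗ f, hence p̂_f* p̂_f = p̂_f, and the left
side is self-adjoint. -/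
theorem star_slR_self (hV : IsMultiplicative V) (hn : inner ℂ f f = (1 : ℂ))
    (hi : V (f ⊗ₜ f) = f ⊗ₜ f) : star (slR (op V) f f) = slR (op V) f f := by
  have h1 : star (slR (op V) f f) * slR (op V) f f = slR (op V) f f := by
    ext η
    have h2 : V (slR (op V) f f η ⊗ₜ f) = slR (op V) f f η ⊗ₜ f :=
      (slR_apply_eq_iff hn _).1 (slR_idem hV hn hi η)
    rw [Module.End.mul_apply, star_slR, slR_apply (op V.symm), symm_invariant h2, braR_tmul, hn,
      one_smul]
  conv_lhs => rw [← h1]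
  rw [star_mul, star_star, h1]

theorem star_slL_self (hV : IsMultiplicative V) (hn : inner ℂ f f = (1 : ℂ))
    (hi : V (f ⊗ₜ f) = f ⊗ₜ f) : star (slL (op V) f f) = slL (op V) f f := by
  have h1 := star_slR_self hV.dual hn (dual_invariant hi)
  rw [slR_dual, ← star_slL, star_star] at h1
  exact h1.symm

theorem slR_dual_self (hV : IsMultiplicative V) (hn : inner ℂ f f = (1 : ℂ))
    (hi : V (f ⊗ₜ f) = f ⊗ₜ f) : slR (op (dual V)) f f = slL (op V) f f := by
  rw [slR_dual, ← star_slL, star_slL_self hV hn hi]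

theorem slL_dual_self (hV : IsMultiplicative V) (hn : inner ℂ f f = (1 : ℂ))
    (hi : V (f ⊗ₜ f) = f ⊗ₜ f) : slL (op (dual V)) f f = slR (op V) f f := by
  rw [slL_dual, ← star_slR, star_slR_self hV hn hi]

theorem slL_idem (hV : IsMultiplicative V) (hn : inner ℂ f f = (1 : ℂ))
    (hi : V (f ⊗ₜ f) = f ⊗ₜ f) (η : H) :
    slL (op V) f f (slL (op V) f f η) = slL (op V) f f η := by
  have := slR_idem hV.dual hn (dual_invariant hi) η
  rwa [slR_dual_self hV hn hi] at this

theorem slL_apply_eq_iff (hV : IsMultiplicative V) (hn : inner ℂ f f = (1 : ℂ))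
    (hi : V (f ⊗ₜ f) = f ⊗ₜ f) (η : H) :
    slL (op V) f f η = η ↔ η ∈ upperSpace V f := by
  rw [← slR_dual_self hV hn hi, slR_apply_eq_iff hn, lowerSpace_dual]

end Invariant

/-- p_f fixes f, so the component of p_f e along f is ⟨f, e⟩; by `braR_op_e`, ‖p_f e‖² = |⟨f, e⟩|²,
so nothing else remains. -/
theorem Std.slL_self_apply_e (h : Std V e ehat) (hn : inner ℂ f f = (1 : ℂ))
    (hi : V (f ⊗ₜ f) = f ⊗ₜ f) : slL (op V) f f e = inner ℂ f e • f := by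
  refine eq_smul_of_inner_eq hn ?_ ?_
  · rw [← star_slL_self h.mult hn hi, inner_star_right, slL_apply, op_apply, hi, braL_tmul, hn,
      one_smul]
  · conv_lhs => enter [2]; rw [← star_slL_self h.mult hn hi]
    rw [inner_star_left, slL_idem h.mult hn hi, inner_slL, ← inner_braR,
      h.braR_op_e, inner_smul_right, inner_conj_symm]

namespace IsPreSubgroup

theorem inner_self (hf : IsPreSubgroup V e f) : inner ℂ f f = (1 : ℂ) := by
  rw [inner_self_eq_norm_sq_to_K, hf.norm_eq_one]; simp

theorem exists_real (hf : IsPreSubgroup V e f) : ∃ a : ℝ, 0 < a ∧ inner ℂ f e = (a : ℂ) := by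
  have h1 := Complex.pos_iff.1 hf.inner_pos
  exact ⟨_, h1.1, Complex.ext rfl h1.2.symm⟩

theorem inner_comm (hf : IsPreSubgroup V e f) : inner ℂ e f = inner ℂ f e := by
  obtain ⟨a, -, ha⟩ := hf.exists_real
  rw [← inner_conj_symm, ha, Complex.conj_ofReal]

theorem inner_ne (hf : IsPreSubgroup V e f) : inner ℂ f e ≠ (0 : ℂ) := hf.inner_pos.ne'

variable (hf : IsPreSubgroup V e f) (hg : IsPreSubgroup V e g) (h : Std V e ehat)
include hf h

theorem star_p : star (slL (op V) f f) = slL (op V) f f :=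
  star_slL_self h.mult hf.inner_self hf.invariant

theorem star_phat : star (slR (op V) f f) = slR (op V) f f :=
  star_slR_self h.mult hf.inner_self hf.invariant

theorem p_idem (η : H) : slL (op V) f f (slL (op V) f f η) = slL (op V) f f η :=
  slL_idem h.mult hf.inner_self hf.invariant η

theorem p_e : slL (op V) f f e = inner ℂ f e • f := h.slL_self_apply_e hf.inner_self hf.invariant

theorem p_ehat : slL (op V) f f ehat = ehat := by
  rw [h.slL_apply_ehat, hf.inner_self, one_smul]

/-- Compute ⟨ê, p_f e⟩ in two ways, from p_f ê = ê and from p_f e = ⟨f, e⟩f. In particular ⟨f, ê⟩ >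
0, so f is a pre-subgroup for the dual too. -/
theorem inner_ehat_mul : inner ℂ ehat f * inner ℂ f e = (Std.scale H : ℂ) := by
  have h1 : inner ℂ ehat (slL (op V) f f e) = (Std.scale H : ℂ) := by
    rw [← hf.star_p h, inner_star_right, hf.p_ehat h, h.inner_ehat_e]
  rwa [hf.p_e h, inner_smul_right, mul_comm] at h1

theorem dual : IsPreSubgroup (dual V) ehat f where
  norm_eq_one := hf.norm_eq_one
  inner_pos := by
    obtain ⟨a, ha0, ha⟩ := hf.exists_real
    have h1 := hf.inner_ehat_mul h
    rw [ha] at h1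
    have h2 : inner ℂ ehat f = ((Std.scale H / a : ℝ) : ℂ) := by
      rw [Complex.ofReal_div, eq_div_iff (by exact_mod_cast ha0.ne'), h1]
    rw [← inner_conj_symm, h2, Complex.conj_ofReal]
    exact_mod_cast div_pos h.scale_pos ha0
  invariant := dual_invariant hf.invariant

theorem inner_mul_inner : inner ℂ f ehat * inner ℂ f e = (Std.scale H : ℂ) := by
  rw [← (hf.dual h).inner_comm, hf.inner_ehat_mul h]

theorem invol_self : invol V e ehat f = f := by
  have h1 := h.invol_apply_e (slL_mem V f f)
  obtain ⟨a, -, ha⟩ := hf.exists_real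
  rw [hf.star_p h, hf.p_e h, LinearMap.map_smulₛₗ, ha, Complex.conj_ofReal, ← ha] at h1
  exact smul_right_injective _ hf.inner_ne h1

theorem invol_dual_self : invol (MultUnitary.dual V) ehat e f = f :=
  (hf.dual h).invol_self h.dual

theorem opp : IsPreSubgroup h.opp e f where
  norm_eq_one := hf.norm_eq_one
  inner_pos := hf.inner_pos
  invariant := by
    have := (h.opp_tmul_eq_iff f f).2 hf.invariant
    rwa [hf.invol_dual_self h] at this

theorem invol_phat (b : H) :
    invol V e ehat (slR (op V) f f b) = slR (op V) f f (invol V e ehat b) := by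
  refine ext_inner_left ℂ fun k => ?_
  rw [h.inner_invol_comm, ← inner_conj_symm, inner_slR, ← inner_slL, ← h.slL_symm_invol, inner_slL,
    inner_op, V.symm_symm, h.invol_invol, inner_slR]
  exact inner_conj_symm (𝕜 := ℂ) (E := H ⊗[ℂ] H) _ _

theorem invol_mem_lowerSpace {η : H} (hη : η ∈ lowerSpace V f) :
    invol V e ehat η ∈ lowerSpace V f := by
  rw [← slR_apply_eq_iff hf.inner_self] at hη ⊢
  rw [← hf.invol_phat h, hη]

theorem invol_dual_mem_upperSpace {η : H} (hη : η ∈ upperSpace V f) :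
    invol (MultUnitary.dual V) ehat e η ∈ upperSpace V f := by
  rw [← lowerSpace_dual] at hη ⊢
  exact (hf.dual h).invol_mem_lowerSpace h.dual hη

theorem apply_self_of_mem {x : Module.End ℂ H} (hx : x ∈ algG V e f) :
    x f = Std.counit ehat x • f := by
  have h1 := h.braL_ehat hx.1 f
  have h2 : op V (x e ⊗ₜ f) = x e ⊗ₜ f := hx.2
  rw [h2, braL_tmul, h.inner_ehat_apply_e hx.1, mul_smul] at h1
  exact (smul_right_injective _ h.scale_ne h1).symm

/-- The case θ = e is the definition; operators in the commutant of S take e to any θ and commute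
with Δ(x) in the first leg. In this form G_f is visibly closed under products. -/
theorem mem_algG_iff {x : Module.End ℂ H} (hx : x ∈ algS V) : x ∈ algG V e f ↔
    ∀ θ, (op V * x.rTensor H * op V.symm) (θ ⊗ₜ f) = x θ ⊗ₜ f := by
  have hce : (op V * x.rTensor H * op V.symm) (e ⊗ₜ f) = op V (x e ⊗ₜ f) := by
    rw [Module.End.mul_apply, Module.End.mul_apply, h.fixed.symm_apply, LinearMap.rTensor_tmul]
  constructor
  · intro hxG θ
    obtain ⟨y, hy, rfl⟩ := h.exists_apply_e θ
    have hc : ∀ w ∈ algS V, _ := fun w hw => h.conjBy_commute hw (h.star_mem hy)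
    have hze := h.conjBy_apply_e h.one_mem (h.star_mem hy)
    rw [star_star, Module.End.one_apply, Module.End.one_apply] at hze
    have h1 : (op V * x.rTensor H * op V.symm) ((conjBy (invol V e ehat) (star y)).rTensor H
        (e ⊗ₜ f)) = (conjBy (invol V e ehat) (star y)).rTensor H
          ((op V * x.rTensor H * op V.symm) (e ⊗ₜ f)) :=
      LinearMap.congr_fun (h.coproduct_comm_rTensor hx hc) (e ⊗ₜ f)
    rw [LinearMap.rTensor_tmul, hce, hze] at h1
    have h2 : op V (x e ⊗ₜ f) = x e ⊗ₜ f := hxG.2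
    rw [h1, h2, LinearMap.rTensor_tmul, ← hze]
    congr 1
    exact LinearMap.congr_fun (hc x hx) e
  · intro hθ
    exact ⟨hx, hce.symm.trans (hθ e)⟩

theorem mul_mem {x y : Module.End ℂ H} (hx : x ∈ algG V e f) (hy : y ∈ algG V e f) :
    x * y ∈ algG V e f := by
  refine (hf.mem_algG_iff h (h.mul_mem hx.1 hy.1)).2 fun θ => ?_
  have h1 := (hf.mem_algG_iff h hx.1).1 hx (y θ)
  rw [← (hf.mem_algG_iff h hy.1).1 hy θ] at h1
  refine Eq.trans ?_ h1
  simp only [Module.End.mul_apply]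
  rw [show op V.symm (op V (y.rTensor H (op V.symm (θ ⊗ₜ f)))) = y.rTensor H (op V.symm (θ ⊗ₜ f))
    from V.symm_apply_apply _]
  congr 1
  exact LinearMap.congr_fun (LinearMap.rTensor_comp H x y) _

theorem star_mem {x : Module.End ℂ H} (hx : x ∈ algG V e f) : star x ∈ algG V e f := by
  refine ⟨h.star_mem hx.1, ?_⟩
  rw [← h.invol_apply_e hx.1]
  exact hf.invol_mem_lowerSpace h hx.2

theorem p_mem : slL (op V) f f ∈ algG V e f := by
  refine ⟨slL_mem _ _ _, ?_⟩
  rw [hf.p_e h]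
  exact Submodule.smul_mem _ _ hf.invariant

theorem elt_mem_algG {η : H} (hη : η ∈ lowerSpace V f) : Std.elt V ehat η ∈ algG V e f :=
  ⟨Std.elt_mem _, by rwa [h.elt_e]⟩

theorem phat_mul_ehat : slR (op V) f f ehat = inner ℂ f ehat • f := by
  have := (hf.dual h).p_e h.dual
  rwa [slL_dual_self h.mult hf.inner_self hf.invariant] at this

theorem mem_map_antip {N : Submodule ℂ H} {η : H} :
    η ∈ N.map (antipodeOperator V e) ↔ h.antip η ∈ N := by
  constructor
  · rintro ⟨ξ, hξ, rfl⟩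
    rw [h.antip_eq, h.antip_antip]; exact hξ
  · intro hη
    exact ⟨_, hη, by rw [h.antip_eq, h.antip_antip]⟩

theorem mem_lowerSpace_opp {η : H} :
    η ∈ lowerSpace h.opp f ↔ invol (MultUnitary.dual V) ehat e η ∈ lowerSpace V f := by
  have := h.opp_tmul_eq_iff (invol (MultUnitary.dual V) ehat e η) f
  rwa [hf.invol_dual_self h, h.dual.invol_invol] at this

theorem mem_upperSpace_opp {η : H} :
    η ∈ upperSpace h.opp f ↔ η ∈ upperSpace V f := by
  have := h.opp_tmul_eq_iff f (invol (MultUnitary.dual V) ehat e η)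
  rw [hf.invol_dual_self h, h.dual.invol_invol] at this
  refine this.trans ⟨fun hη => ?_, fun hη => hf.invol_dual_mem_upperSpace h hη⟩
  have := hf.invol_dual_mem_upperSpace h (η := invol (MultUnitary.dual V) ehat e η) hη
  rwa [h.dual.invol_invol] at this

theorem lowerSpace_opp : lowerSpace h.opp f = (lowerSpace V f).map (antipodeOperator V e) := by
  ext η
  rw [hf.mem_lowerSpace_opp h, hf.mem_map_antip h, Std.antip_apply, h.invol_comm]
  refine ⟨fun hη => hf.invol_mem_lowerSpace h hη, fun hη => ?_⟩
  have := hf.invol_mem_lowerSpace h hη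
  rwa [h.invol_invol] at this

/-- `D_f` is `G_f` for the opposite multiplicative unitary. -/
theorem algG_opp : algG h.opp e f = algD V e f := by
  rw [algG, algD, h.algS_opp, hf.lowerSpace_opp h]

/-- dim H_f is the trace of p̂_f. The slices of V(ê ⊗ e) are n^{-1/2} times an antiunitary, so ‖(1 ⊗
p̂_f)V(ê ⊗ e)‖² is that trace divided by n; it is also ‖p̂_f ê‖² = ⟨f, ê⟩², because 1 ⊗ p̂_f can be
moved through V. -/
theorem finrank_lowerSpace : (Std.scale H : ℂ) ^ 2 * Module.finrank ℂ (lowerSpace V f) =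
    inner ℂ f ehat ^ 2 := by
  set ε := stdOrthonormalBasis ℂ H
  have hproj : LinearMap.IsProj (lowerSpace V f) (slR (op V) f f) :=
    ⟨fun x => (slR_apply_eq_iff hf.inner_self _).1 (slR_idem h.mult hf.inner_self hf.invariant x),
      fun x hx => (slR_apply_eq_iff hf.inner_self _).2 hx⟩
  rw [← hproj.trace, LinearMap.trace_eq_sum_inner _ ε]
  have h1 := norm_sq_eq_sum_braR ε ((slR (op V) f f).lTensor H (op V (ehat ⊗ₜ e)))
  rw [h.lTensor_op_e (slR_mem _ _ _)] at h1
  have h2 : inner ℂ (op V (slR (op V) f f ehat ⊗ₜ e)) (op V (slR (op V) f f ehat ⊗ₜ e)) =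
      inner ℂ f ehat ^ 2 := by
    refine (V.inner_map_map _ _).trans ?_
    rw [TensorProduct.inner_tmul, h.inner_ee, hf.phat_mul_ehat h, inner_smul_left, inner_smul_right,
      hf.inner_self, inner_conj_symm, (hf.dual h).inner_comm]
    ring
  rw [← h2, h1, Finset.mul_sum]
  refine Finset.sum_congr rfl fun i _ => ?_
  rw [← h.lTensor_op_e (slR_mem _ _ _), braR_lTensor, hf.star_phat h, h.braR_op_ehat_e,
    inner_smul_left, inner_smul_right, h.dual.inner_invol_invol, Complex.conj_ofReal, ← mul_assoc,
    ← sq]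
  conv_rhs => enter [2, 2]; rw [← hf.star_phat h]
  rw [inner_star_left, slR_idem h.mult hf.inner_self hf.invariant]

theorem finrank_upperSpace : (Std.scale H : ℂ) ^ 2 * Module.finrank ℂ (upperSpace V f) =
    inner ℂ f e ^ 2 := by
  rw [← lowerSpace_dual]; exact (hf.dual h).finrank_lowerSpace h.dual

theorem finrank_mul : Module.finrank ℂ (lowerSpace V f) * Module.finrank ℂ (upperSpace V f) =
    Module.finrank ℂ H := by
  have h1 := hf.finrank_lowerSpace h
  have h2 := hf.finrank_upperSpace h
  have h3 := hf.inner_mul_inner h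
  have hc := h.scale_ne
  have hn : (Module.finrank ℂ H : ℂ) * (Std.scale H : ℂ) ^ 2 = 1 := by
    exact_mod_cast h.finrank_mul_scale_sq
  have h4 : (Module.finrank ℂ (lowerSpace V f) * Module.finrank ℂ (upperSpace V f) : ℂ) *
      (Std.scale H : ℂ) ^ 2 = 1 := by
    have h5 : ((Std.scale H : ℂ) ^ 2 * Module.finrank ℂ (lowerSpace V f)) *
        ((Std.scale H : ℂ) ^ 2 * Module.finrank ℂ (upperSpace V f)) = (Std.scale H : ℂ) ^ 2 := by
      rw [h1, h2, ← mul_pow, h3]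
    have h6 : (Std.scale H : ℂ) ^ 2 ≠ 0 := pow_ne_zero _ hc
    refine mul_left_cancel₀ h6 ?_
    linear_combination h5
  rw [← hn] at h4
  exact_mod_cast mul_right_cancel₀ (pow_ne_zero 2 hc) h4

end IsPreSubgroup

end MultUnitary

end

/-! ### Pairs of pre-subgroups and the factorization S = G_f D_g -/

noncomputable section

namespace MultUnitary

set_option linter.unusedSectionVars false

variable {H : Type*} [NormedAddCommGroup H] [InnerProductSpace ℂ H] [FiniteDimensional ℂ H]
variable {V : (H ⊗[ℂ] H) ≃ₗᵢ[ℂ] (H ⊗[ℂ] H)} {e ehat f g : H}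

/-- The vector state of `e` is a trace on `S`. -/
theorem Std.inner_apply_e_comm (h : Std V e ehat) {x y : Module.End ℂ H} (hx : x ∈ algS V)
    (hy : y ∈ algS V) : inner ℂ e (x (y e)) = inner ℂ e (y (x e)) := by
  rw [← inner_star_left, ← h.invol_apply_e hx, ← inner_conj_symm, h.inner_invol_comm,
    inner_conj_symm, h.invol_apply_e hy, inner_star_left]

/-- A product of two subalgebras which are independent for the trace is everything, if the
dimensions allow it. -/
theorem Std.mem_span_mul (h : Std V e ehat) (N₁ N₂ : Submodule ℂ H)
    (hm₁ : ∀ x ∈ algS V, ∀ y ∈ algS V, x e ∈ N₁ → y e ∈ N₁ → (x * y) e ∈ N₁)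
    (hs₁ : ∀ x ∈ algS V, x e ∈ N₁ → star x e ∈ N₁)
    (hm₂ : ∀ x ∈ algS V, ∀ y ∈ algS V, x e ∈ N₂ → y e ∈ N₂ → (x * y) e ∈ N₂)
    (hs₂ : ∀ x ∈ algS V, x e ∈ N₂ → star x e ∈ N₂)
    (hind : ∀ a ∈ N₁, ∀ b ∈ N₂, inner ℂ a b = inner ℂ a e * inner ℂ e b)
    (hdim : Module.finrank ℂ N₁ * Module.finrank ℂ N₂ = Module.finrank ℂ H)
    {x : Module.End ℂ H} (hx : x ∈ algS V) :
    x ∈ Submodule.span ℂ {z | ∃ u, (u ∈ algS V ∧ u e ∈ N₁) ∧ ∃ v, (v ∈ algS V ∧ v e ∈ N₂) ∧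
      z = u * v} := by
  set a := stdOrthonormalBasis ℂ N₁
  set b := stdOrthonormalBasis ℂ N₂
  set u : Fin (Module.finrank ℂ N₁) → Module.End ℂ H := fun i => Std.elt V ehat (a i : H) with hu
  set v : Fin (Module.finrank ℂ N₂) → Module.End ℂ H := fun i => Std.elt V ehat (b i : H) with hv
  have uS : ∀ i, u i ∈ algS V := fun i => Std.elt_mem _
  have vS : ∀ i, v i ∈ algS V := fun i => Std.elt_mem _
  have ue : ∀ i, u i e = a i := fun i => h.elt_e _
  have ve : ∀ i, v i e = b i := fun i => h.elt_e _
  have uN : ∀ i, u i e ∈ N₁ := fun i => by rw [ue]; exact (a i).2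
  have vN : ∀ i, v i e ∈ N₂ := fun i => by rw [ve]; exact (b i).2
  -- The products of orthonormal bases remain orthonormal, and there are dim H of them, so they
  -- span.
  have horth : Orthonormal ℂ fun p : Fin (Module.finrank ℂ N₁) × Fin (Module.finrank ℂ N₂) =>
      (u p.1 * v p.2) e := by
    rw [orthonormal_iff_ite]
    rintro ⟨i, j⟩ ⟨k, l⟩
    have e1 : inner ℂ ((u i * v j) e) ((u k * v l) e) =
        inner ℂ e ((star (v j)) ((star (u i) * u k * v l) e)) := by
      rw [inner_star_right]
      simp only [Module.End.mul_apply]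
      rw [inner_star_right]
    have huu : star (u i) * u k ∈ algS V := h.mul_mem (h.star_mem (uS i)) (uS k)
    have hvv : v l * star (v j) ∈ algS V := h.mul_mem (vS l) (h.star_mem (vS j))
    -- The trace property moves v_j* behind v_l, which brings together the factors from N₁ and those
    -- from N₂.
    have e2 : inner ℂ e ((star (v j)) ((star (u i) * u k * v l) e)) =
        inner ℂ (star (star (u i) * u k) e) ((v l * star (v j)) e) := by
      rw [h.inner_apply_e_comm (h.star_mem (vS j)) (h.mul_mem huu (vS l)), inner_star_left]
      rfl
    have e3 := hind _ (hs₁ _ huu (hm₁ _ (h.star_mem (uS i)) _ (uS k) (hs₁ _ (uS i) (uN i)) (uN k)))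
      _ (hm₂ _ (vS l) _ (h.star_mem (vS j)) (vN l) (hs₂ _ (vS j) (vN j)))
    have e4 : inner ℂ (star (star (u i) * u k) e) e = if i = k then (1 : ℂ) else 0 := by
      rw [inner_star_left, Module.End.mul_apply, inner_star_right, ue, ue]
      exact (orthonormal_iff_ite.1 a.orthonormal) i k
    have e5 : inner ℂ e ((v l * star (v j)) e) = if j = l then (1 : ℂ) else 0 := by
      rw [Module.End.mul_apply, h.inner_apply_e_comm (vS l) (h.star_mem (vS j)), inner_star_right,
        ve, ve]
      exact (orthonormal_iff_ite.1 b.orthonormal) j l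
    rw [e1, e2, e3, e4, e5]
    by_cases hik : i = k <;> by_cases hjl : j = l <;> simp [hik, hjl]
  have hspan := horth.linearIndependent.span_eq_top_of_card_eq_finrank' (by simp [hdim])
  set P := Submodule.span ℂ {z | ∃ u, (u ∈ algS V ∧ u e ∈ N₁) ∧ ∃ v, (v ∈ algS V ∧ v e ∈ N₂) ∧
      z = u * v} with hP
  have hPS : P ≤ algS V := Submodule.span_le.2 (by
    rintro _ ⟨u, hu, v, hv, rfl⟩; exact h.mul_mem hu.1 hv.1)
  have hmap : (⊤ : Submodule ℂ H) ≤ P.map (LinearMap.applyₗ e) := by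
    rw [← hspan, Submodule.span_le]
    rintro _ ⟨p, rfl⟩
    exact ⟨u p.1 * v p.2, Submodule.subset_span ⟨_, ⟨uS _, uN _⟩, _, ⟨vS _, vN _⟩, rfl⟩, rfl⟩
  obtain ⟨y, hy, hye⟩ := hmap (Submodule.mem_top : x e ∈ ⊤)
  have : x = y := h.eq_of_apply_e hx (hPS hy) hye.symm
  rw [this]
  exact hy

/-- Two pre-subgroups in general position. -/
structure Pair (V : (H ⊗[ℂ] H) ≃ₗᵢ[ℂ] (H ⊗[ℂ] H)) (e ehat f g : H) : Prop where
  std : Std V e ehat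
  left : IsPreSubgroup V e f
  right : IsPreSubgroup V e g
  inner_eq : inner ℂ f g = (Std.scale H : ℂ)

namespace Pair

variable (k : Pair V e ehat f g)
include k

theorem inner_eq' : inner ℂ g f = (Std.scale H : ℂ) := by
  rw [← inner_conj_symm, k.inner_eq, Complex.conj_ofReal]

theorem symm : Pair V e ehat g f := ⟨k.std, k.right, k.left, k.inner_eq'⟩

theorem dual : Pair (dual V) ehat e f g :=
  ⟨k.std.dual, k.left.dual k.std, k.right.dual k.std, k.inner_eq⟩

theorem opp : Pair k.std.opp e ehat f g :=
  ⟨k.std.std_opp, k.left.opp k.std, k.right.opp k.std, k.inner_eq⟩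

/-- Traciality reduces ⟨e, p_f p_g p_f e⟩ to ⟨p_g e, p_f e⟩ = ⟨g, e⟩⟨f, e⟩⟨g, f⟩. -/
theorem inner_p_p : inner ℂ (slL (op V) g g (slL (op V) f f e)) (slL (op V) g g (slL (op V) f f e)) =
    (Std.scale H : ℂ) * (inner ℂ f e * inner ℂ g e) := by
  have hp := slL_mem V f f
  have hq := slL_mem V g g
  rw [← inner_star_right, k.right.star_p k.std, k.right.p_idem k.std, ← inner_star_right,
    k.left.star_p k.std, ← Module.End.mul_apply (slL (op V) g g),
    k.std.inner_apply_e_comm hp (k.std.mul_mem hq hp), Module.End.mul_apply, k.left.p_idem k.std,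
    k.left.p_e k.std, ← k.right.star_p k.std, inner_star_right, k.right.p_e k.std, inner_smul_left,
    inner_smul_right, k.inner_eq', inner_conj_symm, k.right.inner_comm]
  ring

theorem inner_ehat_p_p : inner ℂ ehat (slL (op V) g g (slL (op V) f f e)) = (Std.scale H : ℂ) := by
  rw [← k.right.star_p k.std, inner_star_right, k.right.p_ehat k.std, ← k.left.star_p k.std,
    inner_star_right, k.left.p_ehat k.std, k.std.inner_ehat_e]

/-- Cauchy–Schwarz for ê and p_g p_f e, whose inner product is n^{-1/2}. -/
theorem scale_le {a b : ℝ} (ha : inner ℂ f e = (a : ℂ)) (hb : inner ℂ g e = (b : ℂ)) :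
    Std.scale H ≤ a * b := by
  have h1 := k.inner_p_p
  rw [ha, hb, inner_self_eq_norm_sq_to_K] at h1
  have h2 : ‖slL (op V) g g (slL (op V) f f e)‖ ^ 2 = Std.scale H * (a * b) := Complex.ofReal_injective (by push_cast; exact h1)
  have h3 := norm_inner_le_norm (𝕜 := ℂ) ehat (slL (op V) g g (slL (op V) f f e))
  rw [k.inner_ehat_p_p, k.std.norm_ehat, one_mul, Complex.norm_real, Real.norm_eq_abs,
    abs_of_pos k.std.scale_pos] at h3
  have h4 : Std.scale H ^ 2 ≤ Std.scale H * (a * b) := by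
    rw [← h2]; exact pow_le_pow_left₀ k.std.scale_pos.le h3 2
  rw [sq] at h4
  exact le_of_mul_le_mul_left h4 k.std.scale_pos

/-- The lower bound `scale_le` holds for V and for its dual. By `IsPreSubgroup.inner_mul_inner` for
f and for g, the two bounded quantities have product exactly n^{-1}, so both bounds are attained. -/
theorem inner_mul_inner : inner ℂ f e * inner ℂ g e = (Std.scale H : ℂ) := by
  obtain ⟨a, ha0, ha⟩ := k.left.exists_real
  obtain ⟨b, hb0, hb⟩ := k.right.exists_real
  obtain ⟨a', ha0', ha'⟩ := k.dual.left.exists_real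
  obtain ⟨b', hb0', hb'⟩ := k.dual.right.exists_real
  have h1 := k.scale_le ha hb
  have h2 := k.dual.scale_le ha' hb'
  have h3 := k.left.inner_mul_inner k.std
  have h4 := k.right.inner_mul_inner k.std
  rw [ha, ha'] at h3
  rw [hb, hb'] at h4
  have h3' : a' * a = Std.scale H := by exact_mod_cast h3
  have h4' : b' * b = Std.scale H := by exact_mod_cast h4
  have hc := k.std.scale_pos
  have h5 : (a * b) * (a' * b') = Std.scale H * Std.scale H := by
    calc (a * b) * (a' * b') = (a' * a) * (b' * b) := by ring
      _ = _ := by rw [h3', h4']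
  have h6 : a * b ≤ Std.scale H := by
    by_contra hlt
    push Not at hlt
    nlinarith [mul_pos ha0' hb0']
  rw [ha, hb]
  exact_mod_cast le_antisymm h6 h1

theorem p_p_e : slL (op V) g g (slL (op V) f f e) = (Std.scale H : ℂ) • ehat := by
  refine eq_smul_of_inner_eq k.std.inner_hh k.inner_ehat_p_p ?_
  rw [k.inner_p_p, k.inner_mul_inner, Complex.conj_ofReal]

/-- Equality in Cauchy–Schwarz puts p_g p_f e on the line of ê, and e separates S. All later
general-position statements come from this one and its dual. -/
theorem p_mul_p : slL (op V) g g * slL (op V) f f = (innerₛₗ ℂ ehat).smulRight ehat := by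
  rw [← k.std.slL_ehat_ehat]
  refine k.std.eq_of_apply_e (k.std.mul_mem (slL_mem _ _ _) (slL_mem _ _ _)) (slL_mem _ _ _) ?_
  rw [Module.End.mul_apply, k.p_p_e, k.std.slL_ehat_ehat]
  simp [k.std.inner_ehat_e]

theorem p_apply : slL (op V) g g f = inner ℂ g e • ehat := by
  have h1 := k.p_p_e
  rw [k.left.p_e k.std, map_smul, ← k.inner_mul_inner, mul_smul] at h1
  exact smul_right_injective _ k.left.inner_ne h1

theorem apply_p {x : Module.End ℂ H} (hx : x ∈ algG V e f) :
    x * slL (op V) f f = Std.counit ehat x • slL (op V) f f := by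
  refine k.std.eq_of_apply_e (k.std.mul_mem hx.1 (slL_mem _ _ _))
    (Submodule.smul_mem _ _ (slL_mem _ _ _)) ?_
  rw [Module.End.mul_apply, k.left.p_e k.std, map_smul, k.left.apply_self_of_mem k.std hx,
    LinearMap.smul_apply, k.left.p_e k.std, smul_comm]

theorem p_apply_left {x : Module.End ℂ H} (hx : x ∈ algG V e f) :
    slL (op V) f f * x = Std.counit ehat x • slL (op V) f f := by
  have h1 := congrArg star (k.apply_p (k.left.star_mem k.std hx))
  rwa [star_mul, star_smul, star_star, k.left.star_p k.std, Std.counit_star, starRingEnd_apply,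
    star_star] at h1

theorem finrank_mul :
    Module.finrank ℂ (lowerSpace V f) * Module.finrank ℂ (lowerSpace V g) =
      Module.finrank ℂ H := by
  have h1 := k.left.finrank_lowerSpace k.std
  have h2 := k.right.finrank_lowerSpace k.std
  have h3 := k.dual.inner_mul_inner
  have hc := k.std.scale_ne
  have hn : (Module.finrank ℂ H : ℂ) * (Std.scale H : ℂ) ^ 2 = 1 := by
    exact_mod_cast k.std.finrank_mul_scale_sq
  have h4 : (Module.finrank ℂ (lowerSpace V f) * Module.finrank ℂ (lowerSpace V g) : ℂ) *
      (Std.scale H : ℂ) ^ 2 = 1 := by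
    have h5 : ((Std.scale H : ℂ) ^ 2 * Module.finrank ℂ (lowerSpace V f)) *
        ((Std.scale H : ℂ) ^ 2 * Module.finrank ℂ (lowerSpace V g)) = (Std.scale H : ℂ) ^ 2 := by
      rw [h1, h2, ← mul_pow, h3]
    have h6 : (Std.scale H : ℂ) ^ 2 ≠ 0 := pow_ne_zero _ hc
    refine mul_left_cancel₀ h6 ?_
    linear_combination h5
  rw [← hn] at h4
  exact_mod_cast mul_right_cancel₀ (pow_ne_zero 2 hc) h4

theorem phat_mul_phat : slR (op V) g g * slR (op V) f f = (innerₛₗ ℂ e).smulRight e := by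
  have := k.dual.p_mul_p
  rwa [slL_dual_self k.std.mult k.left.inner_self k.left.invariant,
    slL_dual_self k.std.mult k.right.inner_self k.right.invariant] at this

theorem phat_apply : slR (op V) g g f = inner ℂ g ehat • e := by
  have := k.dual.p_apply
  rwa [slL_dual_self k.std.mult k.right.inner_self k.right.invariant] at this

/-- p̂_f p̂_g is the projection onto e. This is the independence for the trace required by
`Std.mem_span_mul`. -/
theorem inner_of_mem {a b : H} (ha : a ∈ lowerSpace V f) (hb : b ∈ lowerSpace V g) :
    inner ℂ a b = inner ℂ a e * inner ℂ e b := by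
  have ha' := (slR_apply_eq_iff k.left.inner_self a).2 ha
  have hb' := (slR_apply_eq_iff k.right.inner_self b).2 hb
  conv_lhs => rw [← ha', ← hb', ← k.left.star_phat k.std, inner_star_left,
    ← Module.End.mul_apply, k.symm.phat_mul_phat]
  simp [mul_comm]

/-- `S` is spanned by the products of elements of `G_f` and `G_g`. -/
theorem mem_span_algG_mul_algG {x : Module.End ℂ H} (hx : x ∈ algS V) :
    x ∈ Submodule.span ℂ {z | ∃ u, u ∈ algG V e f ∧ ∃ v, v ∈ algG V e g ∧ z = u * v} :=
  k.std.mem_span_mul (lowerSpace V f) (lowerSpace V g)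
    (fun _ hx _ hy hxe hye => (k.left.mul_mem k.std ⟨hx, hxe⟩ ⟨hy, hye⟩).2)
    (fun _ hx hxe => (k.left.star_mem k.std ⟨hx, hxe⟩).2)
    (fun _ hx _ hy hxe hye => (k.right.mul_mem k.std ⟨hx, hxe⟩ ⟨hy, hye⟩).2)
    (fun _ hx hxe => (k.right.star_mem k.std ⟨hx, hxe⟩).2)
    (fun _ ha _ hb => k.inner_of_mem ha hb) k.finrank_mul hx

/-- By S = G_f G_g it suffices to take x = uv; then p_f absorbs u, p_g absorbs v, and p_f p_g
remains. Letting x vary is what allows p_g to be replaced by its conjugate in the commutant, hence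
H_g by UH_g and G_g by D_g. -/
theorem p_mul_mul_p {x : Module.End ℂ H} (hx : x ∈ algS V) :
    slL (op V) f f * x * slL (op V) g g =
      Std.counit ehat x • (innerₛₗ ℂ ehat).smulRight ehat := by
  have hle : Submodule.span ℂ {z | ∃ u, u ∈ algG V e f ∧ ∃ v, v ∈ algG V e g ∧ z = u * v} ≤
      LinearMap.eqLocus
        (LinearMap.mulRight ℂ (slL (op V) g g) ∘ₗ LinearMap.mulLeft ℂ (slL (op V) f f))
        ((Std.counit ehat).smulRight ((innerₛₗ ℂ ehat).smulRight ehat)) := by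
    rw [Submodule.span_le]
    rintro _ ⟨u, hu, v, hv, rfl⟩
    change slL (op V) f f * (u * v) * slL (op V) g g =
      Std.counit ehat (u * v) • (innerₛₗ ℂ ehat).smulRight ehat
    have hc : Std.counit ehat (u * v) = Std.counit ehat u * Std.counit ehat v := by
      rw [Std.counit_apply, Module.End.mul_apply, k.std.apply_ehat hv.1, map_smul, inner_smul_right,
        mul_comm]
      rfl
    rw [← mul_assoc, mul_assoc, k.p_apply_left hu, k.symm.apply_p hv, smul_mul_smul_comm,
      k.symm.p_mul_p, hc]
  exact hle (k.mem_span_algG_mul_algG hx)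

/-- `p_f (T p_g T)` is the projection on `ê`. -/
theorem p_mul_conjBy_p : slL (op V) f f * conjBy (invol V e ehat) (slL (op V) g g) =
    (innerₛₗ ℂ ehat).smulRight ehat := by
  refine LinearMap.coe_injective (k.std.ext_apply_e fun x hx => ?_)
  rw [Module.End.mul_apply, k.std.conjBy_apply_e hx (slL_mem V g g), k.right.star_p k.std]
  have h1 := LinearMap.congr_fun (k.p_mul_mul_p hx) e
  simp only [Module.End.mul_apply, LinearMap.smul_apply, LinearMap.smulRight_apply,
    innerₛₗ_apply_apply] at h1 ⊢
  rw [h1, k.std.inner_ehat_e, k.std.inner_ehat_apply_e hx, smul_smul, mul_comm]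

theorem phat_mul_conjBy_phat :
    slR (op V) f f * conjBy (invol (MultUnitary.dual V) ehat e) (slR (op V) g g) =
    (innerₛₗ ℂ e).smulRight e := by
  have := k.dual.p_mul_conjBy_p
  rwa [slL_dual_self k.std.mult k.left.inner_self k.left.invariant,
    slL_dual_self k.std.mult k.right.inner_self k.right.invariant] at this

theorem inner_of_mem_opp {a b : H} (ha : a ∈ lowerSpace V f) (hb : b ∈ lowerSpace k.std.opp g) :
    inner ℂ a b = inner ℂ a e * inner ℂ e b := by
  have ha' := (slR_apply_eq_iff k.left.inner_self a).2 ha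
  have hb1 := (k.right.mem_lowerSpace_opp k.std).1 hb
  have hb' := (slR_apply_eq_iff k.right.inner_self _).2 hb1
  have hb2 : conjBy (invol (MultUnitary.dual V) ehat e) (slR (op V) g g) b = b := by
    rw [conjBy_apply, hb', k.std.dual.invol_invol]
  conv_lhs => rw [← ha', ← hb2, ← k.left.star_phat k.std, inner_star_left,
    ← Module.End.mul_apply, k.phat_mul_conjBy_phat]
  simp [mul_comm]

theorem finrank_lowerSpace_opp :
    Module.finrank ℂ (lowerSpace k.std.opp g) = Module.finrank ℂ (lowerSpace V g) := by
  rw [k.right.lowerSpace_opp k.std, k.std.antipodeOperator_eq]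
  exact LinearEquiv.finrank_map_eq _ _

/-- `S` is spanned by the products of elements of `G_f` and `D_g`. -/
theorem mem_span_algG_mul_algD {x : Module.End ℂ H} (hx : x ∈ algS V) :
    x ∈ Submodule.span ℂ {z | ∃ u, u ∈ algG V e f ∧ ∃ v, v ∈ algD V e g ∧ z = u * v} := by
  have hD : ∀ x, x ∈ algD V e g ↔ x ∈ algS V ∧ x e ∈ lowerSpace k.std.opp g := fun x => by
    rw [← k.right.algG_opp k.std, ← k.std.algS_opp]; rfl
  have hG := k.std.algS_opp
  simp only [hD]
  refine k.std.mem_span_mul (lowerSpace V f) (lowerSpace k.std.opp g)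
    (fun _ hx _ hy hxe hye => (k.left.mul_mem k.std ⟨hx, hxe⟩ ⟨hy, hye⟩).2)
    (fun _ hx hxe => (k.left.star_mem k.std ⟨hx, hxe⟩).2)
    (fun _ hx _ hy hxe hye => (k.opp.right.mul_mem k.opp.std ⟨hG.symm ▸ hx, hxe⟩
      ⟨hG.symm ▸ hy, hye⟩).2)
    (fun _ hx hxe => (k.opp.right.star_mem k.opp.std ⟨hG.symm ▸ hx, hxe⟩).2)
    (fun _ ha _ hb => k.inner_of_mem_opp ha hb) ?_ hx
  rw [k.finrank_lowerSpace_opp, k.finrank_mul]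

end Pair

end MultUnitary

end

noncomputable section

namespace MultUnitary

/-! ### Legs in tensor powers of an algebra -/

section Legs

variable {A : Type*} [Ring A] [Algebra ℂ A]
variable {Q : Type*} [Ring Q] [Algebra ℂ Q] {Q' : Type*} [Ring Q'] [Algebra ℂ Q']

/-- Commuting embeddings. -/
def Cm (i j : A →ₐ[ℂ] Q) : Prop := ∀ a b, Commute (i a) (j b)

theorem Cm.symm {i j : A →ₐ[ℂ] Q} (h : Cm i j) : Cm j i := fun a b => (h b a).symm

theorem Cm.map {i j : A →ₐ[ℂ] Q} (h : Cm i j) (φ : Q →ₐ[ℂ] Q') : Cm (φ.comp i) (φ.comp j) :=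
  fun a b => (h a b).map φ

/-- The element `z` of `A ⊗ A` placed on the legs `i`, `j`. -/
def lg (i j : A →ₐ[ℂ] Q) (h : Cm i j) : A ⊗[ℂ] A →ₐ[ℂ] Q := Algebra.TensorProduct.lift i j h

variable {i j k l : A →ₐ[ℂ] Q}

@[simp] theorem lg_tmul (h : Cm i j) (a b : A) : lg i j h (a ⊗ₜ b) = i a * j b :=
  Algebra.TensorProduct.lift_tmul _ _ _ _ _

theorem map_lg (h : Cm i j) (φ : Q →ₐ[ℂ] Q') (z : A ⊗[ℂ] A) :
    φ (lg i j h z) = lg (φ.comp i) (φ.comp j) (h.map φ) z := by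
  induction z with
  | zero => simp
  | tmul a b => simp
  | add x y hx hy => simp only [map_add, hx, hy]

theorem lg_comm (h : Cm i j) (z : A ⊗[ℂ] A) :
    lg j i h.symm (Algebra.TensorProduct.comm ℂ A A z) = lg i j h z := by
  induction z with
  | zero => simp
  | tmul a b => simpa using (h a b).symm.eq
  | add x y hx hy => simp only [map_add, hx, hy]

theorem commute_lg_left (h : Cm i j) {x : Q} (hi : ∀ a, Commute x (i a))
    (hj : ∀ a, Commute x (j a)) (z : A ⊗[ℂ] A) : Commute x (lg i j h z) := by
  induction z with
  | zero => simp
  | tmul a b => rw [lg_tmul]; exact (hi a).mul_right (hj b)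
  | add x y hx hy => rw [map_add]; exact hx.add_right hy

theorem Cm.commute_lg (hij : Cm i j) (hki : Cm k i) (hkj : Cm k j) (a : A) (z : A ⊗[ℂ] A) :
    Commute (k a) (lg i j hij z) := commute_lg_left _ (hki a) (hkj a) z

theorem Cm.lg_commute_lg (hij : Cm i j) (hkl : Cm k l) (hki : Cm k i) (hkj : Cm k j) (hli : Cm l i)
    (hlj : Cm l j) (z w : A ⊗[ℂ] A) : Commute (lg k l hkl w) (lg i j hij z) :=
  commute_lg_left _ (fun a => (hkl.commute_lg hki.symm hli.symm a w).symm)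
    (fun a => (hkl.commute_lg hkj.symm hlj.symm a w).symm) z

/-- The three legs of `A ⊗ (A ⊗ A)`. -/
def j₁ : A →ₐ[ℂ] A ⊗[ℂ] (A ⊗[ℂ] A) := Algebra.TensorProduct.includeLeft

/-- The three legs of `A ⊗ (A ⊗ A)`. -/
def j₂ : A →ₐ[ℂ] A ⊗[ℂ] (A ⊗[ℂ] A) :=
  (Algebra.TensorProduct.includeRight).comp Algebra.TensorProduct.includeLeft

/-- The three legs of `A ⊗ (A ⊗ A)`. -/
def j₃ : A →ₐ[ℂ] A ⊗[ℂ] (A ⊗[ℂ] A) :=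
  (Algebra.TensorProduct.includeRight).comp Algebra.TensorProduct.includeRight

theorem j₁_apply (a : A) : j₁ a = a ⊗ₜ[ℂ] (1 ⊗ₜ[ℂ] 1 : A ⊗[ℂ] A) := rfl
theorem j₂_apply (a : A) : j₂ a = (1 : A) ⊗ₜ[ℂ] (a ⊗ₜ[ℂ] (1 : A)) := rfl
theorem j₃_apply (a : A) : j₃ a = (1 : A) ⊗ₜ[ℂ] ((1 : A) ⊗ₜ[ℂ] a) := rfl

theorem c₁₂ : Cm (j₁ (A := A)) j₂ := fun a b => by
  simp only [Commute, SemiconjBy, j₁_apply, j₂_apply, Algebra.TensorProduct.tmul_mul_tmul, one_mul,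
    mul_one]
theorem c₁₃ : Cm (j₁ (A := A)) j₃ := fun a b => by
  simp only [Commute, SemiconjBy, j₁_apply, j₃_apply, Algebra.TensorProduct.tmul_mul_tmul, one_mul,
    mul_one]
theorem c₂₃ : Cm (j₂ (A := A)) j₃ := fun a b => by
  simp only [Commute, SemiconjBy, j₂_apply, j₃_apply, Algebra.TensorProduct.tmul_mul_tmul, one_mul,
    mul_one]

theorem lg_j₁₂_tmul (a b : A) : lg j₁ j₂ c₁₂ (a ⊗ₜ b) = a ⊗ₜ[ℂ] (b ⊗ₜ[ℂ] (1 : A)) := by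
  simp [j₁_apply, j₂_apply]
theorem lg_j₁₃_tmul (a b : A) : lg j₁ j₃ c₁₃ (a ⊗ₜ b) = a ⊗ₜ[ℂ] ((1 : A) ⊗ₜ[ℂ] b) := by
  simp [j₁_apply, j₃_apply]
theorem lg_j₂₃ (z : A ⊗[ℂ] A) : lg j₂ j₃ c₂₃ z = (1 : A) ⊗ₜ[ℂ] z := by
  induction z with
  | zero => simp
  | tmul a b => simp [j₂_apply, j₃_apply]
  | add x y hx hy => simp only [map_add, hx, hy, TensorProduct.tmul_add]

/-- The homomorphism on `A ⊗ (A ⊗ A)` given by three commuting embeddings. -/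
def lg3 (hij : Cm i j) (hik : Cm i k) (hjk : Cm j k) : A ⊗[ℂ] (A ⊗[ℂ] A) →ₐ[ℂ] Q :=
  Algebra.TensorProduct.lift i (lg j k hjk) fun a z => hjk.commute_lg hij hik a z

theorem lg3_comp_j₁ (hij : Cm i j) (hik : Cm i k) (hjk : Cm j k) :
    (lg3 hij hik hjk).comp j₁ = i := by
  ext a; simp [lg3, j₁_apply]

theorem lg3_comp_j₂ (hij : Cm i j) (hik : Cm i k) (hjk : Cm j k) :
    (lg3 hij hik hjk).comp j₂ = j := by
  ext a; simp [lg3, j₂_apply]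

theorem lg3_comp_j₃ (hij : Cm i j) (hik : Cm i k) (hjk : Cm j k) :
    (lg3 hij hik hjk).comp j₃ = k := by
  ext a; simp [lg3, j₃_apply]

theorem lg3_j₂ (hij : Cm i j) (hik : Cm i k) (hjk : Cm j k) (a : A) :
    lg3 hij hik hjk (j₂ a) = j a := DFunLike.congr_fun (lg3_comp_j₂ hij hik hjk) a

theorem lg_congr {i' j' : A →ₐ[ℂ] Q} (hij : Cm i j) (hij' : Cm i' j') (hi : i = i') (hj : j = j')
    (z : A ⊗[ℂ] A) : lg i j hij z = lg i' j' hij' z := by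
  subst hi; subst hj; rfl

theorem lg3_lg₁₂ (hij : Cm i j) (hik : Cm i k) (hjk : Cm j k) (z : A ⊗[ℂ] A) :
    lg3 hij hik hjk (lg j₁ j₂ c₁₂ z) = lg i j hij z := by
  rw [map_lg]
  exact lg_congr _ _ (lg3_comp_j₁ _ _ _) (lg3_comp_j₂ _ _ _) z

theorem lg3_lg₁₃ (hij : Cm i j) (hik : Cm i k) (hjk : Cm j k) (z : A ⊗[ℂ] A) :
    lg3 hij hik hjk (lg j₁ j₃ c₁₃ z) = lg i k hik z := by
  rw [map_lg]
  exact lg_congr _ _ (lg3_comp_j₁ _ _ _) (lg3_comp_j₃ _ _ _) z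

theorem lg3_lg₂₃ (hij : Cm i j) (hik : Cm i k) (hjk : Cm j k) (z : A ⊗[ℂ] A) :
    lg3 hij hik hjk (lg j₂ j₃ c₂₃ z) = lg j k hjk z := by
  rw [map_lg]
  exact lg_congr _ _ (lg3_comp_j₂ _ _ _) (lg3_comp_j₃ _ _ _) z

/-- The pentagon relation in `A ⊗ (A ⊗ A)`. -/
def Pentagon (v : A ⊗[ℂ] A) : Prop :=
  lg j₁ j₂ c₁₂ v * lg j₁ j₃ c₁₃ v * lg j₂ j₃ c₂₃ v = lg j₂ j₃ c₂₃ v * lg j₁ j₂ c₁₂ v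

/-- Three commuting embeddings define a homomorphism out of the triple tensor product. Relations
proved on three legs can therefore be used on any legs of a fourfold product, in any order. -/
theorem Pentagon.lg {v : A ⊗[ℂ] A} (hv : Pentagon v) (hij : Cm i j) (hik : Cm i k) (hjk : Cm j k) :
    lg i j hij v * lg i k hik v * lg j k hjk v = lg j k hjk v * lg i j hij v := by
  have := congrArg (lg3 hij hik hjk) hv
  simpa only [map_mul, lg3_lg₁₂, lg3_lg₁₃, lg3_lg₂₃] using this

/-- The span of the elementary tensors with factors in given subspaces. -/
def tens (P R : Submodule ℂ A) : Submodule ℂ (A ⊗[ℂ] A) :=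
  Submodule.map₂ (TensorProduct.mk ℂ A A) P R

theorem tmul_mem_tens {P R : Submodule ℂ A} {a b : A} (ha : a ∈ P) (hb : b ∈ R) :
    a ⊗ₜ[ℂ] b ∈ tens P R := Submodule.apply_mem_map₂ _ ha hb

theorem tens_mono {P P' R R' : Submodule ℂ A} (hP : P ≤ P') (hR : R ≤ R') :
    tens P R ≤ tens P' R' := Submodule.map₂_le_map₂ hP hR

theorem tens_induction {P R : Submodule ℂ A} {p : A ⊗[ℂ] A → Prop} {z : A ⊗[ℂ] A}
    (hz : z ∈ tens P R) (h0 : p 0) (ht : ∀ a ∈ P, ∀ b ∈ R, p (a ⊗ₜ b))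
    (ha : ∀ x y, p x → p y → p (x + y)) : p z := by
  rw [tens, Submodule.map₂_eq_span_image2] at hz
  -- Quantifying over a scalar, absorbed into the left factor, spares the assumption that p is
  -- stable under scalars.
  suffices h : ∀ c : ℂ, p (c • z) by simpa using h 1
  induction hz using Submodule.span_induction with
  | mem x hx =>
    obtain ⟨a, ha', b, hb, rfl⟩ := hx
    intro c
    exact ht _ (P.smul_mem c ha') _ hb
  | zero => intro c; simpa using h0
  | add x y _ _ hx hy => intro c; rw [smul_add]; exact ha _ _ (hx c) (hy c)
  | smul d x _ hx => intro c; rw [smul_smul]; exact hx _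

theorem lTensor_eq_of_mem {M : Type*} [AddCommGroup M] [Module ℂ M] {R : Submodule ℂ A}
    {F G : A →ₗ[ℂ] M} (hFG : ∀ a ∈ R, F a = G a) {z : A ⊗[ℂ] A} (hz : z ∈ tens ⊤ R) :
    F.lTensor A z = G.lTensor A z := by
  refine tens_induction (p := fun z => F.lTensor A z = G.lTensor A z) hz (by simp)
    (fun a _ b hb => ?_) fun x y hx hy => by
    simp only [map_add, hx, hy]
  simp [hFG b hb]

end Legs

end MultUnitary

end

/-! ### Relations between v, w, a and b on arbitrary legs -/

noncomputable section

namespace MultUnitary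

set_option linter.unusedSectionVars false

section Legs

variable {A : Type*} [Ring A] [Algebra ℂ A]
variable {Q : Type*} [Ring Q] [Algebra ℂ Q]
variable {i j k l : A →ₐ[ℂ] Q}

/-- Algebraic data on `v` and its companion `w`, two idempotents `p`, `q`, and the elements `a`,
`b`, from which the pentagon relation for `b a` follows. -/
structure Data (v v' w w' a b : A ⊗[ℂ] A) (p q : A) (S : Subalgebra ℂ A) (G D Y Z : Submodule ℂ A)
    (Γ : A ⊗[ℂ] A →ₗ[ℂ] A) : Prop where
  vv' : v * v' = 1
  v'v : v' * v = 1
  ww' : w * w' = 1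
  pent : Pentagon v
  copr : ∀ x ∈ S, w' * (1 ⊗ₜ x) * w = v * (x ⊗ₜ 1) * v'
  copr_mem : ∀ x ∈ S, v * (x ⊗ₜ 1) * v' ∈ tens (Subalgebra.toSubmodule S) (Subalgebra.toSubmodule S)
  G_le : G ≤ Subalgebra.toSubmodule S
  D_le : D ≤ Subalgebra.toSubmodule S
  a_mem : a ∈ tens ⊤ G
  a_mem' : a ∈ tens Y ⊤
  b_mem : b ∈ tens D ⊤
  b_mem' : b ∈ tens ⊤ Z
  YZ : ∀ y ∈ Y, ∀ z ∈ Z, Commute y z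
  a_q : a * (1 ⊗ₜ q) = v * (1 ⊗ₜ q)
  p_b : (p ⊗ₜ 1) * b = (p ⊗ₜ 1) * w
  a_G : ∀ u ∈ G, a * (u ⊗ₜ 1) = (v * (u ⊗ₜ 1) * v') * a
  b_D : ∀ d ∈ D, b * (v * (d ⊗ₜ 1) * v') = (1 ⊗ₜ d) * b
  p_copr : ∀ u ∈ G, (1 ⊗ₜ p) * (v * (u ⊗ₜ 1) * v') = u ⊗ₜ p
  copr_q : ∀ d ∈ D, (v * (d ⊗ₜ 1) * v') * (q ⊗ₜ 1) = q ⊗ₜ d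
  T1 : j₂ p * lg j₁ j₂ c₁₂ w' * lg j₂ j₃ c₂₃ b * lg j₁ j₂ c₁₂ w =
    j₂ p * lg j₁ j₃ c₁₃ b * lg j₂ j₃ c₂₃ w
  T2 : lg j₂ j₃ c₂₃ v * lg j₁ j₂ c₁₂ a * lg j₂ j₃ c₂₃ v' * j₂ q =
    lg j₁ j₂ c₁₂ v * lg j₁ j₃ c₁₃ a * j₂ q
  left_inv : ∀ s ∈ S, Γ ((1 ⊗ₜ p) * (v * (s ⊗ₜ 1) * v') * (q ⊗ₜ 1)) = s

theorem lg_copr (h : Cm i j) (v v' : A ⊗[ℂ] A) (x : A) : lg i j h (v * (x ⊗ₜ 1) * v') =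
    lg i j h v * i x * lg i j h v' := by simp

namespace Data

variable {v v' w w' a b : A ⊗[ℂ] A} {p q : A} {S : Subalgebra ℂ A} {G D Y Z : Submodule ℂ A}
  {Γ : A ⊗[ℂ] A →ₗ[ℂ] A} (d : Data v v' w w' a b p q S G D Y Z Γ)
include d

theorem lg_vv' (h : Cm i j) : lg i j h v * lg i j h v' = 1 := by rw [← map_mul, d.vv', map_one]
theorem lg_v'v (h : Cm i j) : lg i j h v' * lg i j h v = 1 := by rw [← map_mul, d.v'v, map_one]
theorem lg_ww' (h : Cm i j) : lg i j h w * lg i j h w' = 1 := by rw [← map_mul, d.ww', map_one]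

theorem lg_copr' (h : Cm i j) {x : A} (hx : x ∈ S) :
    lg i j h w' * j x * lg i j h w = lg i j h v * i x * lg i j h v' := by
  rw [← lg_copr, ← d.copr x hx]; simp

theorem lg_T1 (hij : Cm i j) (hik : Cm i k) (hjk : Cm j k) :
    j p * lg i j hij w' * lg j k hjk b * lg i j hij w = j p * lg i k hik b * lg j k hjk w := by
  have := congrArg (lg3 hij hik hjk) d.T1
  simpa only [map_mul, lg3_lg₁₂, lg3_lg₁₃, lg3_lg₂₃, lg3_j₂] using this

theorem lg_T2 (hij : Cm i j) (hik : Cm i k) (hjk : Cm j k) :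
    lg j k hjk v * lg i j hij a * lg j k hjk v' * j q = lg i j hij v * lg i k hik a * j q := by
  have := congrArg (lg3 hij hik hjk) d.T2
  simpa only [map_mul, lg3_lg₁₂, lg3_lg₁₃, lg3_lg₂₃, lg3_j₂] using this

/-- `V_{ij} b_{ik} V_{ij}* = w_{ij}* b_{jk} w_{ij}`. -/
theorem conj_b (hij : Cm i j) (hik : Cm i k) (hjk : Cm j k) :
    lg i j hij v * lg i k hik b * lg i j hij v' = lg i j hij w' * lg j k hjk b * lg i j hij w := by
  have key : ∀ z ∈ tens D ⊤, lg i j hij v * lg i k hik z * lg i j hij v' =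
      lg i j hij w' * lg j k hjk z * lg i j hij w := by
    intro z hz
    refine tens_induction (p := fun z => lg i j hij v * lg i k hik z * lg i j hij v' =
      lg i j hij w' * lg j k hjk z * lg i j hij w) hz (by simp) (fun x hx y _ => ?_)
      fun x y hx hy => by simp only [map_add, mul_add, add_mul, hx, hy]
    -- Only the leg of z in D meets V_{ij}, and there the two expressions of the coproduct, by v and
    -- by w, exchange the legs i and j. The sibling lemmas for a and b follow the same pattern.
    have c1 := (hij.commute_lg hik.symm hjk.symm y v').eq
    have c2 := (hij.commute_lg hik.symm hjk.symm y w).eq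
    calc lg i j hij v * lg i k hik (x ⊗ₜ y) * lg i j hij v'
        = (lg i j hij v * i x) * (k y * lg i j hij v') := by rw [lg_tmul]; simp only [mul_assoc]
      _ = (lg i j hij v * i x * lg i j hij v') * k y := by rw [c1]; simp only [mul_assoc]
      _ = (lg i j hij w' * j x) * (lg i j hij w * k y) := by
          rw [← d.lg_copr' hij (d.D_le hx)]; simp only [mul_assoc]
      _ = lg i j hij w' * lg j k hjk (x ⊗ₜ y) * lg i j hij w := by
          rw [← c2, lg_tmul]; simp only [mul_assoc]
  exact key b d.b_mem

/-- `V_{jk} a_{ij} V_{jk}* = w_{jk}* a_{ik} w_{jk}`. -/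
theorem conj_a (hij : Cm i j) (hik : Cm i k) (hjk : Cm j k) :
    lg j k hjk v * lg i j hij a * lg j k hjk v' = lg j k hjk w' * lg i k hik a * lg j k hjk w := by
  have key : ∀ z ∈ tens ⊤ G, lg j k hjk v * lg i j hij z * lg j k hjk v' =
      lg j k hjk w' * lg i k hik z * lg j k hjk w := by
    intro z hz
    refine tens_induction (p := fun z => lg j k hjk v * lg i j hij z * lg j k hjk v' =
      lg j k hjk w' * lg i k hik z * lg j k hjk w) hz (by simp) (fun x _ y hy => ?_)
      fun x y hx hy => by simp only [map_add, mul_add, add_mul, hx, hy]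
    have c1 := (hjk.commute_lg hij hik x v).eq
    have c2 := (hjk.commute_lg hij hik x w').eq
    calc lg j k hjk v * lg i j hij (x ⊗ₜ y) * lg j k hjk v'
        = (lg j k hjk v * i x) * (j y * lg j k hjk v') := by rw [lg_tmul]; simp only [mul_assoc]
      _ = i x * (lg j k hjk v * j y * lg j k hjk v') := by rw [← c1]; simp only [mul_assoc]
      _ = (i x * lg j k hjk w') * (k y * lg j k hjk w) := by
          rw [← d.lg_copr' hjk (d.G_le hy)]; simp only [mul_assoc]
      _ = lg j k hjk w' * lg i k hik (x ⊗ₜ y) * lg j k hjk w := by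
          rw [c2, lg_tmul]; simp only [mul_assoc]
  exact key a d.a_mem

/-- `p_k V_{jk} a_{ij} V_{jk}* = a_{ij} p_k`. -/
theorem p_conj_a (hij : Cm i j) (hik : Cm i k) (hjk : Cm j k) :
    k p * (lg j k hjk v * lg i j hij a * lg j k hjk v') = lg i j hij a * k p := by
  have key : ∀ z ∈ tens ⊤ G, k p * (lg j k hjk v * lg i j hij z * lg j k hjk v') =
      lg i j hij z * k p := by
    intro z hz
    refine tens_induction (p := fun z => k p * (lg j k hjk v * lg i j hij z * lg j k hjk v') =
      lg i j hij z * k p) hz (by simp) (fun x _ y hy => ?_)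
      fun x y hx hy => by simp only [map_add, mul_add, add_mul, hx, hy]
    have c1 := (hjk.commute_lg hij hik x v).eq
    have h1 := congrArg (lg j k hjk) (d.p_copr y hy)
    rw [map_mul, lg_copr, lg_tmul, lg_tmul, map_one, one_mul] at h1
    calc k p * (lg j k hjk v * lg i j hij (x ⊗ₜ y) * lg j k hjk v')
        = k p * ((lg j k hjk v * i x) * (j y * lg j k hjk v')) := by
          rw [lg_tmul]; simp only [mul_assoc]
      _ = (k p * i x) * (lg j k hjk v * j y * lg j k hjk v') := by rw [← c1]; simp only [mul_assoc]
      _ = i x * (k p * (lg j k hjk v * j y * lg j k hjk v')) := by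
          rw [← (hik x p).eq, mul_assoc]
      _ = lg i j hij (x ⊗ₜ y) * k p := by rw [h1, lg_tmul, mul_assoc]
  exact key a d.a_mem

/-- `V_{ij} b_{ik} V_{ij}* q_i = q_i b_{jk}`. -/
theorem conj_b_q (hij : Cm i j) (hik : Cm i k) (hjk : Cm j k) :
    (lg i j hij v * lg i k hik b * lg i j hij v') * i q = i q * lg j k hjk b := by
  have key : ∀ z ∈ tens D ⊤, (lg i j hij v * lg i k hik z * lg i j hij v') * i q =
      i q * lg j k hjk z := by
    intro z hz
    refine tens_induction (p := fun z => (lg i j hij v * lg i k hik z * lg i j hij v') * i q =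
      i q * lg j k hjk z) hz (by simp) (fun x hx y _ => ?_)
      fun x y hx hy => by simp only [map_add, mul_add, add_mul, hx, hy]
    have c1 := (hij.commute_lg hik.symm hjk.symm y v').eq
    have h1 := congrArg (lg i j hij) (d.copr_q x hx)
    rw [map_mul, lg_copr, lg_tmul, lg_tmul, map_one, mul_one] at h1
    calc (lg i j hij v * lg i k hik (x ⊗ₜ y) * lg i j hij v') * i q
        = (lg i j hij v * i x) * (k y * lg i j hij v') * i q := by
          rw [lg_tmul]; simp only [mul_assoc]
      _ = (lg i j hij v * i x * lg i j hij v') * (k y * i q) := by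
          rw [c1]; simp only [mul_assoc]
      _ = ((lg i j hij v * i x * lg i j hij v') * i q) * k y := by
          rw [← (hik q y).eq]; simp only [mul_assoc]
      _ = i q * lg j k hjk (x ⊗ₜ y) := by rw [h1, lg_tmul, mul_assoc]
  exact key b d.b_mem

theorem lg_a_q (hij : Cm i j) : lg i j hij a * j q = lg i j hij v * j q := by
  simpa using congrArg (lg i j hij) d.a_q

theorem lg_p_b (hij : Cm i j) : i p * lg i j hij b = i p * lg i j hij w := by
  simpa using congrArg (lg i j hij) d.p_b

/-- `a_{jk} a_{ij} = (V_{jk} a_{ij} V_{jk}*) a_{jk}`. -/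
theorem a_mul_a (hij : Cm i j) (hik : Cm i k) (hjk : Cm j k) :
    lg j k hjk a * lg i j hij a =
      (lg j k hjk v * lg i j hij a * lg j k hjk v') * lg j k hjk a := by
  have key : ∀ z ∈ tens ⊤ G, lg j k hjk a * lg i j hij z =
      (lg j k hjk v * lg i j hij z * lg j k hjk v') * lg j k hjk a := by
    intro z hz
    refine tens_induction (p := fun z => lg j k hjk a * lg i j hij z =
      (lg j k hjk v * lg i j hij z * lg j k hjk v') * lg j k hjk a) hz (by simp)
      (fun x _ y hy => ?_) fun x y hx hy => by simp only [map_add, mul_add, add_mul, hx, hy]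
    have c1 := (hjk.commute_lg hij hik x v).eq
    have c2 := (hjk.commute_lg hij hik x a).eq
    have h1 := congrArg (lg j k hjk) (d.a_G y hy)
    rw [map_mul, map_mul, lg_copr, lg_tmul, map_one, mul_one] at h1
    calc lg j k hjk a * lg i j hij (x ⊗ₜ y)
        = (lg j k hjk a * i x) * j y := by rw [lg_tmul, mul_assoc]
      _ = i x * (lg j k hjk a * j y) := by rw [← c2, mul_assoc]
      _ = (i x * lg j k hjk v) * j y * lg j k hjk v' * lg j k hjk a := by
          rw [h1]; simp only [mul_assoc]
      _ = _ := by rw [c1, lg_tmul]; simp only [mul_assoc]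
  exact key a d.a_mem

/-- `b_{jk} b_{ij} = b_{ij} (V_{ij} b_{ik} V_{ij}*)`. -/
theorem b_mul_b (hij : Cm i j) (hik : Cm i k) (hjk : Cm j k) :
    lg j k hjk b * lg i j hij b =
      lg i j hij b * (lg i j hij v * lg i k hik b * lg i j hij v') := by
  have key : ∀ z ∈ tens D ⊤, lg j k hjk z * lg i j hij b =
      lg i j hij b * (lg i j hij v * lg i k hik z * lg i j hij v') := by
    intro z hz
    refine tens_induction (p := fun z => lg j k hjk z * lg i j hij b =
      lg i j hij b * (lg i j hij v * lg i k hik z * lg i j hij v')) hz (by simp)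
      (fun x hx y _ => ?_) fun x y hx hy => by simp only [map_add, mul_add, add_mul, hx, hy]
    have c1 := (hij.commute_lg hik.symm hjk.symm y v').eq
    have c2 := (hij.commute_lg hik.symm hjk.symm y b).eq
    have h1 := congrArg (lg i j hij) (d.b_D x hx)
    rw [map_mul, lg_copr, map_mul, lg_tmul, map_one, one_mul] at h1
    calc lg j k hjk (x ⊗ₜ y) * lg i j hij b
        = j x * (k y * lg i j hij b) := by rw [lg_tmul, mul_assoc]
      _ = (j x * lg i j hij b) * k y := by rw [c2, mul_assoc]
      _ = lg i j hij b * (lg i j hij v * i x) * (lg i j hij v' * k y) := by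
          rw [← h1]; simp only [mul_assoc]
      _ = _ := by rw [← c1, lg_tmul]; simp only [mul_assoc]
  exact key b d.b_mem

/-- `a_{jk}` and `b_{ij}` commute. -/
theorem a_comm_b (hij : Cm i j) (hik : Cm i k) (hjk : Cm j k) :
    lg j k hjk a * lg i j hij b = lg i j hij b * lg j k hjk a := by
  have key : ∀ z ∈ tens Y ⊤, ∀ z' ∈ tens ⊤ Z, lg j k hjk z * lg i j hij z' =
      lg i j hij z' * lg j k hjk z := by
    intro z hz z' hz'
    refine tens_induction (p := fun z => lg j k hjk z * lg i j hij z' =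
      lg i j hij z' * lg j k hjk z) hz (by simp)
      (fun x hx y _ => ?_) fun x y hx hy => by simp only [map_add, mul_add, add_mul, hx, hy]
    refine tens_induction (p := fun z' => lg j k hjk (x ⊗ₜ y) * lg i j hij z' =
      lg i j hij z' * lg j k hjk (x ⊗ₜ y)) hz' (by simp)
      (fun x' _ y' hy' => ?_) fun x y hx hy => by simp only [map_add, mul_add, add_mul, hx, hy]
    rw [lg_tmul, lg_tmul]
    have h1 : Commute (j x) (i x' * j y') :=
      ((hij x' x).symm).mul_right ((d.YZ x hx y' hy').map j)
    have h2 : Commute (k y) (i x' * j y') := ((hik x' y).symm).mul_right ((hjk y' y).symm)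
    exact (h1.mul_left h2).eq
  exact key a d.a_mem' b d.b_mem'

end Data

end Legs

end MultUnitary

end

/-! ### The four-leg argument and the pentagon relation for b a -/

noncomputable section

namespace MultUnitary

section Legs

variable {A : Type*} [Ring A] [Algebra ℂ A]
variable {Q : Type*} [Ring Q] [Algebra ℂ Q]
variable {i j k l : A →ₐ[ℂ] Q}

namespace Data

variable {v v' w w' a b : A ⊗[ℂ] A} {p q : A} {S : Subalgebra ℂ A} {G D Y Z : Submodule ℂ A}
  {Γ : A ⊗[ℂ] A →ₗ[ℂ] A} (d : Data v v' w w' a b p q S G D Y Z Γ)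
include d

theorem pent_inv (hij : Cm i j) (hik : Cm i k) (hjk : Cm j k) :
    lg i j hij v' * lg j k hjk v' = lg j k hjk v' * lg i k hik v' * lg i j hij v' := by
  have h := d.pent.lg hij hik hjk
  refine left_inv_eq_right_inv (a := lg j k hjk v * lg i j hij v) ?_ ?_
  · rw [mul_assoc, ← mul_assoc (lg j k hjk v'), d.lg_v'v, one_mul, d.lg_v'v]
  · rw [← h]
    calc _ = lg i j hij v * (lg i k hik v * (lg j k hjk v * lg j k hjk v') * lg i k hik v') *
          lg i j hij v' := by simp only [mul_assoc]
      _ = 1 := by rw [d.lg_vv', mul_one, d.lg_vv', mul_one, d.lg_vv']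

/-- `V_{23} V_{12} b_{14} V_{12}* V_{23}* = V_{12} V_{13} b_{14} V_{13}* V_{12}*`. -/
theorem conj_conj_b (hij : Cm i j) (hik : Cm i k) (hil : Cm i l) (hjk : Cm j k) (hjl : Cm j l)
    (hkl : Cm k l) :
    lg j k hjk v * (lg i j hij v * lg i l hil b * lg i j hij v') * lg j k hjk v' =
      lg i j hij v * (lg i k hik v * lg i l hil b * lg i k hik v') * lg i j hij v' := by
  have c := (hil.lg_commute_lg hjk hij.symm hjl hik.symm hkl b v).eq
  calc lg j k hjk v * (lg i j hij v * lg i l hil b * lg i j hij v') * lg j k hjk v'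
      = (lg j k hjk v * lg i j hij v) * lg i l hil b * (lg i j hij v' * lg j k hjk v') := by
        simp only [mul_assoc]
    _ = lg i j hij v * lg i k hik v * (lg j k hjk v * lg i l hil b) *
        (lg j k hjk v' * lg i k hik v' * lg i j hij v') := by
        rw [d.pent_inv hij hik hjk, ← d.pent.lg hij hik hjk]; simp only [mul_assoc]
    _ = lg i j hij v * lg i k hik v * lg i l hil b * (lg j k hjk v * lg j k hjk v') *
        lg i k hik v' * lg i j hij v' := by rw [c]; simp only [mul_assoc]
    _ = _ := by rw [d.lg_vv', mul_one]; simp only [mul_assoc]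

theorem lg_pent_conj (hjk : Cm j k) (hjl : Cm j l) (hkl : Cm k l) :
    lg j k hjk v * lg j l hjl v = lg k l hkl v * lg j k hjk v * lg k l hkl v' := by
  rw [← d.pent.lg hjk hjl hkl, mul_assoc, d.lg_vv', mul_one]

theorem lg_pent_conj' (hjk : Cm j k) (hjl : Cm j l) (hkl : Cm k l) :
    lg j l hjl v' * lg j k hjk v' = lg k l hkl v * lg j k hjk v' * lg k l hkl v' := by
  rw [mul_assoc, d.pent_inv hjk hjl hkl, ← mul_assoc, ← mul_assoc, d.lg_vv', one_mul]

/-- `V_{23} V_{24} a_{12} V_{24}* V_{23}* q_2 = V_{12} V_{34} a_{13} V_{34}* q_2`. -/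
theorem conj_conj_a (hij : Cm i j) (hik : Cm i k) (hil : Cm i l) (hjk : Cm j k) (hjl : Cm j l)
    (hkl : Cm k l) :
    lg j k hjk v * (lg j l hjl v * lg i j hij a * lg j l hjl v') * lg j k hjk v' * j q =
      lg i j hij v * (lg k l hkl v * lg i k hik a * lg k l hkl v') * j q := by
  have c := (hij.lg_commute_lg hkl hik.symm hjk.symm hil.symm hjl.symm a v').eq
  have c' := (hij.lg_commute_lg hkl hik.symm hjk.symm hil.symm hjl.symm v v).eq
  have cq := (hkl.commute_lg hjk hjl q v').eq
  calc _ = (lg j k hjk v * lg j l hjl v) * lg i j hij a * (lg j l hjl v' * lg j k hjk v') * j q := by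
        simp only [mul_assoc]
    _ = lg k l hkl v * lg j k hjk v * (lg k l hkl v' * lg i j hij a) * lg k l hkl v *
        lg j k hjk v' * (lg k l hkl v' * j q) := by
        rw [d.lg_pent_conj hjk hjl hkl, d.lg_pent_conj' hjk hjl hkl]; simp only [mul_assoc]
    _ = lg k l hkl v * lg j k hjk v * lg i j hij a * (lg k l hkl v' * lg k l hkl v) *
        lg j k hjk v' * j q * lg k l hkl v' := by
        rw [c, ← cq]; simp only [mul_assoc]
    _ = lg k l hkl v * (lg j k hjk v * lg i j hij a * lg j k hjk v' * j q) * lg k l hkl v' := by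
        rw [d.lg_v'v, mul_one]; simp only [mul_assoc]
    _ = lg k l hkl v * lg i j hij v * lg i k hik a * (j q * lg k l hkl v') := by
        rw [d.lg_T2 hij hik hjk]; simp only [mul_assoc]
    _ = _ := by rw [c', cq]; simp only [mul_assoc]

/-- Conjugation by V_{jk} spreads the two factors by the pentagon relation, so that V_{ij} cancels
between them. The cut-offs p_k and q_j are what make `T1` and `T2` applicable; then w_{kl} cancels
too. -/
theorem four_left (hij : Cm i j) (hik : Cm i k) (hil : Cm i l) (hjk : Cm j k) (hjl : Cm j l)
    (hkl : Cm k l) :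
    k p * (lg j k hjk v * ((lg i j hij v * lg i l hil b * lg i j hij v') *
      (lg j l hjl v * lg i j hij a * lg j l hjl v')) * lg j k hjk v') * j q =
    lg i j hij v * (k p * lg i l hil b * lg i l hil a * lg k l hkl w) * j q := by
  have cp := (hij.commute_lg hik.symm hjk.symm p v).eq
  calc _ = k p * (lg j k hjk v * (lg i j hij v * lg i l hil b * lg i j hij v') *
        (lg j k hjk v' * lg j k hjk v) *
      (lg j l hjl v * lg i j hij a * lg j l hjl v') * lg j k hjk v') * j q := by
        rw [d.lg_v'v, mul_one]; simp only [mul_assoc]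
    _ = k p * (lg j k hjk v * (lg i j hij v * lg i l hil b * lg i j hij v') * lg j k hjk v') *
        (lg j k hjk v * (lg j l hjl v * lg i j hij a * lg j l hjl v') * lg j k hjk v' * j q) := by
        simp only [mul_assoc]
    _ = (k p * lg i j hij v) * (lg i k hik v * lg i l hil b * lg i k hik v') *
        (lg i j hij v' * lg i j hij v) *
        (lg k l hkl v * lg i k hik a * lg k l hkl v') * j q := by
        rw [d.conj_conj_b hij hik hil hjk hjl hkl, d.conj_conj_a hij hik hil hjk hjl hkl]
        simp only [mul_assoc]
    _ = lg i j hij v * (k p * lg i k hik w' * lg k l hkl b * lg i k hik w) *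
        (lg k l hkl w' * lg i l hil a * lg k l hkl w) * j q := by
        rw [d.lg_v'v, mul_one, cp, d.conj_b hik hil hkl, d.conj_a hik hil hkl]
        simp only [mul_assoc]
    _ = lg i j hij v * (k p * lg i l hil b) * (lg k l hkl w * lg k l hkl w') *
        lg i l hil a * lg k l hkl w * j q := by
        rw [d.lg_T1 hik hil hkl]; simp only [mul_assoc]
    _ = _ := by rw [d.lg_ww', mul_one]; simp only [mul_assoc]

/-- The cut-offs undo the conjugation by V_{jk}: p_k takes the conjugate of a_{ij} back to a_{ij},
and q_j takes that of b_{jl} to b_{kl}. Next to them a and b may be replaced by v and w, and the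
value of `four_left` appears. -/
theorem four_right (hij : Cm i j) (hik : Cm i k) (hil : Cm i l) (hjk : Cm j k) (hjl : Cm j l)
    (hkl : Cm k l) :
    k p * (lg j k hjk v * (lg i j hij a * (lg i l hil b * lg i l hil a) * lg j l hjl b) *
      lg j k hjk v') * j q =
    lg i j hij v * (k p * lg i l hil b * lg i l hil a * lg k l hkl w) * j q := by
  have c : lg j k hjk v' * (lg i l hil b * lg i l hil a) =
      (lg i l hil b * lg i l hil a) * lg j k hjk v' := by
    rw [← map_mul]
    exact (hil.lg_commute_lg hjk hij.symm hjl hik.symm hkl (b * a) v').eq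
  have cp : k p * (lg i l hil b * lg i l hil a) = (lg i l hil b * lg i l hil a) * k p := by
    rw [← map_mul]
    exact (hil.commute_lg hik.symm hkl p (b * a)).eq
  have cq : j q * (lg i l hil b * lg i l hil a) = (lg i l hil b * lg i l hil a) * j q := by
    rw [← map_mul]
    exact (hil.commute_lg hij.symm hjl q (b * a)).eq
  have cqw := (hkl.commute_lg hjk hjl q w).eq
  calc _ = k p * (lg j k hjk v * lg i j hij a * (lg j k hjk v' * lg j k hjk v) *
        (lg i l hil b * lg i l hil a) * lg j l hjl b * lg j k hjk v') * j q := by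
        rw [d.lg_v'v, mul_one]; simp only [mul_assoc]
    _ = k p * (lg j k hjk v * lg i j hij a * lg j k hjk v') * (lg i l hil b * lg i l hil a) *
        ((lg j k hjk v * lg j l hjl b * lg j k hjk v') * j q) := by
        have c2 : lg j k hjk v * (lg i l hil b * lg i l hil a) =
            (lg i l hil b * lg i l hil a) * lg j k hjk v := by
          rw [← map_mul]
          exact (hil.lg_commute_lg hjk hij.symm hjl hik.symm hkl (b * a) v).eq
        calc _ = k p * (lg j k hjk v * lg i j hij a * lg j k hjk v' *
              (lg j k hjk v * (lg i l hil b * lg i l hil a)) * lg j l hjl b * lg j k hjk v') *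
              j q := by simp only [mul_assoc]
          _ = _ := by rw [c2]; simp only [mul_assoc]
    _ = lg i j hij a * (k p * (lg i l hil b * lg i l hil a)) * j q * lg k l hkl b := by
        rw [d.p_conj_a hij hik hjk, d.conj_b_q hjk hjl hkl]; simp only [mul_assoc]
    _ = lg i j hij a * (lg i l hil b * lg i l hil a * j q) * k p * lg k l hkl b := by
        rw [cp]; simp only [mul_assoc]; rw [← mul_assoc (k p), ← (hjk q p).eq, mul_assoc]
    _ = (lg i j hij a * j q) * (lg i l hil b * lg i l hil a) * (k p * lg k l hkl b) := by
        rw [← cq]; simp only [mul_assoc]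
    _ = lg i j hij v * (j q * (lg i l hil b * lg i l hil a)) * (k p * lg k l hkl w) := by
        rw [d.lg_a_q, d.lg_p_b]; simp only [mul_assoc]
    _ = lg i j hij v * (lg i l hil b * lg i l hil a) * (j q * k p) * lg k l hkl w := by
        rw [cq]; simp only [mul_assoc]
    _ = lg i j hij v * ((lg i l hil b * lg i l hil a) * k p) * (j q * lg k l hkl w) := by
        rw [(hjk q p).eq]; simp only [mul_assoc]
    _ = _ := by rw [← cp, cqw]; simp only [mul_assoc]

/-- On `(A ⊗ A) ⊗ S`, the map `z ↦ p₃ V₂₃ z V₂₃* q₂` has a left inverse. -/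
theorem lTensor_left_inv :
    ∀ z ∈ (Algebra.TensorProduct.map (AlgHom.id ℂ (A ⊗[ℂ] A)) S.val).range,
      (Γ ∘ₗ (LinearMap.mulLeft ℂ ((1 : A) ⊗ₜ p) ∘ₗ LinearMap.mulRight ℂ (q ⊗ₜ (1 : A)) ∘ₗ
        LinearMap.mulLeft ℂ v ∘ₗ LinearMap.mulRight ℂ v' ∘ₗ
        (TensorProduct.mk ℂ A A).flip 1)).lTensor (A ⊗[ℂ] A) z = z := by
  rintro _ ⟨t, rfl⟩
  induction t with
  | zero => simp
  | tmul x s =>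
    have := d.left_inv s s.2
    simp only [mul_assoc] at this
    simp [mul_assoc, this]
  | add x y hx hy => simp only [map_add] at *; rw [hx, hy]

/-- The universal case of the identity. The legs are called 1, 2, 4, and leg 2 is put in the last
factor: there both sides have components in S, so they may be compared after the injective map that
creates leg 3. -/
theorem conj_b_mul_conj_a_legs :
    let κ₁ : A →ₐ[ℂ] (A ⊗[ℂ] A) ⊗[ℂ] A :=
      Algebra.TensorProduct.includeLeft.comp Algebra.TensorProduct.includeLeft
    let κ₂ : A →ₐ[ℂ] (A ⊗[ℂ] A) ⊗[ℂ] A := Algebra.TensorProduct.includeRight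
    let κ₄ : A →ₐ[ℂ] (A ⊗[ℂ] A) ⊗[ℂ] A :=
      Algebra.TensorProduct.includeLeft.comp Algebra.TensorProduct.includeRight
    ∃ (h₁₂ : Cm κ₁ κ₂) (h₁₄ : Cm κ₁ κ₄) (h₂₄ : Cm κ₂ κ₄),
      (lg _ _ h₁₂ v * lg _ _ h₁₄ b * lg _ _ h₁₂ v') *
        (lg _ _ h₂₄ v * lg _ _ h₁₂ a * lg _ _ h₂₄ v') =
      lg _ _ h₁₂ a * (lg _ _ h₁₄ b * lg _ _ h₁₄ a) * lg _ _ h₂₄ b := by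
  intro κ₁ κ₂ κ₄
  have h₁₂ : Cm κ₁ κ₂ := fun x y => by
    simp [κ₁, κ₂, Commute, SemiconjBy]
  have h₁₄ : Cm κ₁ κ₄ := fun x y => by
    simp [κ₁, κ₄, Commute, SemiconjBy]
  have h₂₄ : Cm κ₂ κ₄ := fun x y => by
    simp [κ₂, κ₄, Commute, SemiconjBy]
  refine ⟨h₁₂, h₁₄, h₂₄, ?_⟩
  -- N is the subalgebra (A ⊗ A) ⊗ S, on which `lTensor_left_inv` applies; both sides have to be
  -- shown to lie in it.
  set N := (Algebra.TensorProduct.map (AlgHom.id ℂ (A ⊗[ℂ] A)) S.val).range with hN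
  have hκ₁ : ∀ x, κ₁ x ∈ N := fun x => ⟨(x ⊗ₜ 1) ⊗ₜ 1, by simp [κ₁]⟩
  have hκ₄ : ∀ x, κ₄ x ∈ N := fun x => ⟨(1 ⊗ₜ x) ⊗ₜ 1, by simp [κ₄]⟩
  have hκ₂ : ∀ x ∈ S, κ₂ x ∈ N := fun x hx => ⟨1 ⊗ₜ ⟨x, hx⟩, by simp [κ₂]⟩
  have m₁₄ : ∀ z, lg _ _ h₁₄ z ∈ N := fun z => by
    induction z with
    | zero => simp
    | tmul x y => rw [lg_tmul]; exact mul_mem (hκ₁ x) (hκ₄ y)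
    | add x y hx hy => rw [map_add]; exact add_mem hx hy
  have m₁₂ : ∀ z ∈ tens ⊤ (Subalgebra.toSubmodule S), lg _ _ h₁₂ z ∈ N := fun z hz =>
    tens_induction (p := fun z => lg _ _ h₁₂ z ∈ N) hz (by simp)
      (fun x _ y hy => by rw [lg_tmul]; exact mul_mem (hκ₁ x) (hκ₂ y hy))
      fun x y hx hy => by rw [map_add]; exact add_mem hx hy
  have m₂₄ : ∀ z ∈ tens (Subalgebra.toSubmodule S) ⊤, lg _ _ h₂₄ z ∈ N := fun z hz =>
    tens_induction (p := fun z => lg _ _ h₂₄ z ∈ N) hz (by simp)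
      (fun x hx y _ => by rw [lg_tmul]; exact mul_mem (hκ₂ x hx) (hκ₄ y))
      fun x y hx hy => by rw [map_add]; exact add_mem hx hy
  have mb : lg _ _ h₁₂ v * lg _ _ h₁₄ b * lg _ _ h₁₂ v' ∈ N := by
    refine tens_induction (p := fun z => lg _ _ h₁₂ v * lg _ _ h₁₄ z * lg _ _ h₁₂ v' ∈ N)
      d.b_mem (by simp) (fun x hx y _ => ?_) fun x y hx hy => by
        simp only [map_add, mul_add, add_mul]; exact add_mem hx hy
    have c := (h₁₂.commute_lg h₁₄.symm h₂₄.symm y v').eq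
    have : lg _ _ h₁₂ v * lg _ _ h₁₄ (x ⊗ₜ y) * lg _ _ h₁₂ v' =
        lg _ _ h₁₂ (v * (x ⊗ₜ 1) * v') * κ₄ y := by
      rw [lg_copr, lg_tmul]; simp only [mul_assoc]; rw [c]
    rw [this]
    exact mul_mem (m₁₂ _ (tens_mono le_top le_rfl (d.copr_mem x (d.D_le hx)))) (hκ₄ y)
  have ma : lg _ _ h₂₄ v * lg _ _ h₁₂ a * lg _ _ h₂₄ v' ∈ N := by
    refine tens_induction (p := fun z => lg _ _ h₂₄ v * lg _ _ h₁₂ z * lg _ _ h₂₄ v' ∈ N)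
      d.a_mem (by simp) (fun x _ y hy => ?_) fun x y hx hy => by
        simp only [map_add, mul_add, add_mul]; exact add_mem hx hy
    have c := (h₂₄.commute_lg h₁₂ h₁₄ x v).eq
    have : lg _ _ h₂₄ v * lg _ _ h₁₂ (x ⊗ₜ y) * lg _ _ h₂₄ v' =
        κ₁ x * lg _ _ h₂₄ (v * (y ⊗ₜ 1) * v') := by
      rw [lg_copr, lg_tmul]; simp only [← mul_assoc]; rw [c]
    rw [this]
    exact mul_mem (hκ₁ x) (m₂₄ _ (tens_mono le_rfl le_top (d.copr_mem y (d.G_le hy))))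
  have hL : (lg _ _ h₁₂ v * lg _ _ h₁₄ b * lg _ _ h₁₂ v') *
      (lg _ _ h₂₄ v * lg _ _ h₁₂ a * lg _ _ h₂₄ v') ∈ N := mul_mem mb ma
  have hR : lg _ _ h₁₂ a * (lg _ _ h₁₄ b * lg _ _ h₁₄ a) * lg _ _ h₂₄ b ∈ N :=
    mul_mem (mul_mem (m₁₂ _ (tens_mono le_rfl d.G_le d.a_mem)) (mul_mem (m₁₄ _) (m₁₄ _)))
      (m₂₄ _ (tens_mono d.D_le le_rfl d.b_mem))
  rw [← d.lTensor_left_inv _ hL, ← d.lTensor_left_inv _ hR]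
  rw [LinearMap.lTensor_comp, LinearMap.comp_apply, LinearMap.comp_apply]
  congr 1
  -- θ keeps the legs 1, 4 and 2 and leaves room for the new leg 3, embedded by ι₃.
  let θ : (A ⊗[ℂ] A) ⊗[ℂ] A →ₐ[ℂ] (A ⊗[ℂ] A) ⊗[ℂ] (A ⊗[ℂ] A) :=
    Algebra.TensorProduct.map (AlgHom.id ℂ _) Algebra.TensorProduct.includeLeft
  let ι₃ : A →ₐ[ℂ] (A ⊗[ℂ] A) ⊗[ℂ] (A ⊗[ℂ] A) :=
    Algebra.TensorProduct.includeRight.comp Algebra.TensorProduct.includeRight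
  have g₁₃ : Cm (θ.comp κ₁) ι₃ := fun x y => by simp [θ, κ₁, ι₃, Commute, SemiconjBy]
  have g₂₃ : Cm (θ.comp κ₂) ι₃ := fun x y => by simp [θ, κ₂, ι₃, Commute, SemiconjBy]
  have g₃₄ : Cm ι₃ (θ.comp κ₄) := fun x y => by simp [θ, κ₄, ι₃, Commute, SemiconjBy]
  have hlg : ∀ z, lg _ _ g₂₃ z = (1 : A ⊗[ℂ] A) ⊗ₜ z := fun z => by
    induction z with
    | zero => simp
    | tmul x y => simp [θ, κ₂, ι₃]
    | add x y hx hy => rw [map_add, hx, hy, TensorProduct.tmul_add]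
  have hJ : ∀ z, (LinearMap.mulLeft ℂ ((1 : A) ⊗ₜ p) ∘ₗ LinearMap.mulRight ℂ (q ⊗ₜ (1 : A)) ∘ₗ
        LinearMap.mulLeft ℂ v ∘ₗ LinearMap.mulRight ℂ v' ∘ₗ
        (TensorProduct.mk ℂ A A).flip 1).lTensor (A ⊗[ℂ] A) z =
      ι₃ p * (lg _ _ g₂₃ v * θ z * lg _ _ g₂₃ v') * (θ.comp κ₂) q := fun z => by
    induction z with
    | zero => simp
    | tmul x y => rw [hlg, hlg]; simp [θ, κ₂, ι₃, mul_assoc]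
    | add x y hx hy => simp only [map_add, mul_add, add_mul, hx, hy]
  rw [hJ, hJ]
  simp only [map_mul, map_lg]
  exact (d.four_left (h₁₂.map θ) g₁₃ (h₁₄.map θ) g₂₃ (h₂₄.map θ) g₃₄).trans
    (d.four_right (h₁₂.map θ) g₁₃ (h₁₄.map θ) g₂₃ (h₂₄.map θ) g₃₄).symm

/-- `(V_{ij} b_{ik} V_{ij}*) (V_{jk} a_{ij} V_{jk}*) = a_{ij} b_{ik} a_{ik} b_{jk}`. -/
theorem conj_b_mul_conj_a (hij : Cm i j) (hik : Cm i k) (hjk : Cm j k) :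
    (lg i j hij v * lg i k hik b * lg i j hij v') * (lg j k hjk v * lg i j hij a * lg j k hjk v') =
      lg i j hij a * (lg i k hik b * lg i k hik a) * lg j k hjk b := by
  obtain ⟨h₁₂, h₁₄, h₂₄, h⟩ := d.conj_b_mul_conj_a_legs
  let φ : (A ⊗[ℂ] A) ⊗[ℂ] A →ₐ[ℂ] Q := Algebra.TensorProduct.lift (lg i k hik) j
    fun z x => (hik.commute_lg hij.symm hjk x z).symm
  have h := congrArg φ h
  simp only [map_mul, map_lg] at h
  have e₁ : φ.comp (Algebra.TensorProduct.includeLeft.comp Algebra.TensorProduct.includeLeft) = i := by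
    ext x; simp [φ]
  have e₂ : φ.comp Algebra.TensorProduct.includeRight = j := by
    ext x; simp [φ]
  have e₄ : φ.comp (Algebra.TensorProduct.includeLeft.comp Algebra.TensorProduct.includeRight) = k := by
    ext x; simp [φ]
  simpa only [lg_congr _ hij e₁ e₂, lg_congr _ hik e₁ e₄, lg_congr _ hjk e₂ e₄] using h

/-- The inner factors a₁₂b₁₃a₁₃b₂₃ are replaced by conjugates under V. These are absorbed by the
outer b₁₂ and a₂₃ through `b_mul_b` and `a_mul_a`, and a last commutation reorders the result. -/
theorem pentagon : Pentagon (b * a) := by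
  rw [Pentagon]
  simp only [map_mul]
  have hij := c₁₂ (A := A)
  have hik := c₁₃ (A := A)
  have hjk := c₂₃ (A := A)
  calc _ = lg j₁ j₂ hij b * (lg j₁ j₂ hij a * (lg j₁ j₃ hik b * lg j₁ j₃ hik a) *
        lg j₂ j₃ hjk b) * lg j₂ j₃ hjk a := by simp only [mul_assoc]
    _ = (lg j₁ j₂ hij b * (lg j₁ j₂ hij v * lg j₁ j₃ hik b * lg j₁ j₂ hij v')) *
        ((lg j₂ j₃ hjk v * lg j₁ j₂ hij a * lg j₂ j₃ hjk v') * lg j₂ j₃ hjk a) := by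
        rw [← d.conj_b_mul_conj_a hij hik hjk]; simp only [mul_assoc]
    _ = lg j₂ j₃ hjk b * (lg j₁ j₂ hij b * lg j₂ j₃ hjk a) * lg j₁ j₂ hij a := by
        rw [← d.b_mul_b hij hik hjk, ← d.a_mul_a hij hik hjk]; simp only [mul_assoc]
    _ = _ := by rw [← d.a_comm_b hij hik hjk]; simp only [mul_assoc]

end Data

end Legs

end MultUnitary

end

noncomputable section

namespace MultUnitary

/-! ### Operators on `H ⊗ H` as elements of `End H ⊗ End H` -/

set_option linter.unusedSectionVars false

variable {H : Type*} [NormedAddCommGroup H] [InnerProductSpace ℂ H] [FiniteDimensional ℂ H]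

/-- `End H ⊗ End H` is the algebra of operators on `H ⊗ H`. -/
def endEquiv (H : Type*) [NormedAddCommGroup H] [InnerProductSpace ℂ H] [FiniteDimensional ℂ H] :
    Module.End ℂ H ⊗[ℂ] Module.End ℂ H ≃ₐ[ℂ] Module.End ℂ (H ⊗[ℂ] H) :=
  AlgEquiv.ofBijective (Module.endTensorEndAlgHom (R := ℂ) (S := ℂ) (A := ℂ) (M := H) (N := H)) (by
    have : ⇑(Module.endTensorEndAlgHom (R := ℂ) (S := ℂ) (A := ℂ) (M := H) (N := H)) =
        homTensorHomEquiv ℂ H H H H := by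
      funext z
      induction z with
      | zero => simp
      | tmul x y => rw [homTensorHomEquiv_apply]; rfl
      | add x y hx hy => rw [map_add, map_add, hx, hy]
    rw [this]
    exact (homTensorHomEquiv ℂ H H H H).bijective)

theorem endEquiv_tmul (x y : Module.End ℂ H) :
    endEquiv H (x ⊗ₜ y) = TensorProduct.map x y := rfl

theorem endEquiv_tmul_one (x : Module.End ℂ H) : endEquiv H (x ⊗ₜ 1) = x.rTensor H := rfl

theorem endEquiv_star (z : Module.End ℂ H ⊗[ℂ] Module.End ℂ H) :
    endEquiv H (star z) = star (endEquiv H z) := by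
  rw [LinearMap.star_eq_adjoint]
  induction z with
  | zero => rw [star_zero, map_zero, map_zero]
  | tmul x y =>
    rw [TensorProduct.star_tmul, endEquiv_tmul, endEquiv_tmul, LinearMap.star_eq_adjoint,
      LinearMap.star_eq_adjoint, TensorProduct.adjoint_map]
  | add x y hx hy => rw [star_add, map_add, map_add, hx, hy, map_add]

theorem endEquiv_comm (z : Module.End ℂ H ⊗[ℂ] Module.End ℂ H) :
    endEquiv H (Algebra.TensorProduct.comm ℂ _ _ z) = flipMap H * endEquiv H z * flipMap H := by
  induction z with
  | zero => simp
  | tmul x y =>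
    rw [Algebra.TensorProduct.comm_tmul, endEquiv_tmul, endEquiv_tmul]
    ext ξ η
    simp
  | add x y hx hy => simp only [map_add, mul_add, add_mul, hx, hy]

theorem comm_star {A : Type*} [Ring A] [StarRing A] [Algebra ℂ A] [StarModule ℂ A]
    (z : A ⊗[ℂ] A) : Algebra.TensorProduct.comm ℂ A A (star z) =
      star (Algebra.TensorProduct.comm ℂ A A z) := by
  induction z with
  | zero => simp
  | tmul x y => simp [TensorProduct.star_tmul]
  | add x y hx hy => simp only [map_add, star_add, hx, hy]

theorem lTensor_endEquiv_comm_apply (z : Module.End ℂ H ⊗[ℂ] Module.End ℂ H) (ξ η : H) :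
    endEquiv H (Algebra.TensorProduct.comm ℂ _ _ z) (ξ ⊗ₜ η) =
      TensorProduct.comm ℂ H H (endEquiv H z (η ⊗ₜ ξ)) := by
  rw [endEquiv_comm]; rfl

theorem slL_endEquiv_tmul (x y : Module.End ℂ H) (ζ η : H) :
    slL (endEquiv H (x ⊗ₜ y)) ζ η = inner ℂ ζ (x η) • y := by
  ext θ
  rw [slL_apply, endEquiv_tmul, TensorProduct.map_tmul, braL_tmul, LinearMap.smul_apply]

theorem slR_endEquiv_tmul (x y : Module.End ℂ H) (ζ η : H) :
    slR (endEquiv H (x ⊗ₜ y)) ζ η = inner ℂ ζ (y η) • x := by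
  ext θ
  rw [slR_apply, endEquiv_tmul, TensorProduct.map_tmul, braR_tmul, LinearMap.smul_apply]

theorem slL_add (S T : Module.End ℂ (H ⊗[ℂ] H)) (ζ η : H) :
    slL (S + T) ζ η = slL S ζ η + slL T ζ η := by
  ext θ; simp [slL_apply]

theorem slR_add (S T : Module.End ℂ (H ⊗[ℂ] H)) (ζ η : H) :
    slR (S + T) ζ η = slR S ζ η + slR T ζ η := by
  ext θ; simp [slR_apply]

@[simp] theorem slL_zero (ζ η : H) : slL (0 : Module.End ℂ (H ⊗[ℂ] H)) ζ η = 0 := by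
  ext θ; simp [slL_apply]

@[simp] theorem slR_zero (ζ η : H) : slR (0 : Module.End ℂ (H ⊗[ℂ] H)) ζ η = 0 := by
  ext θ; simp [slR_apply]

theorem slL_lTensor (Φ : Module.End ℂ H →ₗ[ℂ] Module.End ℂ H)
    (z : Module.End ℂ H ⊗[ℂ] Module.End ℂ H) (ζ η : H) :
    slL (endEquiv H (Φ.lTensor _ z)) ζ η = Φ (slL (endEquiv H z) ζ η) := by
  induction z with
  | zero => simp
  | tmul x y => rw [LinearMap.lTensor_tmul, slL_endEquiv_tmul, slL_endEquiv_tmul, map_smul]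
  | add x y hx hy => simp only [map_add, slL_add, hx, hy]

theorem slL_mem_of_mem_tens {R : Submodule ℂ (Module.End ℂ H)}
    {z : Module.End ℂ H ⊗[ℂ] Module.End ℂ H} (hz : z ∈ tens ⊤ R) (ζ η : H) :
    slL (endEquiv H z) ζ η ∈ R :=
  tens_induction (p := fun z => slL (endEquiv H z) ζ η ∈ R) hz (by simp)
    (fun x _ y hy => by rw [slL_endEquiv_tmul]; exact R.smul_mem _ hy)
    fun x y hx hy => by rw [map_add, slL_add]; exact add_mem hx hy

theorem slR_mem_of_mem_tens {R : Submodule ℂ (Module.End ℂ H)}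
    {z : Module.End ℂ H ⊗[ℂ] Module.End ℂ H} (hz : z ∈ tens R ⊤) (ζ η : H) :
    slR (endEquiv H z) ζ η ∈ R :=
  tens_induction (p := fun z => slR (endEquiv H z) ζ η ∈ R) hz (by simp)
    (fun x hx y _ => by rw [slR_endEquiv_tmul]; exact R.smul_mem _ hx)
    fun x y hx hy => by rw [map_add, slR_add]; exact add_mem hx hy

theorem eq_sum_tmul_slL {ι : Type*} [Fintype ι] (ε : OrthonormalBasis ι ℂ H)
    (z : Module.End ℂ H ⊗[ℂ] Module.End ℂ H) :
    z = ∑ i, ∑ j, ((innerₛₗ ℂ (ε j)).smulRight (ε i)) ⊗ₜ slL (endEquiv H z) (ε i) (ε j) := by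
  apply (endEquiv H).injective
  simp only [map_sum, endEquiv_tmul]
  exact eq_sum_map_slL ε _

theorem mem_tens_of_slL {R : Submodule ℂ (Module.End ℂ H)}
    {z : Module.End ℂ H ⊗[ℂ] Module.End ℂ H} (hz : ∀ ζ η, slL (endEquiv H z) ζ η ∈ R) :
    z ∈ tens ⊤ R := by
  rw [eq_sum_tmul_slL (stdOrthonormalBasis ℂ H) z]
  exact Submodule.sum_mem _ fun i _ => Submodule.sum_mem _ fun j _ =>
    tmul_mem_tens Submodule.mem_top (hz _ _)

theorem comm_mem_tens {A : Type*} [Ring A] [Algebra ℂ A] {P R : Submodule ℂ A} {z : A ⊗[ℂ] A}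
    (hz : z ∈ tens P R) : Algebra.TensorProduct.comm ℂ A A z ∈ tens R P :=
  tens_induction (p := fun z => Algebra.TensorProduct.comm ℂ A A z ∈ tens R P) hz (by simp)
    (fun x hx y hy => by rw [Algebra.TensorProduct.comm_tmul]; exact tmul_mem_tens hy hx)
    fun x y hx hy => by rw [map_add]; exact add_mem hx hy

theorem star_mem_tens {A : Type*} [Ring A] [StarRing A] [Algebra ℂ A] [StarModule ℂ A]
    {P R P' R' : Submodule ℂ A} (hP : ∀ x ∈ P, star x ∈ P') (hR : ∀ x ∈ R, star x ∈ R')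
    {z : A ⊗[ℂ] A} (hz : z ∈ tens P R) : star z ∈ tens P' R' :=
  tens_induction (p := fun z => star z ∈ tens P' R') hz (by simp)
    (fun x hx y hy => by
      rw [TensorProduct.star_tmul]; exact tmul_mem_tens (hP _ hx) (hR _ hy))
    fun x y hx hy => by rw [star_add]; exact add_mem hx hy

theorem mul_mem_tens {A : Type*} [Ring A] [Algebra ℂ A]
    {P R P' R' P'' R'' : Submodule ℂ A} (hP : ∀ x ∈ P, ∀ y ∈ P', x * y ∈ P'')
    (hR : ∀ x ∈ R, ∀ y ∈ R', x * y ∈ R'') {z z' : A ⊗[ℂ] A} (hz : z ∈ tens P R)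
    (hz' : z' ∈ tens P' R') : z * z' ∈ tens P'' R'' := by
  refine tens_induction (p := fun z => z * z' ∈ tens P'' R'') hz (by simp) (fun x hx y hy => ?_)
    fun x y hx hy => by rw [add_mul]; exact add_mem hx hy
  refine tens_induction (p := fun z' => (x ⊗ₜ[ℂ] y) * z' ∈ tens P'' R'') hz' (by simp)
    (fun x' hx' y' hy' => ?_) fun x y hx hy => by rw [mul_add]; exact add_mem hx hy
  rw [Algebra.TensorProduct.tmul_mul_tmul]
  exact tmul_mem_tens (hP _ hx _ hx') (hR _ hy _ hy')

theorem lTensor_mem_tens {A : Type*} [Ring A] [Algebra ℂ A] {R : Submodule ℂ A} {Φ : A →ₗ[ℂ] A}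
    (hΦ : ∀ x, Φ x ∈ R) (z : A ⊗[ℂ] A) : Φ.lTensor A z ∈ tens ⊤ R := by
  induction z with
  | zero => simp
  | tmul x y => exact tmul_mem_tens Submodule.mem_top (hΦ y)
  | add x y hx hy => rw [map_add]; exact add_mem hx hy

/-- `V` as an element of `End H ⊗ End H`. -/
def vt (V : (H ⊗[ℂ] H) ≃ₗᵢ[ℂ] (H ⊗[ℂ] H)) : Module.End ℂ H ⊗[ℂ] Module.End ℂ H :=
  (endEquiv H).symm (op V)

theorem endEquiv_vt (V : (H ⊗[ℂ] H) ≃ₗᵢ[ℂ] (H ⊗[ℂ] H)) : endEquiv H (vt V) = op V :=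
  (endEquiv H).apply_symm_apply _

theorem vt_mul_vt_symm (V : (H ⊗[ℂ] H) ≃ₗᵢ[ℂ] (H ⊗[ℂ] H)) : vt V * vt V.symm = 1 := by
  rw [vt, vt, ← map_mul, op_mul_op_symm, map_one]

theorem vt_symm_mul_vt (V : (H ⊗[ℂ] H) ≃ₗᵢ[ℂ] (H ⊗[ℂ] H)) : vt V.symm * vt V = 1 := by
  rw [vt, vt, ← map_mul, op_symm_mul_op, map_one]

theorem star_op (V : (H ⊗[ℂ] H) ≃ₗᵢ[ℂ] (H ⊗[ℂ] H)) : star (op V) = op V.symm := by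
  rw [LinearMap.star_eq_adjoint, eq_comm, LinearMap.eq_adjoint_iff]
  exact fun x y => (inner_op V x y).symm

theorem star_vt (V : (H ⊗[ℂ] H) ≃ₗᵢ[ℂ] (H ⊗[ℂ] H)) : star (vt V) = vt V.symm := by
  apply (endEquiv H).injective
  rw [endEquiv_star, endEquiv_vt, endEquiv_vt, star_op]

theorem vt_mem_tens_algS (V : (H ⊗[ℂ] H) ≃ₗᵢ[ℂ] (H ⊗[ℂ] H)) : vt V ∈ tens ⊤ (algS V) :=
  mem_tens_of_slL fun ζ η => by rw [endEquiv_vt]; exact slL_mem _ _ _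

/-- The map `x ↦ V (x ⊗ 1) V*`. -/
def copr (V : (H ⊗[ℂ] H) ≃ₗᵢ[ℂ] (H ⊗[ℂ] H)) :
    Module.End ℂ H →ₗ[ℂ] Module.End ℂ H ⊗[ℂ] Module.End ℂ H :=
  LinearMap.mulLeft ℂ (vt V) ∘ₗ LinearMap.mulRight ℂ (vt V.symm) ∘ₗ
    (TensorProduct.mk ℂ (Module.End ℂ H) (Module.End ℂ H)).flip 1

theorem copr_apply (V : (H ⊗[ℂ] H) ≃ₗᵢ[ℂ] (H ⊗[ℂ] H)) (x : Module.End ℂ H) :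
    copr V x = vt V * (x ⊗ₜ 1) * vt V.symm := (mul_assoc _ _ _).symm

theorem copr_mul (V : (H ⊗[ℂ] H) ≃ₗᵢ[ℂ] (H ⊗[ℂ] H)) (x y : Module.End ℂ H) :
    copr V (x * y) = copr V x * copr V y := by
  have h : (x * y) ⊗ₜ[ℂ] (1 : Module.End ℂ H) = (x ⊗ₜ 1) * (y ⊗ₜ 1) := by simp
  simp only [copr_apply]
  calc _ = vt V * (x ⊗ₜ 1) * 1 * (y ⊗ₜ 1) * vt V.symm := by rw [h, mul_one]; simp only [mul_assoc]
    _ = _ := by rw [← vt_symm_mul_vt V]; simp only [mul_assoc]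

theorem star_copr (V : (H ⊗[ℂ] H) ≃ₗᵢ[ℂ] (H ⊗[ℂ] H)) (x : Module.End ℂ H) :
    star (copr V x) = copr V (star x) := by
  rw [copr_apply, copr_apply, star_mul, star_mul, TensorProduct.star_tmul, star_vt, star_vt,
    LinearIsometryEquiv.symm_symm, star_one, mul_assoc]

theorem copr_mul_vt (V : (H ⊗[ℂ] H) ≃ₗᵢ[ℂ] (H ⊗[ℂ] H)) (x : Module.End ℂ H) :
    copr V x * vt V = vt V * (x ⊗ₜ 1) := by
  rw [copr_apply, mul_assoc, vt_symm_mul_vt, mul_one]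

theorem endEquiv_copr (V : (H ⊗[ℂ] H) ≃ₗᵢ[ℂ] (H ⊗[ℂ] H)) (x : Module.End ℂ H) :
    endEquiv H (copr V x) = op V * x.rTensor H * op V.symm := by
  rw [copr_apply, map_mul, map_mul, endEquiv_vt, endEquiv_vt, endEquiv_tmul_one]

theorem IsMultiplicative.copr_slL {V : (H ⊗[ℂ] H) ≃ₗᵢ[ℂ] (H ⊗[ℂ] H)} (hV : IsMultiplicative V)
    {ι : Type*} [Fintype ι] (ε : OrthonormalBasis ι ℂ H) (ζ η : H) :
    copr V (slL (op V) ζ η) = ∑ i, slL (op V) ζ (ε i) ⊗ₜ slL (op V) (ε i) η := by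
  apply (endEquiv H).injective
  rw [endEquiv_copr, hV.coproduct_slL ε, map_sum]
  rfl

theorem IsMultiplicative.copr_elt {V : (H ⊗[ℂ] H) ≃ₗᵢ[ℂ] (H ⊗[ℂ] H)} (hV : IsMultiplicative V)
    {ι : Type*} [Fintype ι] (ε : OrthonormalBasis ι ℂ H) (ehat η : H) :
    copr V (Std.elt V ehat η) = ∑ i, Std.elt V ehat (ε i) ⊗ₜ slL (op V) (ε i) η := by
  simp only [Std.elt_apply, map_smul, hV.copr_slL ε, Finset.smul_sum, TensorProduct.smul_tmul']

/-- The third tensor power of an algebra. -/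
abbrev Tri (A : Type*) [Ring A] [Algebra ℂ A] : Type _ := A ⊗[ℂ] (A ⊗[ℂ] A)

/-- The isomorphism of `End H ⊗ (End H ⊗ End H)` with the operators on `H ⊗ (H ⊗ H)`. -/
def endEquiv3 (H : Type*) [NormedAddCommGroup H] [InnerProductSpace ℂ H] [FiniteDimensional ℂ H] :
    Tri (Module.End ℂ H) →ₐ[ℂ] Module.End ℂ (H ⊗[ℂ] (H ⊗[ℂ] H)) :=
  (Module.endTensorEndAlgHom (R := ℂ) (S := ℂ) (A := ℂ) (M := H) (N := H ⊗[ℂ] H)).comp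
    (Algebra.TensorProduct.map (AlgHom.id ℂ _) (endEquiv H).toAlgHom)

theorem endEquiv3_tmul (x y z : Module.End ℂ H) :
    endEquiv3 H (x ⊗ₜ (y ⊗ₜ z)) = TensorProduct.map x (TensorProduct.map y z) := rfl

theorem endEquiv3_injective : Function.Injective (endEquiv3 H) := by
  have h1 : Function.Injective
      (Module.endTensorEndAlgHom (R := ℂ) (S := ℂ) (A := ℂ) (M := H) (N := H ⊗[ℂ] H)) := by
    have : ⇑(Module.endTensorEndAlgHom (R := ℂ) (S := ℂ) (A := ℂ) (M := H) (N := H ⊗[ℂ] H)) =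
        homTensorHomEquiv ℂ H (H ⊗[ℂ] H) H (H ⊗[ℂ] H) := by
      funext z
      induction z with
      | zero => simp
      | tmul x y => rw [homTensorHomEquiv_apply]; rfl
      | add x y hx hy => rw [map_add, map_add, hx, hy]
    rw [this]
    exact LinearEquiv.injective _
  exact h1.comp (Algebra.TensorProduct.congr AlgEquiv.refl (endEquiv H)).injective

theorem endEquiv3_lg₁₂ (z : Module.End ℂ H ⊗[ℂ] Module.End ℂ H) :
    endEquiv3 H (lg j₁ j₂ c₁₂ z) = leg12 (endEquiv H z) := by
  induction z with
  | zero => simp [leg12]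
  | tmul x y =>
    rw [lg_j₁₂_tmul, endEquiv3_tmul, endEquiv_tmul]
    refine ext3 fun ξ η θ => ?_
    simp [leg12_tmul]
  | add x y hx hy =>
    simp only [map_add, hx, hy]
    refine ext3 fun ξ η θ => ?_
    simp [leg12_tmul]

theorem endEquiv3_lg₁₃ (z : Module.End ℂ H ⊗[ℂ] Module.End ℂ H) :
    endEquiv3 H (lg j₁ j₃ c₁₃ z) = leg13 (endEquiv H z) := by
  induction z with
  | zero => simp [leg13, leg12]
  | tmul x y =>
    rw [lg_j₁₃_tmul, endEquiv3_tmul, endEquiv_tmul]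
    refine ext3 fun ξ η θ => ?_
    simp [leg13_tmul]
  | add x y hx hy =>
    simp only [map_add, hx, hy]
    refine ext3 fun ξ η θ => ?_
    simp [leg13_tmul]

theorem endEquiv3_lg₂₃ (z : Module.End ℂ H ⊗[ℂ] Module.End ℂ H) :
    endEquiv3 H (lg j₂ j₃ c₂₃ z) = leg23 (endEquiv H z) := by
  rw [lg_j₂₃]; rfl

/-- The bridge between operators on H ⊗ H ⊗ H and the leg calculus: the representation of the triple
tensor product of End H is faithful. -/
theorem isMultiplicative_iff (V : (H ⊗[ℂ] H) ≃ₗᵢ[ℂ] (H ⊗[ℂ] H)) :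
    IsMultiplicative V ↔ Pentagon (vt V) := by
  rw [Pentagon, ← endEquiv3_injective.eq_iff, map_mul, map_mul, map_mul, endEquiv3_lg₁₂,
    endEquiv3_lg₁₃, endEquiv3_lg₂₃, endEquiv_vt, IsMultiplicative]

end MultUnitary

end

noncomputable section

namespace MultUnitary

set_option linter.unusedSectionVars false

variable {H : Type*} [NormedAddCommGroup H] [InnerProductSpace ℂ H] [FiniteDimensional ℂ H]
variable {V : (H ⊗[ℂ] H) ≃ₗᵢ[ℂ] (H ⊗[ℂ] H)} {e ehat f g : H}

/-! ### The coproduct and pre-subgroups -/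

/-- `G_f` as a subspace. -/
def subG (V : (H ⊗[ℂ] H) ≃ₗᵢ[ℂ] (H ⊗[ℂ] H)) (e f : H) : Submodule ℂ (Module.End ℂ H) :=
  algS V ⊓ (lowerSpace V f).comap (LinearMap.applyₗ e)

/-- `D_f` as a subspace. -/
def subD (V : (H ⊗[ℂ] H) ≃ₗᵢ[ℂ] (H ⊗[ℂ] H)) (e f : H) : Submodule ℂ (Module.End ℂ H) :=
  algS V ⊓ ((lowerSpace V f).map (antipodeOperator V e)).comap (LinearMap.applyₗ e)

/-- `Ĝ_f` as a subspace. -/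
def subGHat (V : (H ⊗[ℂ] H) ≃ₗᵢ[ℂ] (H ⊗[ℂ] H)) (e ehat f : H) :
    Submodule ℂ (Module.End ℂ H) :=
  algSHat V ⊓ ((upperSpace V f).map (antipodeOperator V e)).comap (LinearMap.applyₗ ehat)

namespace Std

variable (h : Std V e ehat)
include h

theorem counit_slL (ζ η : H) : counit ehat (slL (op V) ζ η) = inner ℂ ζ η := by
  rw [counit_apply, h.slL_apply_ehat, inner_smul_right, h.inner_hh, mul_one]

theorem elt_mul {x : Module.End ℂ H} (hx : x ∈ algS V) (η : H) :
    elt V ehat (x η) = x * elt V ehat η :=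
  h.eq_of_apply_e (elt_mem _) (h.mul_mem hx (elt_mem _)) (by
    rw [h.elt_e, Module.End.mul_apply, h.elt_e])

theorem copr_mem {x : Module.End ℂ H} (hx : x ∈ algS V) : copr V x ∈ tens (algS V) (algS V) := by
  rw [← h.elt_apply_e hx, h.mult.copr_elt (stdOrthonormalBasis ℂ H)]
  exact Submodule.sum_mem _ fun i _ => tmul_mem_tens (elt_mem _) (slL_mem _ _ _)

theorem comm_copr_opp {x : Module.End ℂ H} (hx : x ∈ algS V) :
    Algebra.TensorProduct.comm ℂ _ _ (copr h.opp x) = copr V x := by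
  apply (endEquiv H).injective
  rw [endEquiv_comm, endEquiv_copr, endEquiv_copr, h.opp_coproduct hx]
  ext ξ η
  simp

end Std

namespace IsPreSubgroup

variable (hf : IsPreSubgroup V e f) (h : Std V e ehat)
include hf h

theorem inner_ehat_ne : inner ℂ f ehat ≠ (0 : ℂ) := (hf.dual h).inner_ne

/-- From Δ(u)(ξ ⊗ f) = uξ ⊗ f, the operator u ⊗ 1 can be moved through V* on ξ ⊗ f; pair with ⟨f|
and use that p̂_f is self-adjoint. -/
theorem phat_apply_of_mem {u : Module.End ℂ H} (hu : u ∈ algG V e f) (ξ : H) :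
    slR (op V) f f (u ξ) = u (slR (op V) f f ξ) := by
  have h1 := (hf.mem_algG_iff h hu.1).1 hu
  have key : u.rTensor H (op V.symm (ξ ⊗ₜ f)) = op V.symm (u ξ ⊗ₜ f) := by
    rw [← h1 ξ, Module.End.mul_apply, Module.End.mul_apply, ← Module.End.mul_apply (op V.symm),
      op_symm_mul_op, Module.End.one_apply]
  have h2 := congrArg (braR f) key
  rw [braR_rTensor, ← slR_apply, ← slR_apply, ← star_slR, hf.star_phat h] at h2
  exact h2.symm

/-- The pentagon relation on η ⊗ e ⊗ f, where V₂₃ and V₁₃ act trivially. It makes G_f a coideal: the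
second legs of Δ(u) stay in G_f. -/
theorem slL_mem_algG {η : H} (hη : η ∈ lowerSpace V f) (ζ : H) : slL (op V) ζ η ∈ algG V e f := by
  refine ⟨slL_mem _ _ _, ?_⟩
  have h1 := LinearMap.congr_fun h.mult (η ⊗ₜ (e ⊗ₜ f))
  have hη' : op V (η ⊗ₜ f) = η ⊗ₜ f := hη
  simp only [Module.End.mul_apply, leg23_tmul, leg12_tmul, leg13_tmul, h.fixed.op_apply, hη',
    insM_tmul] at h1
  have h2 := congrArg (braL ζ) h1
  rw [bra1_leg23, bra1_insR, ← slL_apply] at h2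
  exact h2.symm

theorem copr_mem_subG {u : Module.End ℂ H} (hu : u ∈ algG V e f) :
    copr V u ∈ tens ⊤ (subG V e f) := by
  rw [← h.elt_apply_e hu.1, h.mult.copr_elt (stdOrthonormalBasis ℂ H)]
  exact Submodule.sum_mem _ fun i _ =>
    tmul_mem_tens Submodule.mem_top (hf.slL_mem_algG h hu.2 _)

end IsPreSubgroup

namespace Pair

variable (k : Pair V e ehat f g)
include k

/-- The second legs of Δ(u) are in G_f, on which p_f acts by the counit; then the counit axiom
leaves u. -/
theorem p_mul_copr {u : Module.End ℂ H} (hu : u ∈ algG V e f) :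
    (1 ⊗ₜ slL (op V) f f) * copr V u = u ⊗ₜ slL (op V) f f := by
  have h := k.std
  let ε := stdOrthonormalBasis ℂ H
  conv_lhs => rw [← h.elt_apply_e hu.1, h.mult.copr_elt ε]
  conv_rhs => rw [← h.elt_apply_e hu.1, ← ε.sum_repr' (u e)]
  simp only [Finset.mul_sum, map_sum, map_smul, TensorProduct.sum_tmul]
  refine Finset.sum_congr rfl fun i _ => ?_
  rw [Algebra.TensorProduct.tmul_mul_tmul, one_mul, k.p_apply_left (k.left.slL_mem_algG h hu.2 _),
    h.counit_slL, TensorProduct.tmul_smul, TensorProduct.smul_tmul']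

theorem copr_mul_p {u : Module.End ℂ H} (hu : u ∈ algG V e f) :
    copr V u * (1 ⊗ₜ slL (op V) f f) = u ⊗ₜ slL (op V) f f := by
  have h := k.std
  let ε := stdOrthonormalBasis ℂ H
  conv_lhs => rw [← h.elt_apply_e hu.1, h.mult.copr_elt ε]
  conv_rhs => rw [← h.elt_apply_e hu.1, ← ε.sum_repr' (u e)]
  simp only [Finset.sum_mul, map_sum, map_smul, TensorProduct.sum_tmul]
  refine Finset.sum_congr rfl fun i _ => ?_
  rw [Algebra.TensorProduct.tmul_mul_tmul, mul_one, k.apply_p (k.left.slL_mem_algG h hu.2 _),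
    h.counit_slL, TensorProduct.tmul_smul, TensorProduct.smul_tmul']

theorem slL_opp_self : slL (op k.std.opp) f f = slL (op V) f f := by
  rw [k.std.slL_opp, k.left.invol_dual_self k.std]

theorem mem_algG_opp {d : Module.End ℂ H} : d ∈ algG k.std.opp e g ↔ d ∈ algD V e g := by
  rw [k.right.algG_opp k.std]

/-- D_g is G_g for the opposite unitary, whose coproduct is the flip of Δ: hence p_g in the first
leg here. -/
theorem copr_mul_p_of_mem_algD {d : Module.End ℂ H} (hd : d ∈ algD V e g) :
    copr V d * (slL (op V) g g ⊗ₜ 1) = slL (op V) g g ⊗ₜ d := by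
  have h1 := k.opp.symm.copr_mul_p (k.mem_algG_opp.2 hd)
  have h2 := congrArg (Algebra.TensorProduct.comm ℂ _ _) h1
  rw [map_mul, k.std.comm_copr_opp hd.1, Algebra.TensorProduct.comm_tmul,
    Algebra.TensorProduct.comm_tmul] at h2
  rwa [k.symm.slL_opp_self] at h2

theorem apply_right_of_mem_algD {d : Module.End ℂ H} (hd : d ∈ algD V e g) :
    d g = Std.counit ehat d • g :=
  (k.right.opp k.std).apply_self_of_mem k.std.std_opp (k.mem_algG_opp.2 hd)

theorem mul_p_of_mem_algD {d : Module.End ℂ H} (hd : d ∈ algD V e g) :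
    d * slL (op V) g g = Std.counit ehat d • slL (op V) g g := by
  have := k.opp.symm.apply_p (k.mem_algG_opp.2 hd)
  rwa [k.symm.slL_opp_self] at this

theorem eqOn_algS {M : Type*} [AddCommGroup M] [Module ℂ M] {F G : Module.End ℂ H →ₗ[ℂ] M}
    (hFG : ∀ u ∈ algG V e f, ∀ d ∈ algD V e g, F (u * d) = G (u * d)) {s : Module.End ℂ H}
    (hs : s ∈ algS V) : F s = G s := by
  have : Submodule.span ℂ {z | ∃ u, u ∈ algG V e f ∧ ∃ v, v ∈ algD V e g ∧ z = u * v} ≤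
      LinearMap.eqLocus F G := by
    rw [Submodule.span_le]
    rintro _ ⟨u, hu, d, hd, rfl⟩
    exact hFG u hu d hd
  exact this (k.mem_span_algG_mul_algD hs)

end Pair

/-! ### The projection of `S = G_f D_g` onto `G_f` -/

/-- The map with `u d ↦ ε(d) u` for `u ∈ G_f` and `d ∈ D_g`. -/
def phi (V : (H ⊗[ℂ] H) ≃ₗᵢ[ℂ] (H ⊗[ℂ] H)) (ehat f g : H) :
    Module.End ℂ H →ₗ[ℂ] Module.End ℂ H :=
  (inner ℂ f ehat : ℂ)⁻¹ • (Std.elt V ehat ∘ₗ slR (op V) f f ∘ₗ LinearMap.applyₗ g)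

theorem phi_apply (s : Module.End ℂ H) :
    phi V ehat f g s = (inner ℂ f ehat : ℂ)⁻¹ • Std.elt V ehat (slR (op V) f f (s g)) := rfl

namespace Pair

variable (k : Pair V e ehat f g)
include k

theorem phi_mem (s : Module.End ℂ H) : phi V ehat f g s ∈ subG V e f := by
  rw [phi_apply]
  refine Submodule.smul_mem _ _ (k.left.elt_mem_algG k.std ?_)
  rw [← slR_apply_eq_iff k.left.inner_self]
  exact slR_idem k.std.mult k.left.inner_self k.left.invariant _

theorem phi_mul {u : Module.End ℂ H} (hu : u ∈ algG V e f) (s : Module.End ℂ H) :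
    phi V ehat f g (u * s) = u * phi V ehat f g s := by
  rw [phi_apply, phi_apply, Module.End.mul_apply, k.left.phat_apply_of_mem k.std hu,
    k.std.elt_mul hu.1, mul_smul_comm]

/-- The normalization in `phi` comes from p̂_f g = ⟨f, ê⟩e. As elements of D_g act on g by the
counit, this and `phi_mul` show that Φ(ud) = ε(d)u. -/
theorem phi_of_apply {s : Module.End ℂ H} {c : ℂ} (hs : s g = c • g) :
    phi V ehat f g s = c • 1 := by
  have h1 : Std.elt V ehat e = 1 := by
    simpa using k.std.elt_apply_e k.std.one_mem
  rw [phi_apply, hs, map_smul, map_smul, k.symm.phat_apply, map_smul, h1, smul_comm,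
    smul_smul _ (inner ℂ f ehat : ℂ), inv_mul_cancel₀ (k.left.inner_ehat_ne k.std), one_smul]

theorem phi_of_mem {u : Module.End ℂ H} (hu : u ∈ algG V e f) : phi V ehat f g u = u := by
  have h1 := k.phi_mul hu 1
  rwa [k.phi_of_apply (s := 1) (c := 1) (by simp), mul_one, one_smul, mul_one] at h1

theorem phi_of_mem_algD {d : Module.End ℂ H} (hd : d ∈ algD V e g) :
    phi V ehat f g d = Std.counit ehat d • 1 := k.phi_of_apply (k.apply_right_of_mem_algD hd)

theorem phi_mul_mem_algD {u d : Module.End ℂ H} (hu : u ∈ algG V e f) (hd : d ∈ algD V e g) :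
    phi V ehat f g (u * d) = Std.counit ehat d • u := by
  rw [k.phi_mul hu, k.phi_of_mem_algD hd, mul_smul_comm, mul_one]

/-- For s = ud both sides equal ε(d)u p_g. So Φ(s) and s agree on H^g, the range of p_g. -/
theorem phi_mul_p {s : Module.End ℂ H} (hs : s ∈ algS V) :
    phi V ehat f g s * slL (op V) g g = s * slL (op V) g g := by
  refine k.eqOn_algS (F := LinearMap.mulRight ℂ (slL (op V) g g) ∘ₗ phi V ehat f g)
    (G := LinearMap.mulRight ℂ (slL (op V) g g)) (fun u hu d hd => ?_) hs
  simp only [LinearMap.comp_apply, LinearMap.mulRight_apply]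
  rw [k.phi_mul_mem_algD hu hd, mul_assoc, k.mul_p_of_mem_algD hd, smul_mul_assoc, mul_smul_comm]

theorem phi_apply_of_mem {s : Module.End ℂ H} (hs : s ∈ algS V) {ξ : H}
    (hξ : ξ ∈ upperSpace V g) : phi V ehat f g s ξ = s ξ := by
  have h1 := (slL_apply_eq_iff k.std.mult k.right.inner_self k.right.invariant ξ).2 hξ
  have h2 := LinearMap.congr_fun (k.phi_mul_p hs) ξ
  rwa [Module.End.mul_apply, Module.End.mul_apply, h1] at h2

theorem ehat_mem_upperSpace : ehat ∈ upperSpace V g := k.std.cofixed g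

theorem counit_phi {s : Module.End ℂ H} (hs : s ∈ algS V) :
    Std.counit ehat (phi V ehat f g s) = Std.counit ehat s := by
  rw [Std.counit_apply, Std.counit_apply, k.phi_apply_of_mem hs k.ehat_mem_upperSpace]

/-- Elements of `G_f` act on `H^f` by the counit. -/
theorem apply_of_mem_upperSpace {u : Module.End ℂ H} (hu : u ∈ algG V e f) {ξ : H}
    (hξ : ξ ∈ upperSpace V f) : u ξ = Std.counit ehat u • ξ := by
  have h1 := (slL_apply_eq_iff k.std.mult k.left.inner_self k.left.invariant ξ).2 hξ
  have h2 := LinearMap.congr_fun (k.apply_p hu) ξ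
  rwa [Module.End.mul_apply, LinearMap.smul_apply, h1] at h2

end Pair

end MultUnitary

end

noncomputable section

namespace MultUnitary

set_option linter.unusedSectionVars false

variable {H : Type*} [NormedAddCommGroup H] [InnerProductSpace ℂ H] [FiniteDimensional ℂ H]
variable {V : (H ⊗[ℂ] H) ≃ₗᵢ[ℂ] (H ⊗[ℂ] H)} {e ehat f g : H}

/-! ### The unitary `a = (id ⊗ Φ)(V)` -/

/-- The image of `V` under `id ⊗ Φ`. -/
def aa (V : (H ⊗[ℂ] H) ≃ₗᵢ[ℂ] (H ⊗[ℂ] H)) (ehat f g : H) : Module.End ℂ H ⊗[ℂ] Module.End ℂ H :=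
  (phi V ehat f g).lTensor _ (vt V)

theorem slL_aa (ζ η : H) : slL (endEquiv H (aa V ehat f g)) ζ η =
    phi V ehat f g (slL (op V) ζ η) := by
  rw [aa, slL_lTensor, endEquiv_vt]

theorem lTensor_mul_left {A : Type*} [Ring A] [Algebra ℂ A]
    {R : Submodule ℂ A} {Φ : A →ₗ[ℂ] A} (hΦ : ∀ u ∈ R, ∀ s, Φ (u * s) = u * Φ s)
    {z : A ⊗[ℂ] A} (hz : z ∈ tens ⊤ R) (z' : A ⊗[ℂ] A) :
    Φ.lTensor A (z * z') = z * Φ.lTensor A z' := by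
  refine tens_induction (p := fun z => Φ.lTensor A (z * z') = z * Φ.lTensor A z') hz (by simp)
    (fun x _ y hy => ?_) fun x y hx hy => by simp only [add_mul, map_add, hx, hy]
  induction z' with
  | zero => simp
  | tmul x' y' => simp [hΦ y hy]
  | add x y hx hy => simp only [mul_add, map_add, hx, hy]

theorem lTensor_mul_tmul_one {A : Type*} [Ring A] [Algebra ℂ A] (Φ : A →ₗ[ℂ] A)
    (z : A ⊗[ℂ] A) (u : A) : Φ.lTensor A (z * (u ⊗ₜ 1)) = Φ.lTensor A z * (u ⊗ₜ 1) := by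
  induction z with
  | zero => simp
  | tmul x' y' => simp
  | add x y hx hy => simp only [add_mul, map_add, hx, hy]

theorem lTensor_mulRight {A : Type*} [Ring A] [Algebra ℂ A] (z : A ⊗[ℂ] A) (q : A) :
    (LinearMap.mulRight ℂ q).lTensor A z = z * (1 ⊗ₜ q) := by
  induction z with
  | zero => simp
  | tmul x' y' => simp
  | add x y hx hy => simp only [add_mul, map_add, hx, hy]

theorem op_tmul_congr {S T : Module.End ℂ (H ⊗[ℂ] H)} {ξ η ξ' : H}
    (hST : ∀ ζ, slL S ζ ξ η = slL T ζ ξ' η) : S (ξ ⊗ₜ η) = T (ξ' ⊗ₜ η) :=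
  ext_braL hST

theorem op_tmul_eq_of_slL {T : Module.End ℂ (H ⊗[ℂ] H)} {ξ η : H}
    (hT : ∀ ζ, slL T ζ ξ η = (inner ℂ ζ ξ : ℂ) • η) : T (ξ ⊗ₜ η) = ξ ⊗ₜ η :=
  ext_braL fun ζ => by rw [braL_tmul]; exact hT ζ

namespace Pair

variable (k : Pair V e ehat f g)
include k

theorem aa_mem : aa V ehat f g ∈ tens ⊤ (subG V e f) := lTensor_mem_tens k.phi_mem _

theorem aa_mul_p : aa V ehat f g * (1 ⊗ₜ slL (op V) g g) = vt V * (1 ⊗ₜ slL (op V) g g) := by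
  rw [← lTensor_mulRight, ← lTensor_mulRight, aa, ← LinearMap.comp_apply, ← LinearMap.lTensor_comp]
  exact lTensor_eq_of_mem (fun s hs => k.phi_mul_p hs) (vt_mem_tens_algS V)

/-- Apply id ⊗ Φ to V(u ⊗ 1) = Δ(u)V. The second legs of Δ(u) are in G_f and Φ is left G_f-linear.
-/
theorem aa_mul {u : Module.End ℂ H} (hu : u ∈ algG V e f) :
    aa V ehat f g * (u ⊗ₜ 1) = copr V u * aa V ehat f g := by
  rw [aa, ← lTensor_mul_tmul_one, ← copr_mul_vt]
  exact lTensor_mul_left (fun u hu s => k.phi_mul hu s)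
    (k.left.copr_mem_subG k.std hu) _

theorem aa_apply_of_mem_upperSpace {ξ : H} (hξ : ξ ∈ upperSpace V g) (η : H) :
    endEquiv H (aa V ehat f g) (η ⊗ₜ ξ) = op V (η ⊗ₜ ξ) :=
  op_tmul_congr fun ζ => by rw [slL_aa, k.phi_apply_of_mem (slL_mem _ _ _) hξ]

theorem aa_apply_of_mem_lowerSpace {ξ : H} (hξ : ξ ∈ lowerSpace V f) (η : H) :
    endEquiv H (aa V ehat f g) (ξ ⊗ₜ η) = op V (ξ ⊗ₜ η) :=
  op_tmul_congr fun ζ => by rw [slL_aa, k.phi_of_mem (k.left.slL_mem_algG k.std hξ ζ)]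

theorem aa_apply_e (η : H) : endEquiv H (aa V ehat f g) (e ⊗ₜ η) = e ⊗ₜ η := by
  rw [k.aa_apply_of_mem_lowerSpace (k.std.fixed f), k.std.fixed.op_apply]

theorem aa_apply_ehat (η : H) : endEquiv H (aa V ehat f g) (η ⊗ₜ ehat) = η ⊗ₜ ehat := by
  rw [k.aa_apply_of_mem_upperSpace k.ehat_mem_upperSpace, k.std.cofixed.op_apply]

/-- `a` fixes `ξ ⊗ η` for `ξ ∈ H_g`. -/
theorem aa_apply_of_mem_lowerSpace_right {ξ : H} (hξ : ξ ∈ lowerSpace V g) (η : H) :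
    endEquiv H (aa V ehat f g) (ξ ⊗ₜ η) = ξ ⊗ₜ η :=
  op_tmul_eq_of_slL fun ζ => by
    rw [slL_aa, k.phi_of_apply (k.right.apply_self_of_mem k.std
      (k.right.slL_mem_algG k.std hξ ζ)), k.std.counit_slL, LinearMap.smul_apply,
      Module.End.one_apply]

/-- `a` fixes `η ⊗ ξ` for `ξ ∈ H^f`. -/
theorem aa_apply_of_mem_upperSpace_left {ξ : H} (hξ : ξ ∈ upperSpace V f) (η : H) :
    endEquiv H (aa V ehat f g) (η ⊗ₜ ξ) = η ⊗ₜ ξ :=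
  op_tmul_eq_of_slL fun ζ => by
    rw [slL_aa, k.apply_of_mem_upperSpace (k.phi_mem _) hξ, k.counit_phi (slL_mem _ _ _),
      k.std.counit_slL]

/-- A vector `ξ` such that `a` fixes all `ξ ⊗ η` belongs to `H_g`. -/
theorem mem_lowerSpace_of_aa {ξ : H} (hξ : ∀ η, endEquiv H (aa V ehat f g) (ξ ⊗ₜ η) = ξ ⊗ₜ η) :
    ξ ∈ lowerSpace V g := by
  have hg : g ∈ upperSpace V g := k.right.invariant
  have h1 := k.aa_apply_of_mem_upperSpace hg ξ
  rw [hξ] at h1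
  exact h1.symm

/-- The slice is Φ of the projection onto ê, a multiple of p_f; the constant is 1 because ⟨ê, g⟩ =
⟨f, e⟩. This later detects membership of fixed vectors of W in H^g. -/
theorem slL_aa_ehat_ehat : slL (endEquiv H (aa V ehat f g)) ehat ehat = slL (op V) f f := by
  have h := k.std
  have h1 : Std.elt V ehat f = (inner ℂ f e : ℂ)⁻¹ • slL (op V) f f := by
    rw [← h.elt_apply_e (slL_mem V f f), k.left.p_e h, map_smul, smul_smul,
      inv_mul_cancel₀ k.left.inner_ne, one_smul]
  have h2 : (inner ℂ ehat g : ℂ) * (inner ℂ f e : ℂ)⁻¹ = 1 := by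
    have h3 := k.right.inner_ehat_mul h
    rw [← k.inner_mul_inner, mul_comm] at h3
    rw [mul_right_cancel₀ k.right.inner_ne ((mul_comm _ _).trans h3)]
    exact mul_inv_cancel₀ k.left.inner_ne
  rw [slL_aa, h.slL_ehat_ehat, phi_apply, LinearMap.smulRight_apply, map_smul, map_smul,
    k.left.phat_mul_ehat h, map_smul, h1, innerₛₗ_apply_apply, smul_smul, smul_smul, smul_smul]
  have h4 : (inner ℂ f ehat : ℂ)⁻¹ * inner ℂ f ehat = 1 :=
    inv_mul_cancel₀ (k.left.inner_ehat_ne h)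
  have h5 : (inner ℂ f ehat : ℂ)⁻¹ * inner ℂ ehat g * ((inner ℂ f ehat) * (inner ℂ f e)⁻¹) = 1 := by
    linear_combination h4 + (inner ℂ f ehat : ℂ)⁻¹ * inner ℂ f ehat * h2
  convert one_smul ℂ _ using 2
  rw [← h5]
  ring

/-- The right slices of `V` at `g` belong to `Ĝ_g`. -/
theorem slR_mem_subGHat (ζ : H) : slR (op V) ζ g ∈ subGHat V e ehat g := by
  have h := k.std
  refine ⟨slR_mem _ _ _, ?_⟩
  have hp := slL_mem V g g
  have h1 := h.star_conjBy_apply_e hp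
  rw [k.right.p_e h] at h1
  set z := star (conjBy (invol V e ehat) (slL (op V) g g)) with hz
  have hzc : ∀ y ∈ algS V, z * y = y * z := fun y hy => by
    have := congrArg star (h.conjBy_commute (h.star_mem hy) hp)
    rw [star_mul, star_mul, star_star, ← hz] at this
    exact this.symm
  have h2 := Std.lTensor_comm (fun ζ η => slL_mem V ζ η) hzc (ehat ⊗ₜ e)
  rw [LinearMap.lTensor_tmul, h1, TensorProduct.tmul_smul, map_smul] at h2
  have h3 := congrArg (braR ζ) h2
  rw [map_smul, braR_lTensor, hz, star_star, h.braR_op_ehat_e, ← slR_apply] at h3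
  change slR (op V) ζ g ehat ∈ (upperSpace V g).map (antipodeOperator V e)
  rw [k.right.mem_map_antip h]
  have h4 : slR (op V) ζ g ehat = (inner ℂ g e : ℂ)⁻¹ • (Std.scale H : ℂ) •
      h.antip (slL (op V) g g (invol V e ehat ζ)) := by
    rw [h.antip_apply, ← conjBy_apply, ← h3, smul_smul, inv_mul_cancel₀ k.right.inner_ne, one_smul]
  rw [h4, map_smul, map_smul, h.antip_antip]
  refine Submodule.smul_mem _ _ (Submodule.smul_mem _ _ ?_)
  rw [← slL_apply_eq_iff h.mult k.right.inner_self k.right.invariant]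
  exact k.right.p_idem h _

/-- Φ(s) depends on s only through the vector s g, so the first legs of a are right slices of V at
g. -/
theorem aa_mem_subGHat : aa V ehat f g ∈ tens (subGHat V e ehat g) ⊤ := by
  have h := k.std
  let ε := stdOrthonormalBasis ℂ H
  have key : ∀ z : Module.End ℂ H ⊗[ℂ] Module.End ℂ H, (phi V ehat f g).lTensor _ z =
      ∑ i, slR (endEquiv H z) (ε i) g ⊗ₜ
        ((inner ℂ f ehat : ℂ)⁻¹ • Std.elt V ehat (slR (op V) f f (ε i))) := by
    intro z
    induction z with
    | zero => simp
    | tmul x y =>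
      rw [LinearMap.lTensor_tmul, phi_apply]
      conv_lhs => rw [← ε.sum_repr' (y g)]
      simp only [map_sum, map_smul, Finset.smul_sum, TensorProduct.tmul_sum, slR_endEquiv_tmul,
        TensorProduct.tmul_smul, TensorProduct.smul_tmul']
    | add x y hx hy =>
      simp only [map_add, hx, hy, slR_add, TensorProduct.add_tmul, Finset.sum_add_distrib]
  rw [aa, key]
  exact Submodule.sum_mem _ fun i _ => tmul_mem_tens
    (by rw [endEquiv_vt]; exact k.slR_mem_subGHat _) Submodule.mem_top

theorem mem_subGHat_iff {y : Module.End ℂ H} :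
    y ∈ subGHat V e ehat g ↔ y ∈ algG k.std.dual.opp ehat g := by
  have h := k.std
  rw [(k.right.dual h).algG_opp h.dual]
  refine and_congr (by rw [h.algS_dual]; rfl) ?_
  change y ehat ∈ (upperSpace V g).map (antipodeOperator V e) ↔ _
  rw [k.right.mem_map_antip h,
    (k.right.dual h).mem_map_antip h.dual, lowerSpace_dual, h.antip_apply, h.dual.antip_apply,
    dual_dual, h.invol_comm]

theorem mul_mem_subGHat {x y : Module.End ℂ H} (hx : x ∈ subGHat V e ehat g)
    (hy : y ∈ subGHat V e ehat g) : x * y ∈ subGHat V e ehat g := by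
  rw [k.mem_subGHat_iff] at *
  exact ((k.right.dual k.std).opp k.std.dual).mul_mem k.std.dual.std_opp hx hy

theorem star_mem_subGHat {x : Module.End ℂ H} (hx : x ∈ subGHat V e ehat g) :
    star x ∈ subGHat V e ehat g := by
  rw [k.mem_subGHat_iff] at *
  exact ((k.right.dual k.std).opp k.std.dual).star_mem k.std.dual.std_opp hx

theorem conjBy_p_apply {y : Module.End ℂ H} (hy : y ∈ subGHat V e ehat g) :
    conjBy (invol V e ehat) (slL (op V) g g) (y ehat) = y ehat := by
  have h := k.std
  have h1 : h.antip (y ehat) ∈ upperSpace V g := (k.right.mem_map_antip h).1 hy.2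
  have h2 := k.right.invol_dual_mem_upperSpace h h1
  have h3 := h.dual.invol_invol (invol V e ehat (y ehat))
  rw [← h.antip_apply] at h3
  rw [h3, ← slL_apply_eq_iff h.mult k.right.inner_self k.right.invariant] at h2
  rw [conjBy_apply, h2, h.invol_invol]

theorem star_aa_mul_aa_commute {u : Module.End ℂ H} (hu : u ∈ algG V e f) :
    (star (aa V ehat f g) * aa V ehat f g) * (u ⊗ₜ 1) =
      (u ⊗ₜ 1) * (star (aa V ehat f g) * aa V ehat f g) := by
  have h1 := congrArg star (k.aa_mul (k.left.star_mem k.std hu))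
  rw [star_mul, star_mul, star_copr, TensorProduct.star_tmul, star_star, star_one] at h1
  rw [mul_assoc, k.aa_mul hu, ← mul_assoc, ← h1, mul_assoc]

/-- M = a*a has first leg in Ĝ_g and commutes with G_f ⊗ 1. This puts M(ê ⊗ θ) in the ranges of p_f
⊗ 1 and of Tp_gT ⊗ 1, whose product is the projection onto ê; since ê separates Ŝ, M = 1 ⊗ N.
Finally N = 1 because a fixes e ⊗ η. -/
theorem star_aa_mul_aa : star (aa V ehat f g) * aa V ehat f g = 1 := by
  have h := k.std
  set M := star (aa V ehat f g) * aa V ehat f g with hM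
  have hMY : M ∈ tens (subGHat V e ehat g) ⊤ :=
    mul_mem_tens (fun x hx y hy => k.mul_mem_subGHat hx hy) (fun _ _ _ _ => Submodule.mem_top)
      (star_mem_tens (fun x hx => k.star_mem_subGHat hx)
        (fun _ _ => Submodule.mem_top (R := ℂ)) k.aa_mem_subGHat) k.aa_mem_subGHat
  have h1 : ∀ θ, endEquiv H M (ehat ⊗ₜ θ) =
      ehat ⊗ₜ braL ehat (endEquiv H M (ehat ⊗ₜ θ)) := by
    intro θ
    have hz : (conjBy (invol V e ehat) (slL (op V) g g)).rTensor H (endEquiv H M (ehat ⊗ₜ θ)) =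
        endEquiv H M (ehat ⊗ₜ θ) := by
      refine tens_induction (p := fun M => (conjBy (invol V e ehat) (slL (op V) g g)).rTensor H
        (endEquiv H M (ehat ⊗ₜ θ)) = endEquiv H M (ehat ⊗ₜ θ)) hMY (by simp)
        (fun y hy x _ => ?_) fun x y hx hy => by
          simp only [map_add, LinearMap.add_apply, hx, hy]
      rw [endEquiv_tmul, TensorProduct.map_tmul, LinearMap.rTensor_tmul, k.conjBy_p_apply hy]
    have hp : (slL (op V) f f).rTensor H (endEquiv H M (ehat ⊗ₜ θ)) =
        endEquiv H M (ehat ⊗ₜ θ) := by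
      have h2 := congrArg (fun T => endEquiv H T (ehat ⊗ₜ θ))
        (k.star_aa_mul_aa_commute (k.left.p_mem h))
      simp only [map_mul, Module.End.mul_apply, endEquiv_tmul_one, LinearMap.rTensor_tmul,
        k.left.p_ehat h] at h2
      rw [hM, map_mul, Module.End.mul_apply]
      exact h2.symm
    rw [← hp]
    conv_lhs => rw [← hz]
    rw [← LinearMap.comp_apply, ← LinearMap.rTensor_comp, ← Module.End.mul_eq_comp,
      k.p_mul_conjBy_p, hp]
    generalize endEquiv H M (ehat ⊗ₜ θ) = w
    induction w with
    | zero => simp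
    | tmul x y =>
      simp [TensorProduct.smul_tmul']
    | add x y hx hy => simp only [map_add, hx, hy, TensorProduct.tmul_add]
  obtain ⟨N, hN⟩ : ∃ N : H → H, ∀ θ, endEquiv H M (ehat ⊗ₜ θ) = ehat ⊗ₜ N θ := ⟨_, h1⟩
  -- The right slices of M lie in Ŝ, and an element of Ŝ is determined by its value at ê.
  have h2 : ∀ ζ η, slR (endEquiv H M) ζ η = (inner ℂ ζ (N η) : ℂ) • 1 := by
    intro ζ η
    have hm : slR (endEquiv H M) ζ η ∈ subGHat V e ehat g := slR_mem_of_mem_tens hMY ζ η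
    refine h.dual.eq_of_apply_e (by rw [h.algS_dual]; exact hm.1)
      (Submodule.smul_mem _ _ h.dual.one_mem) ?_
    rw [slR_apply, hN, braR_tmul]
    rfl
  have h3 : ∀ ζ η, inner ℂ (e ⊗ₜ[ℂ] ζ) (endEquiv H M (e ⊗ₜ η)) = (inner ℂ ζ η : ℂ) := by
    intro ζ η
    rw [hM, map_mul, Module.End.mul_apply, k.aa_apply_e, endEquiv_star, inner_star_right,
      k.aa_apply_e, TensorProduct.inner_tmul, h.inner_ee, one_mul]
  apply (endEquiv H).injective
  refine ext_slR fun ζ η => ?_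
  have h4 := inner_slR (endEquiv H M) ζ η e e
  rw [h3, h2, LinearMap.smul_apply, Module.End.one_apply, inner_smul_right, h.inner_ee,
    mul_one] at h4
  rw [h2, h4, map_one]
  ext θ
  simp [slR_apply]

end Pair

theorem lTensor_lTensor_lg {A : Type*} [Ring A] [Algebra ℂ A] (Φ : A →ₗ[ℂ] A) (w z : A ⊗[ℂ] A) :
    (Φ.lTensor A).lTensor A (lg j₁ j₂ c₁₂ w * lg j₁ j₃ c₁₃ z) =
      lg j₁ j₂ c₁₂ w * lg j₁ j₃ c₁₃ (Φ.lTensor A z) := by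
  induction w with
  | zero => simp
  | add x y hx hy => simp only [map_add, add_mul, hx, hy]
  | tmul x y =>
    induction z with
    | zero => simp
    | add x y hx hy => simp only [map_add, mul_add, hx, hy]
    | tmul x' y' =>
      rw [LinearMap.lTensor_tmul, lg_j₁₂_tmul, lg_j₁₃_tmul, lg_j₁₃_tmul]
      simp

theorem lg_conj_eq_lTensor {A : Type*} [Ring A] [Algebra ℂ A] (v v' z : A ⊗[ℂ] A)
    {F : A →ₗ[ℂ] A ⊗[ℂ] A} (hF : ∀ x, F x = v * (x ⊗ₜ 1) * v') :
    lg j₂ j₃ c₂₃ v * lg j₁ j₂ c₁₂ z * lg j₂ j₃ c₂₃ v' = F.lTensor A z := by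
  induction z with
  | zero => simp
  | add x y hx hy => simp only [map_add, mul_add, add_mul, hx, hy]
  | tmul x y =>
    rw [lg_j₂₃, lg_j₂₃, lg_j₁₂_tmul, LinearMap.lTensor_tmul, hF]
    simp

theorem lTensor_mul_j₂ {A : Type*} [Ring A] [Algebra ℂ A] (z : A ⊗[ℂ] (A ⊗[ℂ] A)) (q : A) :
    z * j₂ q = (LinearMap.mulRight ℂ (q ⊗ₜ[ℂ] (1 : A))).lTensor A z := by
  induction z with
  | zero => simp
  | add x y hx hy => simp only [map_add, add_mul, hx, hy]
  | tmul x y => simp [j₂_apply]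

/-- Apply Φ in the last leg of V₁₂V₁₃ = V₂₃V₁₂V₂₃*. The left side becomes V₁₂a₁₃ and the right side
(id ⊗ (id ⊗ Φ)Δ)(V); `hΦ` lets Φ pass to the inside of Δ once q is present. -/
theorem conj_lTensor_mul {A : Type*} [Ring A] [Algebra ℂ A] {v v' : A ⊗[ℂ] A} {q : A}
    {S : Submodule ℂ A} {Φ : A →ₗ[ℂ] A} {F : A →ₗ[ℂ] A ⊗[ℂ] A}
    (hF : ∀ x, F x = v * (x ⊗ₜ 1) * v') (hv : v ∈ tens ⊤ S) (hp : Pentagon v) (hvv' : v * v' = 1)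
    (hΦ : ∀ s ∈ S, F (Φ s) * (q ⊗ₜ 1) = Φ.lTensor A (F s) * (q ⊗ₜ 1)) :
    lg j₂ j₃ c₂₃ v * lg j₁ j₂ c₁₂ (Φ.lTensor A v) * lg j₂ j₃ c₂₃ v' * j₂ q =
      lg j₁ j₂ c₁₂ v * lg j₁ j₃ c₁₃ (Φ.lTensor A v) * j₂ q := by
  have h1 : lg j₁ j₂ c₁₂ v * lg j₁ j₃ c₁₃ v = lg j₂ j₃ c₂₃ v * lg j₁ j₂ c₁₂ v * lg j₂ j₃ c₂₃ v' := by
    rw [← hp, mul_assoc _ (lg j₂ j₃ c₂₃ v), ← map_mul (lg j₂ j₃ c₂₃), hvv', map_one, mul_one]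
  rw [← lTensor_lTensor_lg, h1, lg_conj_eq_lTensor v v' _ hF, lg_conj_eq_lTensor v v' _ hF,
    lTensor_mul_j₂, lTensor_mul_j₂]
  simp only [← LinearMap.comp_apply, ← LinearMap.lTensor_comp]
  exact lTensor_eq_of_mem hΦ hv

/-- The compatibility of Φ with Δ next to p_g ⊗ 1 is checked on products ud: both ΔΦ(ud) and (id ⊗
Φ)Δ(ud) become ε(d)Δ(u)(p_g ⊗ 1). -/
theorem Pair.conj_aa (k : Pair V e ehat f g) :
    lg j₂ j₃ c₂₃ (vt V) * lg j₁ j₂ c₁₂ (aa V ehat f g) * lg j₂ j₃ c₂₃ (vt V.symm) *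
        j₂ (slL (op V) g g) =
      lg j₁ j₂ c₁₂ (vt V) * lg j₁ j₃ c₁₃ (aa V ehat f g) * j₂ (slL (op V) g g) := by
  refine conj_lTensor_mul (S := algS V) (copr_apply V) (vt_mem_tens_algS V)
    ((isMultiplicative_iff V).1 k.std.mult) (vt_mul_vt_symm V) fun s hs => ?_
  refine k.eqOn_algS (F := LinearMap.mulRight ℂ (slL (op V) g g ⊗ₜ[ℂ] (1 : Module.End ℂ H)) ∘ₗ
    copr V ∘ₗ phi V ehat f g) (G := LinearMap.mulRight ℂ (slL (op V) g g ⊗ₜ[ℂ]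
    (1 : Module.End ℂ H)) ∘ₗ (phi V ehat f g).lTensor _ ∘ₗ copr V) (fun u hu d hd => ?_) hs
  simp only [LinearMap.comp_apply, LinearMap.mulRight_apply]
  rw [k.phi_mul_mem_algD hu hd, copr_mul, lTensor_mul_left
    (fun u hu s => k.phi_mul hu s) (k.left.copr_mem_subG k.std hu), mul_assoc,
    ← lTensor_mul_tmul_one, k.copr_mul_p_of_mem_algD hd, LinearMap.lTensor_tmul,
    k.phi_of_mem_algD hd, map_smul, smul_mul_assoc, TensorProduct.tmul_smul, mul_smul_comm]

end MultUnitary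

end

/-! ### The unitary b and the algebraic data of the pair -/

noncomputable section

namespace MultUnitary

set_option linter.unusedSectionVars false

variable {H : Type*} [NormedAddCommGroup H] [InnerProductSpace ℂ H] [FiniteDimensional ℂ H]
variable {V : (H ⊗[ℂ] H) ≃ₗᵢ[ℂ] (H ⊗[ℂ] H)} {e ehat f g : H}

namespace Std

variable (h : Std V e ehat)

/-- `S` as a subalgebra. -/
def subalg : Subalgebra ℂ (Module.End ℂ H) :=
  (algS V).toSubalgebra h.one_mem fun _ _ hx hy => h.mul_mem hx hy

include h

theorem antip_ehat : h.antip ehat = ehat := by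
  rw [h.antip_apply, h.invol_ehat, h.dual.invol_e]

/-- By `conjBy_slL` for the dual, the involution of V exchanges the two vectors of a slice
generating Ŝ. -/
theorem conjBy_invol_mem {m : Module.End ℂ H} (hm : m ∈ algSHat V) :
    conjBy (invol V e ehat) m ∈ algSHat V := by
  rw [← h.algS_dual] at *
  rw [algS_eq_span] at hm
  induction hm using Submodule.span_induction with
  | mem x hx =>
    obtain ⟨⟨ζ, η⟩, rfl⟩ := hx
    have := h.dual.conjBy_slL η ζ
    rw [dual_dual] at this
    rw [this]
    exact slL_mem _ _ _
  | zero =>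
    convert zero_mem (algS (MultUnitary.dual V))
    ext ξ
    simp [conjBy_apply]
  | add x y _ _ hx hy =>
    convert add_mem hx hy
    ext ξ
    simp [conjBy_apply]
  | smul c x _ hx =>
    convert Submodule.smul_mem _ (starRingEnd ℂ c) hx
    ext ξ
    simp [conjBy_apply]

/-- `U Ŝ U` commutes with `Ŝ`. -/
theorem commute_of_conj_mem {y z : Module.End ℂ H} (hy : y ∈ algSHat V)
    (hz : h.U * z * h.U ∈ algSHat V) : Commute y z := by
  have h1 : z = conjBy (invol (MultUnitary.dual V) ehat e)
      (conjBy (invol V e ehat) (h.U * z * h.U)) := by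
    have h2 : z = h.U * (h.U * z * h.U) * h.U := by
      calc z = (h.U * h.U) * z * (h.U * h.U) := by rw [h.U_mul_U, one_mul, mul_one]
        _ = _ := by simp only [mul_assoc]
    conv_lhs => rw [h2]
    ext ξ
    rw [conjBy_apply, conjBy_apply, ← h.invol_comm ξ, ← h.antip_apply, ← h.antip_apply]
    rfl
  have h3 := h.conjBy_invol_mem hz
  rw [← h.algS_dual] at h3 hy
  rw [h1]
  exact (h.dual.conjBy_commute hy h3).symm

end Std

/-- `x ↦ F(x*)*`. -/
def starConj (F : Module.End ℂ H →ₗ[ℂ] Module.End ℂ H) : Module.End ℂ H →ₗ[ℂ] Module.End ℂ H where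
  toFun x := star (F (star x))
  map_add' x y := by rw [star_add, map_add, star_add]
  map_smul' c x := by rw [star_smul, map_smul, star_smul, star_star, RingHom.id_apply]

/-- A left inverse of `u ↦ u p_g` on `G_f`. -/
def lam (V : (H ⊗[ℂ] H) ≃ₗᵢ[ℂ] (H ⊗[ℂ] H)) (e ehat f g : H) :
    Module.End ℂ H →ₗ[ℂ] Module.End ℂ H :=
  ((inner ℂ g e : ℂ)⁻¹ * (inner ℂ f ehat : ℂ)⁻¹) •
    (Std.elt V ehat ∘ₗ slR (op V) f f ∘ₗ LinearMap.applyₗ e)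

theorem Pair.lam_mul_p (k : Pair V e ehat f g) {u : Module.End ℂ H} (hu : u ∈ algG V e f) :
    lam V e ehat f g (u * slL (op V) g g) = u := by
  have h1 := k.phi_of_mem hu
  rw [phi_apply] at h1
  simp only [lam, LinearMap.smul_apply, LinearMap.comp_apply, LinearMap.applyₗ_apply_apply,
    Module.End.mul_apply, k.right.p_e k.std, map_smul]
  rw [smul_smul, mul_right_comm, inv_mul_cancel₀ k.right.inner_ne, one_mul, h1]

theorem star_lg {A : Type*} [Ring A] [StarRing A] [Algebra ℂ A] [StarModule ℂ A]
    {i j : A →ₐ[ℂ] A ⊗[ℂ] (A ⊗[ℂ] A)} (hij : Cm i j) (hi : ∀ x, star (i x) = i (star x))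
    (hj : ∀ x, star (j x) = j (star x)) (z : A ⊗[ℂ] A) :
    star (lg i j hij z) = lg i j hij (star z) := by
  induction z with
  | zero => simp
  | tmul x y => rw [lg_tmul, star_mul, hi, hj, TensorProduct.star_tmul, lg_tmul, (hij _ _).eq]
  | add x y hx hy => rw [map_add, star_add, hx, hy, star_add, map_add]

section
variable {A : Type*} [Ring A] [StarRing A] [Algebra ℂ A] [StarModule ℂ A] (x : A)

theorem star_j₁ : star (j₁ x) = j₁ (star x) := by
  rw [j₁_apply, j₁_apply, TensorProduct.star_tmul, TensorProduct.star_tmul, star_one]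

theorem star_j₂ : star (j₂ x) = j₂ (star x) := by
  rw [j₂_apply, j₂_apply, TensorProduct.star_tmul, TensorProduct.star_tmul, star_one]

theorem star_j₃ : star (j₃ x) = j₃ (star x) := by
  rw [j₃_apply, j₃_apply, TensorProduct.star_tmul, TensorProduct.star_tmul, star_one]

/-- Taking adjoints and reversing the legs. -/
theorem conj_lg_reverse {v v' a : A ⊗[ℂ] A} {q : A} (hq : star q = q) (hv : star v = v')
    (hv' : star v' = v)
    (h : lg j₂ j₃ c₂₃ v * lg j₁ j₂ c₁₂ a * lg j₂ j₃ c₂₃ v' * j₂ q =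
      lg j₁ j₂ c₁₂ v * lg j₁ j₃ c₁₃ a * j₂ q) :
    j₂ q * lg j₁ j₂ c₁₂ (Algebra.TensorProduct.comm ℂ A A v) *
        lg j₂ j₃ c₂₃ (Algebra.TensorProduct.comm ℂ A A (star a)) *
        lg j₁ j₂ c₁₂ (Algebra.TensorProduct.comm ℂ A A v') =
      j₂ q * lg j₁ j₃ c₁₃ (Algebra.TensorProduct.comm ℂ A A (star a)) *
        lg j₂ j₃ c₂₃ (Algebra.TensorProduct.comm ℂ A A v') := by
  have h1 := congrArg star h
  simp only [star_mul, star_lg c₁₂ star_j₁ star_j₂, star_lg c₁₃ star_j₁ star_j₃,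
    star_lg c₂₃ star_j₂ star_j₃, star_j₂, hq, hv, hv'] at h1
  have h2 := congrArg (lg3 (c₂₃ (A := A)).symm c₁₃.symm c₁₂.symm) h1
  simp only [map_mul, lg3_lg₁₂, lg3_lg₁₃, lg3_lg₂₃, lg3_j₂] at h2
  have hc : ∀ z : A ⊗[ℂ] A, Algebra.TensorProduct.comm ℂ A A (Algebra.TensorProduct.comm ℂ A A z) =
      z := fun z => (Algebra.TensorProduct.comm ℂ A A).symm_apply_apply z
  simp only [← lg_comm c₁₂, ← lg_comm c₁₃, ← lg_comm c₂₃, hc, mul_assoc]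
  simpa only [mul_assoc] using h2

end

namespace Pair

variable (k : Pair V e ehat f g)

/-- The unitary `b`: the flip of the adjoint of the unitary `a` of the opposite of `V`. -/
def bb : Module.End ℂ H ⊗[ℂ] Module.End ℂ H :=
  Algebra.TensorProduct.comm ℂ _ _ (star (aa k.std.opp ehat g f))

include k

theorem star_bb_mul_bb : star k.bb * k.bb = 1 := by
  have h1 := k.opp.symm.star_aa_mul_aa
  have h2 : aa k.std.opp ehat g f * star (aa k.std.opp ehat g f) = 1 := by
    have := congrArg (endEquiv H) h1
    rw [map_mul, map_one] at this
    apply (endEquiv H).injective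
    rw [map_mul, map_one]
    exact mul_eq_one_comm.1 this
  rw [bb, ← comm_star, star_star, ← map_mul, h2, map_one]

theorem mem_algG_of_mem_subG_opp {d : Module.End ℂ H} (hd : d ∈ subG k.std.opp e g) :
    d ∈ algD V e g := k.mem_algG_opp.1 hd

theorem star_mem_subG_opp {d : Module.End ℂ H} (hd : d ∈ subG k.std.opp e g) :
    star d ∈ subG k.std.opp e g :=
  (k.right.opp k.std).star_mem k.std.std_opp hd

theorem bb_mem : k.bb ∈ tens (subG k.std.opp e g) ⊤ :=
  comm_mem_tens (star_mem_tens (fun _ _ => Submodule.mem_top)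
    (fun _ hx => k.star_mem_subG_opp hx) k.opp.symm.aa_mem)

theorem bb_mem' : k.bb ∈ tens ⊤ (subGHat k.std.opp e ehat f) :=
  comm_mem_tens (star_mem_tens (fun _ hx => k.opp.symm.star_mem_subGHat hx)
    (fun _ _ => Submodule.mem_top) k.opp.symm.aa_mem_subGHat)

theorem conj_mem_of_mem_subGHat_opp {z : Module.End ℂ H}
    (hz : z ∈ subGHat k.std.opp e ehat f) : k.std.U * z * k.std.U ∈ algDHat V ehat f := by
  have h := k.std
  refine ⟨h.mem_algSHat_opp.1 hz.1, ?_⟩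
  have h1 : z ehat ∈ (upperSpace h.opp f).map (antipodeOperator h.opp e) := hz.2
  rw [(k.left.opp h).mem_map_antip h.std_opp, h.antip_opp, k.left.mem_upperSpace_opp h] at h1
  change h.antip (z (h.antip ehat)) ∈ _
  rwa [h.antip_ehat]

theorem p_mul_bb : (slL (op V) f f ⊗ₜ 1) * k.bb =
    (slL (op V) f f ⊗ₜ 1) * Algebra.TensorProduct.comm ℂ _ _ (vt k.std.opp.symm) := by
  have h1 := congrArg star k.opp.symm.aa_mul_p
  rw [star_mul, star_mul, k.slL_opp_self, TensorProduct.star_tmul, star_one, k.left.star_p k.std,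
    star_vt] at h1
  have h2 := congrArg (Algebra.TensorProduct.comm ℂ _ _) h1
  rwa [map_mul, map_mul, Algebra.TensorProduct.comm_tmul] at h2

theorem bb_mul_copr {d : Module.End ℂ H} (hd : d ∈ subG k.std.opp e g) :
    k.bb * copr V d = (1 ⊗ₜ d) * k.bb := by
  have h1 := congrArg star (k.opp.symm.aa_mul (k.star_mem_subG_opp hd))
  rw [star_mul, star_mul, TensorProduct.star_tmul, star_one, star_star, star_copr, star_star] at h1
  have h2 := congrArg (Algebra.TensorProduct.comm ℂ _ _) h1
  rw [map_mul, map_mul, Algebra.TensorProduct.comm_tmul,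
    k.std.comm_copr_opp (k.mem_algG_of_mem_subG_opp hd).1] at h2
  exact h2.symm

/-- The companion w is the flip of the adjoint of the opposite unitary, chosen so that w*(1 ⊗ x)w =
Δ(x). Every property of b is the corresponding property of a for the opposite with f and g
exchanged, after a star and a flip; in particular `T1` is `T2` reversed. -/
theorem data : Data (vt V) (vt V.symm) (Algebra.TensorProduct.comm ℂ _ _ (vt k.std.opp.symm))
    (Algebra.TensorProduct.comm ℂ _ _ (vt k.std.opp)) (aa V ehat f g) k.bb (slL (op V) f f)
    (slL (op V) g g) k.std.subalg (subG V e f) (subG k.std.opp e g) (subGHat V e ehat g)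
    (subGHat k.std.opp e ehat f) (LinearMap.mul' ℂ _ ∘ₗ TensorProduct.map (lam V e ehat f g)
      (starConj (lam k.std.opp e ehat g f))) where
  vv' := vt_mul_vt_symm V
  v'v := vt_symm_mul_vt V
  ww' := by rw [← map_mul, vt_symm_mul_vt, map_one]
  pent := (isMultiplicative_iff V).1 k.std.mult
  copr x hx := by
    have h1 := k.std.comm_copr_opp hx
    rw [copr_apply, copr_apply, map_mul, map_mul, Algebra.TensorProduct.comm_tmul] at h1
    exact h1
  copr_mem x hx := by rw [← copr_apply]; exact k.std.copr_mem hx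
  G_le := inf_le_left
  D_le x hx := (k.mem_algG_of_mem_subG_opp hx).1
  a_mem := k.aa_mem
  a_mem' := k.aa_mem_subGHat
  b_mem := k.bb_mem
  b_mem' := k.bb_mem'
  YZ y hy z hz := k.std.commute_of_conj_mem hy.1 (k.conj_mem_of_mem_subGHat_opp hz).1
  a_q := k.aa_mul_p
  p_b := k.p_mul_bb
  a_G u hu := by rw [← copr_apply]; exact k.aa_mul hu
  b_D d hd := by rw [← copr_apply]; exact k.bb_mul_copr hd
  p_copr u hu := by rw [← copr_apply]; exact k.p_mul_copr hu
  copr_q d hd := by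
    rw [← copr_apply]; exact k.copr_mul_p_of_mem_algD (k.mem_algG_of_mem_subG_opp hd)
  T1 := by
    have h1 := k.opp.symm.conj_aa
    rw [k.slL_opp_self] at h1
    exact conj_lg_reverse (k.left.star_p k.std) (star_vt _)
      (by rw [star_vt, LinearIsometryEquiv.symm_symm]) h1
  T2 := k.conj_aa
  -- For s = ud the argument of Γ is u p_g ⊗ p_f d. `lam` recovers u from the first leg, its starred
  -- version for the opposite recovers d from the second, and multiplication returns ud.
  left_inv s hs := by
    rw [← copr_apply]
    refine k.eqOn_algS (F := (LinearMap.mul' ℂ _ ∘ₗ TensorProduct.map (lam V e ehat f g)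
      (starConj (lam k.std.opp e ehat g f))) ∘ₗ
      LinearMap.mulRight ℂ (slL (op V) g g ⊗ₜ[ℂ] (1 : Module.End ℂ H)) ∘ₗ
      LinearMap.mulLeft ℂ ((1 : Module.End ℂ H) ⊗ₜ[ℂ] slL (op V) f f) ∘ₗ copr V)
      (G := LinearMap.id) (fun u hu d hd => ?_) hs
    simp only [LinearMap.comp_apply, LinearMap.mulRight_apply, LinearMap.mulLeft_apply]
    have hd' := k.star_mem_subG_opp (k.mem_algG_opp.2 hd)
    have h1 : starConj (lam k.std.opp e ehat g f) (slL (op V) f f * d) = d := by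
      change star (lam k.std.opp e ehat g f (star (slL (op V) f f * d))) = d
      have := k.opp.symm.lam_mul_p hd'
      rw [k.slL_opp_self] at this
      rw [star_mul, k.left.star_p k.std, this, star_star]
    rw [copr_mul, ← mul_assoc, k.p_mul_copr hu, mul_assoc, k.copr_mul_p_of_mem_algD hd,
      Algebra.TensorProduct.tmul_mul_tmul, TensorProduct.map_tmul, k.lam_mul_p hu, h1,
      LinearMap.mul'_apply, LinearMap.id_apply]

end Pair

end MultUnitary

end

noncomputable section

namespace MultUnitary

set_option linter.unusedSectionVars false

variable {H : Type*} [NormedAddCommGroup H] [InnerProductSpace ℂ H] [FiniteDimensional ℂ H]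
variable {V : (H ⊗[ℂ] H) ≃ₗᵢ[ℂ] (H ⊗[ℂ] H)} {e ehat f g : H}

/-! ### The multiplicative unitary `W = b a` -/

theorem exists_vt_eq {T : Module.End ℂ H ⊗[ℂ] Module.End ℂ H} (hT : star T * T = 1) :
    ∃ W : (H ⊗[ℂ] H) ≃ₗᵢ[ℂ] (H ⊗[ℂ] H), vt W = T := by
  have h1 : ∀ x y, inner ℂ (endEquiv H T x) (endEquiv H T y) = inner ℂ x y := by
    intro x y
    rw [← inner_star_right, ← endEquiv_star, ← Module.End.mul_apply, ← map_mul, hT, map_one,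
      Module.End.one_apply]
  refine ⟨((endEquiv H T).isometryOfInner h1).toLinearIsometryEquiv rfl, ?_⟩
  apply (endEquiv H).injective
  rw [endEquiv_vt]
  rfl

theorem finrank_span_mul_le (F : Module.End ℂ H →ₗ[ℂ] Module.End ℂ H)
    (P Q : Submodule ℂ (Module.End ℂ H)) :
    Module.finrank ℂ (Submodule.span ℂ {z | ∃ x ∈ P, ∃ y ∈ Q, z = F x * y}) ≤
      Module.finrank ℂ P * Module.finrank ℂ Q := by
  let B : P ⊗[ℂ] Q →ₗ[ℂ] Module.End ℂ H :=
    LinearMap.mul' ℂ _ ∘ₗ TensorProduct.map (F ∘ₗ P.subtype) Q.subtype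
  have h1 : Submodule.span ℂ {z | ∃ x ∈ P, ∃ y ∈ Q, z = F x * y} ≤ LinearMap.range B := by
    rw [Submodule.span_le]
    rintro _ ⟨x, hx, y, hy, rfl⟩
    exact ⟨(⟨x, hx⟩ : P) ⊗ₜ (⟨y, hy⟩ : Q), by simp [B]⟩
  calc _ ≤ Module.finrank ℂ (LinearMap.range B) := Submodule.finrank_mono h1
    _ ≤ Module.finrank ℂ (P ⊗[ℂ] Q) := LinearMap.finrank_range_le B
    _ = _ := Module.finrank_tensorProduct

theorem finrank_inf_comap_le {N : Submodule ℂ (Module.End ℂ H)} {ξ : H}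
    (hN : ∀ x ∈ N, x ξ = 0 → x = 0) (L : Submodule ℂ H) :
    Module.finrank ℂ (N ⊓ L.comap (LinearMap.applyₗ ξ) : Submodule ℂ (Module.End ℂ H)) ≤
      Module.finrank ℂ L := by
  let B : (N ⊓ L.comap (LinearMap.applyₗ ξ) : Submodule ℂ (Module.End ℂ H)) →ₗ[ℂ] L :=
    LinearMap.codRestrict L ((LinearMap.applyₗ ξ) ∘ₗ Submodule.subtype _) fun x => x.2.2
  refine LinearMap.finrank_le_finrank_of_injective (f := B) ?_
  rw [injective_iff_map_eq_zero]
  intro x hx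
  exact Subtype.ext (hN x x.2.1 (congrArg Subtype.val hx))

namespace Std

theorem of_multiplicity (hV : IsMultiplicative V)
    (hV1 : multiplicity V = 1) (he : IsFixed V e) (hehat : IsCofixed V ehat) (he1 : ‖e‖ = 1)
    (hehat1 : ‖ehat‖ = 1)
    (hi : inner ℂ e ehat = (((√(Module.finrank ℂ H : ℝ))⁻¹ : ℝ) : ℂ)) : Std V e ehat where
  mult := hV
  fixed := he
  cofixed := hehat
  norm_e := he1
  norm_ehat := hehat1
  inner_eq := hi
  uniq ξ hξ := by
    have h0 : e ≠ 0 := by rintro rfl; simp at he1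
    have h1 : (⟨e, (mem_fixedSpace V e).2 he⟩ : fixedSpace V) ≠ 0 := fun h =>
      h0 (congrArg Subtype.val h)
    obtain ⟨c, hc⟩ := (finrank_eq_one_iff_of_nonzero' _ h1).1 hV1
      ⟨ξ, (mem_fixedSpace V ξ).2 hξ⟩
    exact Submodule.mem_span_singleton.2 ⟨c, congrArg Subtype.val hc⟩

variable (h : Std V e ehat)
include h

theorem eq_zero_of_apply_e {x : Module.End ℂ H} (hx : x ∈ algS V) (h0 : x e = 0) : x = 0 :=
  h.eq_of_apply_e hx (zero_mem _) (by rw [h0, LinearMap.zero_apply])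

theorem eq_zero_of_apply_ehat {x : Module.End ℂ H} (hx : x ∈ algSHat V) (h0 : x ehat = 0) :
    x = 0 :=
  h.dual.eq_zero_of_apply_e (by rwa [h.algS_dual]) h0

theorem multiplicity_eq_one : multiplicity V = 1 := by
  have h1 : fixedSpace V = Submodule.span ℂ {e} := by
    refine le_antisymm (fun ξ hξ => h.uniq ξ ((mem_fixedSpace V ξ).1 hξ)) ?_
    rw [Submodule.span_singleton_le_iff_mem, mem_fixedSpace]
    exact h.fixed
  rw [multiplicity, h1, finrank_span_singleton h.e_ne]

/-- `V` is determined by its fixed and cofixed vectors and its two algebras. -/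
theorem eq_of_algS_eq {W : (H ⊗[ℂ] H) ≃ₗᵢ[ℂ] (H ⊗[ℂ] H)} (h' : Std W e ehat)
    (hS : algS W = algS V) (hS' : algSHat W = algSHat V) : W = V := by
  refine op_injective (ext_slR fun ζ η => ?_)
  rw [← sub_eq_zero]
  set y := slR (op W) ζ η - slR (op V) ζ η with hy
  have hm : y ∈ algS (MultUnitary.dual V) := by
    rw [h.algS_dual]
    exact sub_mem (hS' ▸ slR_mem W ζ η) (slR_mem V ζ η)
  -- For x ∈ S the vector (⟨ê| ⊗ 1)V(x e ⊗ η) is n^{-1/2} xη by `braL_ehat`, with no further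
  -- reference to V; the same formula holds for W.
  have h0 : star y ehat = 0 := by
    refine ext_inner_right ℂ fun ξ => ?_
    obtain ⟨x, hx, rfl⟩ := h.exists_apply_e ξ
    rw [inner_star_left, inner_zero_left, hy, LinearMap.sub_apply, inner_sub_right, inner_slR,
      inner_slR, ← inner_braL, ← inner_braL, h.braL_ehat hx, h'.braL_ehat (by rwa [hS]), sub_self]
  rw [← star_star y, h.dual.eq_zero_of_apply_e (h.dual.star_mem hm) h0, star_zero]

end Std

namespace Pair

variable (k : Pair V e ehat f g)
include k

theorem bb_apply_iff (ξ θ : H) : endEquiv H k.bb (ξ ⊗ₜ θ) = ξ ⊗ₜ θ ↔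
    endEquiv H (aa k.std.opp ehat g f) (θ ⊗ₜ ξ) = θ ⊗ₜ ξ := by
  have h1 := congrArg (endEquiv H) k.opp.symm.star_aa_mul_aa
  rw [map_mul, map_one] at h1
  have h2 := mul_eq_one_comm.1 h1
  rw [bb, lTensor_endEquiv_comm_apply]
  constructor
  · intro hx
    have h3 : endEquiv H (star (aa k.std.opp ehat g f)) (θ ⊗ₜ ξ) = θ ⊗ₜ ξ :=
      (TensorProduct.comm ℂ H H).injective (by rw [hx, TensorProduct.comm_tmul])
    conv_lhs => rw [← h3]
    exact LinearMap.congr_fun h2 _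
  · intro hx
    have h3 := LinearMap.congr_fun h1 (θ ⊗ₜ ξ)
    rw [Module.End.mul_apply, hx, Module.End.one_apply] at h3
    rw [h3, TensorProduct.comm_tmul]

/-- If x ∈ G_g satisfies x e = ξ, then p_g x is a multiple of p_g, so ξ = p_g ξ = p_g x e is a
multiple of p_g e, hence of g. -/
theorem eq_smul_of_mem {ξ : H} (h1 : ξ ∈ lowerSpace V g) (h2 : ξ ∈ upperSpace V g) :
    ξ ∈ Submodule.span ℂ {g} := by
  have h3 := LinearMap.congr_fun (k.symm.p_apply_left (k.right.elt_mem_algG k.std h1)) e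
  rw [Module.End.mul_apply, k.std.elt_e,
    (slL_apply_eq_iff k.std.mult k.right.inner_self k.right.invariant ξ).2 h2,
    LinearMap.smul_apply, k.right.p_e k.std, smul_smul] at h3
  exact Submodule.mem_span_singleton.2 ⟨_, h3.symm⟩

theorem exists_unitary : ∃ W : (H ⊗[ℂ] H) ≃ₗᵢ[ℂ] (H ⊗[ℂ] H), vt W = k.bb * aa V ehat f g :=
  exists_vt_eq (by
    calc _ = star (aa V ehat f g) * (star k.bb * k.bb) * aa V ehat f g := by
          rw [star_mul]; simp only [mul_assoc]
      _ = 1 := by rw [k.star_bb_mul_bb, mul_one, k.star_aa_mul_aa])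

variable {W : (H ⊗[ℂ] H) ≃ₗᵢ[ℂ] (H ⊗[ℂ] H)} (hW : vt W = k.bb * aa V ehat f g)
include hW

theorem apply_eq (z : H ⊗[ℂ] H) :
    W z = endEquiv H k.bb (endEquiv H (aa V ehat f g) z) := by
  rw [← op_apply, ← endEquiv_vt, hW, map_mul, Module.End.mul_apply]

theorem std_unitary : Std W g f where
  mult := (isMultiplicative_iff W).2 (hW ▸ k.data.pentagon)
  fixed θ := by
    rw [k.apply_eq hW, k.aa_apply_of_mem_lowerSpace_right k.right.invariant, k.bb_apply_iff]
    exact k.opp.symm.aa_apply_of_mem_upperSpace_left k.opp.right.invariant θ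
  cofixed θ := by
    rw [k.apply_eq hW, k.aa_apply_of_mem_upperSpace_left k.left.invariant, k.bb_apply_iff]
    exact k.opp.symm.aa_apply_of_mem_lowerSpace_right k.opp.left.invariant θ
  norm_e := k.right.norm_eq_one
  norm_ehat := k.left.norm_eq_one
  inner_eq := k.inner_eq'
  -- Testing on ê, where a is trivial, shows that b fixes ξ ⊗ ê, and the slice at ê gives p_g ξ = ξ.
  -- Then b fixes every ξ ⊗ θ and can be cancelled, so a fixes them as well and ξ ∈ H_g.
  uniq ξ hξ := by
    have h1 := hξ ehat
    rw [k.apply_eq hW, k.aa_apply_ehat, k.bb_apply_iff] at h1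
    have h2 : ξ ∈ upperSpace V g := by
      rw [← k.right.mem_upperSpace_opp k.std, ← slL_apply_eq_iff k.opp.std.mult
        k.right.inner_self k.opp.right.invariant, ← k.opp.symm.slL_aa_ehat_ehat, slL_apply, h1,
        braL_tmul, k.std.inner_hh, one_smul]
    refine k.eq_smul_of_mem (k.mem_lowerSpace_of_aa fun θ => ?_) h2
    have h3 := hξ θ
    have h4 : endEquiv H k.bb (ξ ⊗ₜ θ) = ξ ⊗ₜ θ := (k.bb_apply_iff ξ θ).2
      (k.opp.symm.aa_apply_of_mem_upperSpace_left ((k.right.mem_upperSpace_opp k.std).2 h2) θ)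
    rw [k.apply_eq hW] at h3
    have h5 := congrArg (endEquiv H (star k.bb)) (h3.trans h4.symm)
    simp only [← Module.End.mul_apply, ← map_mul] at h5
    rwa [← mul_assoc, k.star_bb_mul_bb, one_mul, map_one, Module.End.one_apply] at h5

/-- The second legs of b and a lie in U D̂_f U and G_f, which gives one inclusion. The algebra of W
has dimension n because W is standard, while A_{f,f} has dimension at most dim H^f · dim H_f = n. -/
theorem algS_unitary : algS W = algA V e ehat f f := by
  have h := k.std
  have hA : algA V e ehat f f = Submodule.span ℂ
      {z | ∃ x ∈ algSHat V ⊓ (upperSpace V f).comap (LinearMap.applyₗ ehat), ∃ y ∈ subG V e f,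
        z = (LinearMap.mulRight ℂ h.U ∘ₗ LinearMap.mulLeft ℂ h.U) x * y} := by
    rw [algA, h.antipodeOperator_eq]
    rfl
  refine Submodule.eq_of_le_of_finrank_le (algS_le fun ζ η => ?_) ?_
  · rw [← endEquiv_vt, hW]
    refine slL_mem_of_mem_tens (mul_mem_tens (fun _ _ _ _ => Submodule.mem_top)
      (fun z hz u hu => ?_) k.bb_mem' k.aa_mem) ζ η
    refine Submodule.subset_span ⟨_, k.conj_mem_of_mem_subGHat_opp hz, u, hu, ?_⟩
    rw [h.antipodeOperator_eq]
    calc z * u = (h.U * h.U) * z * (h.U * h.U) * u := by rw [h.U_mul_U, one_mul, mul_one]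
      _ = _ := by simp only [mul_assoc]
  · rw [(k.std_unitary hW).finrank_algS, hA, ← k.left.finrank_mul h, mul_comm]
    exact (finrank_span_mul_le _ _ _).trans (Nat.mul_le_mul
      (finrank_inf_comap_le (fun x hx => h.eq_zero_of_apply_ehat hx) _)
      (finrank_inf_comap_le (fun x hx => h.eq_zero_of_apply_e hx) _))

/-- The same count for the first legs of b and a, which lie in D_g and Ĝ_g. -/
theorem algSHat_unitary : algSHat W = algB V e ehat g g := by
  have h := k.std
  have hB : algB V e ehat g g = Submodule.span ℂ
      {z | ∃ x ∈ subD V e g, ∃ y ∈ subGHat V e ehat g,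
        z = (LinearMap.id : Module.End ℂ H →ₗ[ℂ] Module.End ℂ H) x * y} := rfl
  refine Submodule.eq_of_le_of_finrank_le (algSHat_le fun ζ η => ?_) ?_
  · rw [← endEquiv_vt, hW]
    refine slR_mem_of_mem_tens (mul_mem_tens (P'' := algB V e ehat g g)
      (fun d hd y hy => ?_) (fun _ _ _ _ => Submodule.mem_top)
      k.bb_mem k.aa_mem_subGHat) ζ η
    exact Submodule.subset_span (R := ℂ) ⟨d, k.mem_algG_of_mem_subG_opp hd, y, hy, rfl⟩
  · rw [← (k.std_unitary hW).algS_dual, (k.std_unitary hW).dual.finrank_algS, hB,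
      ← k.right.finrank_mul h]
    exact (finrank_span_mul_le _ _ _).trans (Nat.mul_le_mul
      ((finrank_inf_comap_le (fun x hx => h.eq_zero_of_apply_e hx) _).trans
        (Submodule.finrank_map_le _ _))
      ((finrank_inf_comap_le (fun x hx => h.eq_zero_of_apply_ehat hx) _).trans
        (Submodule.finrank_map_le _ _)))

end Pair

end MultUnitary

end

theorem mainTheorem6 {H : Type*} [NormedAddCommGroup H] [InnerProductSpace ℂ H]
    [FiniteDimensional ℂ H]
    (V : (H ⊗[ℂ] H) ≃ₗᵢ[ℂ] (H ⊗[ℂ] H))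
    (hV : MultUnitary.IsMultiplicative V) (hV1 : MultUnitary.multiplicity V = 1)
    (e ehat : H)
    (he : MultUnitary.IsFixed V e) (he1 : ‖e‖ = 1)
    (hehat : MultUnitary.IsCofixed V ehat) (hehat1 : ‖ehat‖ = 1)
    (heehat : inner ℂ e ehat = (((√(Module.finrank ℂ H : ℝ))⁻¹ : ℝ) : ℂ))
    (f g : H)
    (hf : MultUnitary.IsPreSubgroup V e f) (hg : MultUnitary.IsPreSubgroup V e g)
    (hfg : inner ℂ f g = (((√(Module.finrank ℂ H : ℝ))⁻¹ : ℝ) : ℂ)) :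
    ∃! W : (H ⊗[ℂ] H) ≃ₗᵢ[ℂ] (H ⊗[ℂ] H),
      MultUnitary.IsMultiplicative W ∧ MultUnitary.multiplicity W = 1 ∧
      MultUnitary.IsFixed W g ∧ MultUnitary.IsCofixed W f ∧
      MultUnitary.algS W = MultUnitary.algA V e ehat f f ∧
      MultUnitary.algSHat W = MultUnitary.algB V e ehat g g := by
  have h := MultUnitary.Std.of_multiplicity hV hV1 he hehat he1 hehat1 heehat
  have k : MultUnitary.Pair V e ehat f g := ⟨h, hf, hg, hfg⟩
  obtain ⟨W, hW⟩ := k.exists_unitary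
  have hs := k.std_unitary hW
  refine ⟨W, ⟨hs.mult, hs.multiplicity_eq_one, hs.fixed, hs.cofixed, k.algS_unitary hW,
    k.algSHat_unitary hW⟩, ?_⟩
  rintro W' ⟨hm, h1, hg', hf', hA, hB⟩
  -- For W the roles of e and ê are played by g and f; their inner product is again n^{-1/2}, so any
  -- competitor is standard for the same two vectors.
  have hs' := MultUnitary.Std.of_multiplicity hm h1 hg' hf' hg.norm_eq_one hf.norm_eq_one
    k.inner_eq'
  exact hs.eq_of_algS_eq hs' (hA.trans (k.algS_unitary hW).symm)
    (hB.trans (k.algSHat_unitary hW).symm)
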